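/- All rings are commutative and Noetherian. Let $R$ be a ring, and let $\mathsf D(R)$ be its derived category. An $R$-complex $X$ is homologically finite if $\bigoplus_i H_i(X)$ is a finitely generated $R$-module. A homologically finite $R$-complex $K$ is semidualizing if the homothety morphism $R\to \mathbf R\mathrm{Hom}_R(K,K)$ is an isomorphism in $\mathsf D(R)$; $\mathfrak S(R)$ denotes the set of semidualizing $R$-complexes up to isomorphism and shift in $\mathsf D(R)$. A finitely generated $R$-module $C$ is semidualizing if the homothety map $R\to \mathrm{Hom}_R(C,C)$ is an isomorphism and $\mathrm{Ext}^i_R(C,C)=0$ for all $i\ge 1$; $\mathfrak S_0(R)$ denotes the set of isomorphism classes of semidualizing $R$-modules. Write $[K]\trianglelefteq[L]$ (in $\mathfrak S(R)$ or in $\mathfrak S_0(R)$, modules being regarded as complexes in degree $0$) if $\mathbf R\mathrm{Hom}_R(L,K)$ is homologically bounded and the biduality morphism $L\to \mathbf R\mathrm{Hom}_R(\mathbf R\mathrm{Hom}_R(L,K),K)$ is an isomorphism in $\mathsf D(R)$. A bijection $\alpha$ is perfectly order-respecting if $a\trianglelefteq b\iff \alpha(a)\trianglelefteq\alpha(b)$.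 **Proposition.** Let $\varphi\colon R\to S$ and $\psi\colon S\to R$ be ring homomorphisms of finite flat dimension, that is, $\mathrm{fd}_R(S)<\infty$ and $\mathrm{fd}_S(R)<\infty$, such that $\psi\varphi=\mathrm{id}_R$ and $\ker\psi$ is contained in the Jacobson radical of $S$. Then the assignments $K\mapsto K\otimes^{\mathbf L}_R S$ and $L\mapsto L\otimes^{\mathbf L}_S R$ on semidualizing complexes induce well-defined maps $\mathfrak S(\varphi)\colon\mathfrak S(R)\to\mathfrak S(S)$ and $\mathfrak S(\psi)\colon\mathfrak S(S)\to\mathfrak S(R)$, the assignments $C\mapsto C\otimes_R S$ and $D\mapsto D\otimes_S R$ on semidualizing modules induce well-defined maps $\mathfrak S_0(\varphi)\colon\mathfrak S_0(R)\to\mathfrak S_0(S)$ and $\mathfrak S_0(\psi)\colon\mathfrak S_0(S)\to\mathfrak S_0(R)$, and all four maps are perfectly order-respecting bijections. Moreover, for every Noetherian ring $R$ and every $n\ge 0$ the natural maps $R\to R[\![X_1,\dots,X_n]\!]$ and $R[\![X_1,\dots,X_n]\!]\to R$, $X_i\mapsto 0$, satisfy these hypotheses. -/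

import Mathlib

open CategoryTheory CochainComplex.HomComplex
open scoped DirectSum

universe u

namespace SemiDual

noncomputable section

/-! Complexes of `R`-modules are indexed cohomologically: the module in homological degree `i` is
the term `X.X (-i)`. -/

section Basic

variable (R : Type u) [CommRing R]

/-- Complexes of `R`-modules. -/
abbrev Cx : Type (u + 1) := CochainComplex (ModuleCat.{u} R) ℤ

/-- The localization of the category of complexes of `R`-modules at the quasi-isomorphisms. -/
instance hasDerivedCategory : HasDerivedCategory.{u + 1} (ModuleCat.{u} R) :=
  HasDerivedCategory.standard _

end Basic

section Defs

variable {R : Type u} [CommRing R]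

/-- `X ≃ Y`: isomorphism in the derived category `D(R)`. -/
def DerivedIso (X Y : Cx R) : Prop :=
  Nonempty (DerivedCategory.Q.obj X ≅ DerivedCategory.Q.obj Y)

/-- `X ∼ Y`: isomorphism up to shift in the derived category `D(R)`. -/
def ShiftIso (X Y : Cx R) : Prop :=
  ∃ n : ℤ, DerivedIso X ((shiftFunctor (Cx R) n).obj Y)

theorem DerivedIso.refl (X : Cx R) : DerivedIso X X := ⟨Iso.refl _⟩

theorem DerivedIso.symm {X Y : Cx R} (h : DerivedIso X Y) : DerivedIso Y X := ⟨h.some.symm⟩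

theorem DerivedIso.trans {X Y Z : Cx R} (h : DerivedIso X Y) (h' : DerivedIso Y Z) :
    DerivedIso X Z := ⟨h.some ≪≫ h'.some⟩

theorem DerivedIso.of_iso {X Y : Cx R} (e : X ≅ Y) : DerivedIso X Y :=
  ⟨DerivedCategory.Q.mapIso e⟩

theorem DerivedIso.shift {X Y : Cx R} (h : DerivedIso X Y) (n : ℤ) :
    DerivedIso ((shiftFunctor (Cx R) n).obj X) ((shiftFunctor (Cx R) n).obj Y) :=
  ⟨(DerivedCategory.Q.commShiftIso n).app X ≪≫
    (shiftFunctor (DerivedCategory (ModuleCat.{u} R)) n).mapIso h.some ≪≫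
    ((DerivedCategory.Q.commShiftIso n).app Y).symm⟩

theorem ShiftIso.refl (X : Cx R) : ShiftIso X X :=
  ⟨0, DerivedIso.of_iso ((shiftFunctorZero (Cx R) ℤ).app X).symm⟩

theorem ShiftIso.symm {X Y : Cx R} (h : ShiftIso X Y) : ShiftIso Y X := by
  obtain ⟨n, h⟩ := h
  exact ⟨-n, (DerivedIso.of_iso ((shiftFunctorCompIsoId (Cx R) n (-n)
    (add_neg_cancel n)).app Y).symm).trans (h.symm.shift (-n))⟩

theorem ShiftIso.trans {X Y Z : Cx R} (h : ShiftIso X Y) (h' : ShiftIso Y Z) : ShiftIso X Z := by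
  obtain ⟨n, h⟩ := h
  obtain ⟨m, h'⟩ := h'
  exact ⟨m + n, (h.trans (h'.shift n)).trans
    (DerivedIso.of_iso ((shiftFunctorAdd (Cx R) m n).app Z).symm)⟩

/-- The total homology module `H(X) = ⨁ Hᵢ(X)` is a finite `R`-module. -/
def HomologicallyFinite (X : Cx R) : Prop :=
  Module.Finite R (⨁ i : ℤ, X.homology i)

/-- `Hᵢ(X) = 0` for all but finitely many `i`. -/
def HomologicallyBounded (X : Cx R) : Prop :=
  ∃ n : ℕ, ∀ i : ℤ, (n : ℤ) < |i| → Subsingleton (X.homology i)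

/-- The complex `Hom_R(X, Y)`: in degree `n` it is the module of families of linear maps
`X.X p → Y.X (p + n)`, and `d f = d ∘ f - (-1)ⁿ f ∘ d` for `f` of degree `n`. -/
def homCx (X Y : Cx R) : Cx R where
  X n := ModuleCat.of R (Cochain X Y n)
  d n m := ModuleCat.ofHom (δ_hom R X Y n m)
  shape n m h := by
    ext z : 2
    exact δ_shape n m h z
  d_comp_d' n m k _ _ := by
    ext z : 2
    exact δ_δ n m k z

/-- The degree `n` part of the precomposition `Hom_R(X', Y) → Hom_R(X, Y)`. -/
def homCxPrecompHom {X X' : Cx R} (f : X ⟶ X') (Y : Cx R) (n : ℤ) :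
    (homCx X' Y).X n ⟶ (homCx X Y).X n :=
  ModuleCat.ofHom (X := Cochain X' Y n) (Y := Cochain X Y n)
    { toFun := fun z => (Cochain.ofHom f).comp z (zero_add n)
      map_add' := fun z w => Cochain.comp_add _ _ _ _
      map_smul' := fun r z => Cochain.comp_smul _ _ _ _ }

/-- Precomposition `Hom_R(X', Y) → Hom_R(X, Y)` with a morphism `X → X'`. -/
def homCxPrecomp {X X' : Cx R} (f : X ⟶ X') (Y : Cx R) : homCx X' Y ⟶ homCx X Y where
  f n := homCxPrecompHom f Y n
  comm' n m _ := by
    ext z : 2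
    exact δ_ofHom_comp f z m

/-- The map `r ↦ (x ↦ r x)` from `R` to the degree `0` part of `Hom_R(X, X)`. -/
def homothetyZero (X : Cx R) : ModuleCat.of R R ⟶ (homCx X X).X 0 :=
  ModuleCat.ofHom (Y := Cochain X X 0)
    (LinearMap.toSpanSingleton R (Cochain X X 0) (Cochain.ofHom (𝟙 X)))

/-- The homothety morphism `R → Hom_R(X, X)`, `r ↦ (x ↦ r x)`. -/
def homothety (X : Cx R) :
    (HomologicalComplex.single (ModuleCat.{u} R) (ComplexShape.up ℤ) 0).obj (ModuleCat.of R R) ⟶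
      homCx X X :=
  HomologicalComplex.mkHomFromSingle (homothetyZero X)
    (fun k _ => by
      ext
      change δ 0 k ((1 : R) • Cochain.ofHom (𝟙 X)) = 0
      rw [one_smul, δ_ofHom])

/-- The linear map `f ↦ (-1)^(p i) f(x)` on the degree `p` part of `Hom_R(X, Y)`, for `x` in
degree `i`. -/
def evalAt (X Y : Cx R) (i p q : ℤ) (h : p + i = q) (x : X.X i) : (homCx X Y).X p ⟶ Y.X q :=
  ModuleCat.ofHom (X := Cochain X Y p)
    { toFun := fun f => (p * i).negOnePow • (f.v i q (by lia)).hom x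
      map_add' := fun f g => by simp
      map_smul' := fun r f => by simp [smul_comm r] }

/-- The value of the biduality morphism at `x` in degree `i`: the map of degree `i` that takes
`f` of degree `p` to `(-1)^(p i) f(x)`. -/
def bidualityCochain (X Y : Cx R) (i : ℤ) (x : X.X i) : Cochain (homCx X Y) Y i :=
  Cochain.mk fun p q h => evalAt X Y i p q h x

theorem bidualityCochain_v (X Y : Cx R) (i : ℤ) (x : X.X i) (p q : ℤ) (h : p + i = q)
    (f : (homCx X Y).X p) : ((bidualityCochain X Y i x).v p q h).hom f =
      (p * i).negOnePow • (Cochain.v (F := X) (G := Y) (n := p) f i q (by lia)).hom x := by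
  rw [bidualityCochain, Cochain.mk_v]
  rfl

/-- The degree `i` part of the biduality morphism. -/
def bidualityHom (X Y : Cx R) (i : ℤ) : X.X i ⟶ (homCx (homCx X Y) Y).X i :=
  ModuleCat.ofHom (Y := Cochain (homCx X Y) Y i)
    { toFun := fun x => bidualityCochain X Y i x
      map_add' := fun x y => by
        ext p q h f
        rw [Cochain.add_v, ModuleCat.hom_add, LinearMap.add_apply, bidualityCochain_v,
          bidualityCochain_v, bidualityCochain_v, map_add, smul_add]
      map_smul' := fun r x => by
        ext p q h f
        rw [RingHom.id_apply, Cochain.smul_v, ModuleCat.hom_smul, LinearMap.smul_apply,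
          bidualityCochain_v, bidualityCochain_v, map_smul, smul_comm] }

/-- The biduality morphism `X → Hom_R(Hom_R(X, Y), Y)`. -/
def biduality (X Y : Cx R) : X ⟶ homCx (homCx X Y) Y where
  f i := bidualityHom X Y i
  comm' i j hij := by
    obtain rfl : i + 1 = j := hij
    ext x
    refine Cochain.ext _ _ fun p q h => ?_
    ext f
    change ((δ i (i + 1) (bidualityCochain X Y i x)).v p q h).hom f =
      ((bidualityCochain X Y (i + 1) ((X.d i (i + 1)).hom x)).v p q h).hom f
    rw [δ_v i (i + 1) rfl _ p q h (q - 1) (p + 1) rfl rfl, bidualityCochain_v]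
    have h1 : ((bidualityCochain X Y i x).v p (q - 1) (by lia) ≫ Y.d (q - 1) q).hom f =
        (p * i).negOnePow • (Y.d (q - 1) q).hom ((Cochain.v (F := X) (G := Y) (n := p) f i (q - 1) (by lia)).hom x) := by
      rw [ModuleCat.hom_comp, LinearMap.comp_apply, bidualityCochain_v]
      simp [Units.smul_def]
    have h2 : ((homCx X Y).d p (p + 1) ≫
        (bidualityCochain X Y i x).v (p + 1) q (by lia)).hom f =
        ((p + 1) * i).negOnePow • ((Y.d (q - 1) q).hom ((Cochain.v (F := X) (G := Y) (n := p) f i (q - 1) (by lia)).hom x) +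
          (p + 1).negOnePow • (Cochain.v (F := X) (G := Y) (n := p) f (i + 1) q (by lia)).hom ((X.d i (i + 1)).hom x)) := by
      refine (bidualityCochain_v X Y i x (p + 1) q (by lia) (δ p (p + 1) f)).trans ?_
      rw [δ_v p (p + 1) rfl f i q (by lia) (q - 1) (i + 1) rfl rfl]
      simp [Units.smul_def]
    have h3 : ∀ (u : ℤˣ) (g : (homCx X Y).X p ⟶ Y.X q), (u • g).hom f = u • g.hom f :=
      fun u g => by simp [Units.smul_def]
    rw [ModuleCat.hom_add, LinearMap.add_apply, h1, h3, h2]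
    have e1 : (i + 1).negOnePow * ((p + 1) * i).negOnePow = -(p * i).negOnePow := by
      rw [← Int.negOnePow_add, show i + 1 + (p + 1) * i = p * i + 1 + 2 * i by ring,
        Int.negOnePow_add _ (2 * i), Int.negOnePow_two_mul, mul_one, Int.negOnePow_succ]
    have e2 : (p * i).negOnePow * (p + 1).negOnePow = -(p * (i + 1)).negOnePow := by
      rw [← Int.negOnePow_add, show p * i + (p + 1) = p * (i + 1) + 1 by ring,
        Int.negOnePow_succ]
    rw [smul_smul, e1, smul_add, smul_smul, neg_mul, e2, neg_neg, Units.neg_smul,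
      add_neg_cancel_left]

/-- A K-projective (also called homotopically projective or semi-projective) resolution
of a complex. -/
structure ProjRes (X : Cx R) where
  /-- the resolving complex -/
  P : Cx R
  /-- the resolving complex is K-projective -/
  kProjective : P.IsKProjective
  /-- the augmentation -/
  π : P ⟶ X
  /-- the augmentation is a quasi-isomorphism -/
  quasiIso : QuasiIso π

/-- A homologically finite complex `K` is semidualizing when the homothety morphism
`χ : R → RHom_R(K, K)` is an isomorphism in `D(R)`. Here `RHom_R(K, K)` is `Hom_R(P, P)` for a
K-projective resolution `P` of `K`; the condition does not depend on `P`. -/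
def IsSemidualizing (K : Cx R) : Prop :=
  HomologicallyFinite K ∧ ∃ ρ : ProjRes K, QuasiIso (homothety ρ.P)

/-- A homologically finite complex `X` is `K`-reflexive when `RHom_R(X, K)` is homologically
bounded and the biduality morphism `δ : X → RHom_R(RHom_R(X, K), K)` is an isomorphism in `D(R)`.
Here `RHom_R(X, K) = Hom_R(P, K)` for a K-projective resolution `P` of `X`,
`RHom_R(RHom_R(X, K), K) = Hom_R(Q, K)` for a K-projective resolution `Q` of `Hom_R(P, K)`,
and `δ` is the composite `P → Hom_R(Hom_R(P, K), K) → Hom_R(Q, K)`. -/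
def IsReflexive (K X : Cx R) : Prop :=
  HomologicallyFinite X ∧ ∃ ρ : ProjRes X, HomologicallyBounded (homCx ρ.P K) ∧
    ∃ σ : ProjRes (homCx ρ.P K), QuasiIso (biduality ρ.P K ≫ homCxPrecomp σ.π K)

/-- A finitely generated module `C` is semidualizing when the homothety map `R → Hom_R(C, C)` is
an isomorphism and `Ext^i_R(C, C) = 0` for all `i ≥ 1`. -/
def IsSemidualizingModule (C : ModuleCat.{u} R) : Prop :=
  Module.Finite R C ∧ Function.Bijective (algebraMap R (Module.End R C)) ∧
    ∀ i : ℕ, 1 ≤ i → Subsingleton (Abelian.Ext C C i)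

/-- A module as a complex concentrated in degree `0`. -/
abbrev asComplex (M : ModuleCat.{u} R) : Cx R :=
  (HomologicalComplex.single (ModuleCat.{u} R) (ComplexShape.up ℤ) 0).obj M

end Defs

section Sets

variable (R : Type u) [CommRing R]

/-- Shift-isomorphism of semidualizing complexes. -/
def setoid : Setoid {K : Cx R // IsSemidualizing K} where
  r K L := ShiftIso K.1 L.1
  iseqv := ⟨fun K => ShiftIso.refl K.1, ShiftIso.symm, ShiftIso.trans⟩

/-- `𝔖(R)`: the shift-isomorphism classes of semidualizing `R`-complexes. -/
def S : Type (u + 1) := Quotient (setoid R)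

/-- Isomorphism of semidualizing modules. -/
def setoid₀ : Setoid {C : ModuleCat.{u} R // IsSemidualizingModule C} where
  r C D := Nonempty (C.1 ≅ D.1)
  iseqv := ⟨fun _ => ⟨Iso.refl _⟩, fun h => ⟨h.some.symm⟩, fun h h' => ⟨h.some ≪≫ h'.some⟩⟩

/-- `𝔖₀(R)`: the isomorphism classes of semidualizing `R`-modules. -/
def S₀ : Type (u + 1) := Quotient (setoid₀ R)

end Sets

section Maps

variable {R : Type u} [CommRing R]

/-- The class in `𝔖(R)` of a semidualizing complex. -/
def S.mk (K : Cx R) (hK : IsSemidualizing K) : S R := Quotient.mk (setoid R) ⟨K, hK⟩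

/-- The class in `𝔖₀(R)` of a semidualizing module. -/
def S₀.mk (C : ModuleCat.{u} R) (hC : IsSemidualizingModule C) : S₀ R :=
  Quotient.mk (setoid₀ R) ⟨C, hC⟩

/-- `[K] ⊴ [L]` in `𝔖(R)`: the complex `L` is `K`-reflexive. -/
def S.le (a b : S R) : Prop :=
  ∃ (K L : Cx R) (hK : IsSemidualizing K) (hL : IsSemidualizing L),
    a = S.mk K hK ∧ b = S.mk L hL ∧ IsReflexive K L

/-- `[C] ⊴ [D]` in `𝔖₀(R)`: the module `D` is `C`-reflexive, as a complex in degree `0`. -/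
def S₀.le (a b : S₀ R) : Prop :=
  ∃ (C D : ModuleCat.{u} R) (hC : IsSemidualizingModule C) (hD : IsSemidualizingModule D),
    a = S₀.mk C hC ∧ b = S₀.mk D hD ∧ IsReflexive (asComplex C) (asComplex D)

/-- `M` has a flat resolution `0 → F_n → ⋯ → F_0 → M → 0`. -/
def FlatDimLE : ℕ → ModuleCat.{u} R → Prop
  | 0, M => Module.Flat R M
  | n + 1, M => ∃ (F : ModuleCat.{u} R) (f : F →ₗ[R] M), Module.Flat R F ∧
      Function.Surjective f ∧ FlatDimLE n (ModuleCat.of R (LinearMap.ker f))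

variable {S' : Type u} [CommRing S']

/-- The ring homomorphism `φ : R → S'` has finite flat dimension: `fd_R(S') < ∞`. -/
def FiniteFlatDim (φ : R →+* S') : Prop :=
  ∃ n : ℕ, FlatDimLE n ((ModuleCat.restrictScalars φ).obj (ModuleCat.of S' S'))

/-- `L ≃ K ⊗ᴸ_R S'` in `D(S')`, where `K ⊗ᴸ_R S'` is `P ⊗_R S'` for a K-projective resolution
`P` of `K`. -/
def IsDerivedBaseChange (φ : R →+* S') (K : Cx R) (L : Cx S') : Prop :=
  ∃ ρ : ProjRes K,
    DerivedIso L (((ModuleCat.extendScalars φ).mapHomologicalComplex (ComplexShape.up ℤ)).obj ρ.P)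

/-- `f` is the induced map `𝔖(φ)`: for every semidualizing complex `K`, the complex
`K ⊗ᴸ_R S'` is semidualizing and `f [K] = [K ⊗ᴸ_R S']`. -/
def IsInducedMap (φ : R →+* S') (f : S R → S S') : Prop :=
  ∀ (K : Cx R) (hK : IsSemidualizing K),
    (∃ L : Cx S', IsDerivedBaseChange φ K L) ∧
    ∀ L : Cx S', IsDerivedBaseChange φ K L → ∃ hL : IsSemidualizing L, f (S.mk K hK) = S.mk L hL

/-- `f` is the induced map `𝔖₀(φ)`: for every semidualizing module `C`, the module `C ⊗_R S'` is
semidualizing and `f [C] = [C ⊗_R S']`. -/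
def IsInducedMap₀ (φ : R →+* S') (f : S₀ R → S₀ S') : Prop :=
  ∀ (C : ModuleCat.{u} R) (hC : IsSemidualizingModule C),
    ∃ h : IsSemidualizingModule ((ModuleCat.extendScalars φ).obj C),
      f (S₀.mk C hC) = S₀.mk ((ModuleCat.extendScalars φ).obj C) h

end Maps

/-- A bijection `f` is perfectly order-respecting when `a ⊴ b` if and only if `f a ⊴ f b`. -/
def IsPerfectBijection {α β : Type*} (r : α → α → Prop) (s : β → β → Prop) (f : α → β) : Prop :=
  Function.Bijective f ∧ ∀ a b, r a b ↔ s (f a) (f b)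

section Retract

variable {R S' : Type u} [CommRing R] [CommRing S']

/-- The hypotheses on the retract pair: `φ` and `ψ` have finite flat dimension, `ψ ∘ φ = id`, and
`ker ψ` lies in the Jacobson radical of `S'`. -/
structure IsRetractPair (φ : R →+* S') (ψ : S' →+* R) : Prop where
  finiteFlatDim_left : FiniteFlatDim φ
  finiteFlatDim_right : FiniteFlatDim ψ
  comp_eq_id : ψ.comp φ = RingHom.id R
  ker_le_jacobson : RingHom.ker ψ ≤ Ring.jacobson S'

end Retract

end

end SemiDual

namespace SemiDual

noncomputable section

open scoped TensorProduct
open HomologicalComplex Limits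

/-! ### Exactness and quasi-isomorphisms in terms of elements -/

section Elementwise

variable {R : Type u} [CommRing R]

/-! Over a Noetherian ring a homologically finite complex has a resolution by a bounded above
complex P of finite free modules, and the plain complex Hom(P, -) then computes the derived Hom. The
engine is tensor evaluation: let F → Hom(P, Q) be a quasi-isomorphism, with F and Q termwise flat
and Q cohomologically bounded below. It remains one after base change along a homomorphism of finite
flat dimension (`quasiIso_homCxBaseChange`), by induction along a finite flat resolution of the
target ring. For the homothety map this says that base change preserves semidualizing complexes.
Reflexivity is rewritten as a perfect pairing: a map F → Hom(P, Q) which is a quasi-isomorphism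
together with its transpose P → Hom(F, Q) (`isReflexive_iff`). Transposition commutes with base
change, so base change respects the order. It remains to see that the maps induced by φ and ψ are
mutually inverse.

One composite is the identity because ψφ = id. For the other, put I = ker ψ, let P be a
semidualizing complex of finite free S-modules, and let Q = S ⊗ (R ⊗ P), so that R ⊗ Q ≅ R ⊗ P. The
map P → R ⊗ P ≅ R ⊗ Q has to be lifted to P → Q, and the obstruction lies in H¹ of Hom(P, I ⊗ Q).
Since I has finite flat dimension, this vanishes once Hom(P, Q) has no cohomology in positive
degrees. What is known is that Hom_S(P, R ⊗ Q) ≅ Hom_R(R ⊗ P, R ⊗ P) ≃ R has none. Nakayama's lemma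
in the top degree is not available, because Hom(P, Q) is not known to be bounded above. Instead a
tower of flat models of I ⊗ ⋯ ⊗ I ⊗ Q shows that every positive class lies in the k-th power of I
times a finite module for all k, and Krull's intersection theorem kills it (`exists_tower`,
`exactAt_homCx_of_tens`). The lift P → Q becomes an isomorphism after R ⊗ -, so it is an isomorphism
in each degree by Nakayama (`isIso_of_extendScalars`).

A module is semidualizing exactly when it is so as a complex. The module statements therefore reduce
to complexes once C ⊗ᴸ S is known to have cohomology only in degree 0. If P resolves C, then Hom(P,
S ⊗ P) ≃ S has no negative cohomology, and the lowest cohomology T of S ⊗ P, if in negative degree,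
would satisfy Hom(C, T) = 0. A finite faithful module admits no such T ≠ 0
(`exactAt_of_exactAt_homCx`).

For power series, R⟦X⟧ is a product of copies of R, hence flat. Conversely R is obtained from R⟦X⟧
by dividing out one regular variable after another, which raises the flat dimension by at most one
each time. -/

theorem d_d_apply (X : Cx R) (i j k : ℤ) (x : X.X i) :
    (X.d j k).hom ((X.d i j).hom x) = 0 := by
  rw [← LinearMap.comp_apply, ← ModuleCat.hom_comp, X.d_comp_d]
  rfl

theorem f_d_apply {X Y : Cx R} (f : X ⟶ Y) (i j : ℤ) (x : X.X i) :
    (Y.d i j).hom ((f.f i).hom x) = (f.f j).hom ((X.d i j).hom x) := by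
  rw [← LinearMap.comp_apply, ← LinearMap.comp_apply, ← ModuleCat.hom_comp, ← ModuleCat.hom_comp,
    f.comm]

theorem exactAt_iff (X : Cx R) (h i j : ℤ) (hi : h + 1 = i) (hj : i + 1 = j) :
    X.ExactAt i ↔ ∀ x : X.X i, (X.d i j).hom x = 0 → ∃ y : X.X h, (X.d h i).hom y = x := by
  rw [X.exactAt_iff' h i j (by simp; lia) (by simp; lia), ShortComplex.moduleCat_exact_iff]
  rfl

/-- With cohomology modelled as cocycles modulo coboundaries, the two clauses are injectivity and
surjectivity of the induced map of quotients. -/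
theorem quasiIsoAt_iff {X Y : Cx R} (f : X ⟶ Y) (h i j : ℤ) (hi : h + 1 = i) (hj : i + 1 = j) :
    QuasiIsoAt f i ↔
      (∀ x : X.X i, (X.d i j).hom x = 0 → ∀ y : Y.X h, (Y.d h i).hom y = (f.f i).hom x →
        ∃ w : X.X h, (X.d h i).hom w = x) ∧
      (∀ y : Y.X i, (Y.d i j).hom y = 0 → ∃ x : X.X i, (X.d i j).hom x = 0 ∧
        ∃ w : Y.X h, (f.f i).hom x = y + (Y.d h i).hom w) := by
  rw [quasiIsoAt_iff' f h i j (by simp; lia) (by simp; lia)]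
  let S₁ := X.sc' h i j
  let S₂ := Y.sc' h i j
  let φ : S₁ ⟶ S₂ := (shortComplexFunctor' _ _ h i j).map f
  let k : LinearMap.ker S₁.g.hom →ₗ[R] LinearMap.ker S₂.g.hom :=
    (f.f i).hom.restrict (p := LinearMap.ker S₁.g.hom) (q := LinearMap.ker S₂.g.hom) (by
      intro x hx
      exact (f_d_apply f i j x).trans ((congrArg (f.f j).hom hx).trans (map_zero _)))
  have hle : LinearMap.range S₁.moduleCatToCycles ≤
      (LinearMap.range S₂.moduleCatToCycles).comap k := by
    rintro _ ⟨x, rfl⟩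
    refine ⟨(f.f h).hom x, Subtype.ext ?_⟩
    exact f_d_apply f h i x
  let γ : ShortComplex.LeftHomologyMapData φ S₁.moduleCatLeftHomologyData
      S₂.moduleCatLeftHomologyData :=
    { φK := ModuleCat.ofHom k
      φH := ModuleCat.ofHom (Submodule.mapQ _ _ k hle)
      commi := rfl
      commf' := by
        ext x
        exact Subtype.ext (f_d_apply f h i x).symm
      commπ := rfl }
  refine γ.quasiIso_iff.trans ?_
  rw [ConcreteCategory.isIso_iff_bijective]
  change Function.Bijective (Submodule.mapQ _ _ k hle) ↔ _
  refine and_congr ?_ ?_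
  · rw [← LinearMap.ker_eq_bot, LinearMap.ker_eq_bot']
    constructor
    · intro H x hx y hy
      have h1 := H (Submodule.Quotient.mk (⟨x, hx⟩ : LinearMap.ker S₁.g.hom)) (by
        rw [Submodule.mapQ_apply, Submodule.Quotient.mk_eq_zero]
        exact ⟨y, Subtype.ext hy⟩)
      rw [Submodule.Quotient.mk_eq_zero] at h1
      obtain ⟨w, hw⟩ := h1
      exact ⟨w, congrArg Subtype.val hw⟩
    · intro H m
      obtain ⟨⟨x, hx⟩, rfl⟩ := Submodule.Quotient.mk_surjective _ m
      intro hm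
      rw [Submodule.mapQ_apply, Submodule.Quotient.mk_eq_zero] at hm
      obtain ⟨y, hy⟩ := hm
      obtain ⟨w, hw⟩ := H x hx y (congrArg Subtype.val hy)
      rw [Submodule.Quotient.mk_eq_zero]
      exact ⟨w, Subtype.ext hw⟩
  · constructor
    · intro H y hy
      obtain ⟨m, hm⟩ := H (Submodule.Quotient.mk (⟨y, hy⟩ : LinearMap.ker S₂.g.hom))
      obtain ⟨⟨x, hx⟩, rfl⟩ := Submodule.Quotient.mk_surjective _ m
      rw [Submodule.mapQ_apply, Submodule.Quotient.eq] at hm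
      obtain ⟨w, hw⟩ := hm
      refine ⟨x, hx, w, ?_⟩
      have := congrArg Subtype.val hw
      exact (eq_add_of_sub_eq' this.symm)
    · intro H m
      obtain ⟨⟨y, hy⟩, rfl⟩ := Submodule.Quotient.mk_surjective _ m
      obtain ⟨x, hx, w, hw⟩ := H y hy
      refine ⟨Submodule.Quotient.mk (⟨x, hx⟩ : LinearMap.ker S₁.g.hom), ?_⟩
      rw [Submodule.mapQ_apply, Submodule.Quotient.eq]
      refine ⟨w, Subtype.ext ?_⟩
      exact (sub_eq_of_eq_add' hw).symm

theorem quasiIso_iff_forall {X Y : Cx R} (f : X ⟶ Y) : QuasiIso f ↔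
      ∀ h i j : ℤ, h + 1 = i → i + 1 = j →
      (∀ x : X.X i, (X.d i j).hom x = 0 → ∀ y : Y.X h, (Y.d h i).hom y = (f.f i).hom x →
        ∃ w : X.X h, (X.d h i).hom w = x) ∧
      (∀ y : Y.X i, (Y.d i j).hom y = 0 → ∃ x : X.X i, (X.d i j).hom x = 0 ∧
        ∃ w : Y.X h, (f.f i).hom x = y + (Y.d h i).hom w) := by
  rw [quasiIso_iff]
  constructor
  · rintro H h i j hi hj
    exact (quasiIsoAt_iff f h i j hi hj).1 (H i)
  · intro H i
    exact (quasiIsoAt_iff f (i - 1) i (i + 1) (by lia) rfl).2 (H _ _ _ (by lia) rfl)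

theorem exactAt_of_quasiIso {X Y : Cx R} (f : X ⟶ Y) [QuasiIso f] (i : ℤ) :
    X.ExactAt i ↔ Y.ExactAt i := by
  rw [exactAt_iff_isZero_homology, exactAt_iff_isZero_homology]
  exact (asIso (homologyMap f i)).isZero_iff

theorem exactAt_iff_subsingleton (X : Cx R) (i : ℤ) :
    X.ExactAt i ↔ Subsingleton (X.homology i) := by
  rw [exactAt_iff_isZero_homology, ModuleCat.isZero_iff_subsingleton]

end Elementwise

/-! ### Functoriality and exactness of the Hom complex -/

section HomComplex

variable {R : Type u} [CommRing R]

/-- The degree `n` part of the postcomposition `Hom_R(X, Y) → Hom_R(X, Y')`. -/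
def homCxPostcompHom (X : Cx R) {Y Y' : Cx R} (g : Y ⟶ Y') (n : ℤ) :
    (homCx X Y).X n ⟶ (homCx X Y').X n :=
  ModuleCat.ofHom (X := Cochain X Y n) (Y := Cochain X Y' n)
    { toFun := fun z => z.comp (Cochain.ofHom g) (add_zero n)
      map_add' := fun _ _ => Cochain.add_comp _ _ _ _
      map_smul' := fun _ _ => Cochain.smul_comp _ _ _ _ }

/-- Postcomposition `Hom_R(X, Y) → Hom_R(X, Y')` with a morphism `Y → Y'`. -/
def homCxPostcomp (X : Cx R) {Y Y' : Cx R} (g : Y ⟶ Y') : homCx X Y ⟶ homCx X Y' where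
  f n := homCxPostcompHom X g n
  comm' n m _ := by
    ext z : 2
    exact δ_comp_ofHom z g m

theorem homCx_hom_ext {X Y : Cx R} {Z : Cx R} {f g : homCx X Y ⟶ Z}
    (h : ∀ (n : ℤ) (z : Cochain X Y n), (f.f n).hom z = (g.f n).hom z) : f = g := by
  ext n z
  exact h n z

/-- The functor `Hom_R(X, -)`. -/
def homCxFunctor (X : Cx R) : Cx R ⥤ Cx R where
  obj Y := homCx X Y
  map g := homCxPostcomp X g
  map_id Y := by
    refine homCx_hom_ext fun n z => ?_
    exact Cochain.comp_id z
  map_comp f g := by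
    refine homCx_hom_ext fun n z => ?_
    change z.comp (Cochain.ofHom (f ≫ g)) (add_zero n) =
      (z.comp (Cochain.ofHom f) (add_zero n)).comp (Cochain.ofHom g) (add_zero n)
    rw [Cochain.ofHom_comp, Cochain.comp_assoc_of_second_is_zero_cochain]

theorem homCxPostcomp_comp (X : Cx R) {Y Y' Y'' : Cx R} (f : Y ⟶ Y') (g : Y' ⟶ Y'') :
    homCxPostcomp X (f ≫ g) = homCxPostcomp X f ≫ homCxPostcomp X g :=
  (homCxFunctor X).map_comp f g

theorem homCxPrecomp_comp {X X' X'' : Cx R} (f : X ⟶ X') (g : X' ⟶ X'') (Y : Cx R) :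
    homCxPrecomp (f ≫ g) Y = homCxPrecomp g Y ≫ homCxPrecomp f Y := by
  refine homCx_hom_ext fun n z => ?_
  change (Cochain.ofHom (f ≫ g)).comp z (zero_add n) =
    (Cochain.ofHom f).comp ((Cochain.ofHom g).comp z (zero_add n)) (zero_add n)
  rw [Cochain.ofHom_comp, Cochain.comp_assoc_of_first_is_zero_cochain]

instance (X : Cx R) : (homCxFunctor X).Additive where
  map_add {Y Y' f g} := by
    refine homCx_hom_ext fun n (z : Cochain X Y n) => ?_
    change z.comp (Cochain.ofHom (f + g)) (add_zero n) =
      z.comp (Cochain.ofHom f) (add_zero n) + z.comp (Cochain.ofHom g) (add_zero n)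
    rw [Cochain.ofHom_add, Cochain.comp_add]

/-- A degreewise projective complex `P` has an exact functor `Hom_R(P, -)`. -/
theorem shortExact_homCx (P : Cx R) (hP : ∀ i, Projective (P.X i)) {S : ShortComplex (Cx R)}
    (hS : S.ShortExact) : (S.map (homCxFunctor P)).ShortExact := by
  have hdeg := fun i => hS.map_of_exact (eval (ModuleCat.{u} R) (ComplexShape.up ℤ) i)
  refine shortExact_of_degreewise_shortExact _ fun n => ?_
  have hmono : ∀ i, Mono (S.f.f i) := fun i => (hdeg i).mono_f
  have hepi : ∀ i, Epi (S.g.f i) := fun i => (hdeg i).epi_g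
  refine ModuleCat.shortComplex_shortExact _ ?_ ?_ ?_
  · intro (z : Cochain P S.X₂ n)
    constructor
    · intro hz
      have hz' : Cochain.comp z (Cochain.ofHom S.g) (add_zero n) = 0 := hz
      have : ∀ p q (h : p + n = q), ∃ w : P.X p ⟶ S.X₁.X q,
          w ≫ S.f.f q = Cochain.v z p q h := by
        intro p q h
        have h0 : Cochain.v z p q h ≫ S.g.f q = 0 := by
          have := Cochain.congr_v hz' p q h
          rwa [Cochain.comp_zero_cochain_v, Cochain.ofHom_v, Cochain.zero_v] at this
        have : Mono (S.map (eval (ModuleCat.{u} R) (ComplexShape.up ℤ) q)).f := hmono q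
        exact ⟨(hdeg q).exact.lift _ h0, (hdeg q).exact.lift_f _ h0⟩
      choose w hw using this
      refine ⟨Cochain.mk w, ?_⟩
      change Cochain.comp (Cochain.mk w) (Cochain.ofHom S.f) (add_zero n) = z
      ext1 p q h
      rw [Cochain.comp_zero_cochain_v, Cochain.mk_v, Cochain.ofHom_v, hw]
    · rintro ⟨(w : Cochain P S.X₁ n), rfl⟩
      change Cochain.comp (Cochain.comp w (Cochain.ofHom S.f) (add_zero n))
        (Cochain.ofHom S.g) (add_zero n) = (0 : Cochain _ _ _)
      rw [Cochain.comp_assoc_of_second_is_zero_cochain, ← Cochain.ofHom_comp, S.zero,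
        Cochain.ofHom_zero, Cochain.comp_zero]
  · intro (z : Cochain P S.X₁ n) (w : Cochain P S.X₁ n) h
    have h' : Cochain.comp z (Cochain.ofHom S.f) (add_zero n) =
      Cochain.comp w (Cochain.ofHom S.f) (add_zero n) := h
    refine Cochain.ext _ _ fun p q hpq => ?_
    have := Cochain.congr_v h' p q hpq
    rw [Cochain.comp_zero_cochain_v, Cochain.comp_zero_cochain_v, Cochain.ofHom_v] at this
    exact (cancel_mono _).1 this
  · intro (z : Cochain P S.X₃ n)
    refine ⟨Cochain.mk fun p q h => Projective.factorThru (Cochain.v z p q h) (S.g.f q), ?_⟩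
    change Cochain.comp (Cochain.mk fun p q h =>
      Projective.factorThru (Cochain.v z p q h) (S.g.f q)) (Cochain.ofHom S.g) (add_zero n) = z
    ext1 p q h
    rw [Cochain.comp_zero_cochain_v, Cochain.mk_v, Cochain.ofHom_v, Projective.factorThru_comp]

end HomComplex

/-! ### Hom complexes out of K-projective complexes -/

section KProjective

variable {R : Type u} [CommRing R]

theorem homCx_cocycle_exists {X Y : Cx R} {n m : ℤ} (h : n + 1 = m) (z : Cochain X Y n)
    (hz : δ n m z = 0) : ∃ w : Cocycle X Y n, (w : Cochain X Y n) = z :=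
  ⟨Cocycle.mk z m h hz, rfl⟩

theorem mk_eq_mk_iff {X Y : Cx R} {n m : ℤ} (h : m + 1 = n) (z w : Cocycle X Y n) :
    CohomologyClass.mk z = CohomologyClass.mk w ↔
      ∃ b : Cochain X Y m, δ m n b = (z - w : Cochain X Y n) := by
  rw [← sub_eq_zero, ← CohomologyClass.mk_sub, CohomologyClass.mk_eq_zero_iff,
    mem_coboundaries_iff _ m h]
  rfl

/-- A morphism `Hom(X, Y) → Hom(X', Y')` which acts bijectively on cohomology classes is a
quasi-isomorphism. -/
theorem quasiIso_of_bijective {X Y X' Y' : Cx R} (Φ : homCx X Y ⟶ homCx X' Y')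
    (F : ∀ n : ℤ, Cocycle X Y n → Cocycle X' Y' n)
    (hF : ∀ n z, (F n z : Cochain X' Y' n) = (Φ.f n).hom (z : Cochain X Y n))
    (G : ∀ n : ℤ, ((HomotopyCategory.quotient _ (ComplexShape.up ℤ)).obj X ⟶
        (HomotopyCategory.quotient _ _).obj (Y⟦n⟧)) →
      ((HomotopyCategory.quotient _ _).obj X' ⟶ (HomotopyCategory.quotient _ _).obj (Y'⟦n⟧)))
    (hG : ∀ n, Function.Bijective (G n))
    (hGF : ∀ n z, CohomologyClass.toHom (CohomologyClass.mk (F n z)) =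
      G n (CohomologyClass.toHom (CohomologyClass.mk z))) : QuasiIso Φ := by
  rw [quasiIso_iff_forall]
  intro h i j hi hj
  have F0 : (F i 0 : Cochain X' Y' i) = 0 := (hF i 0).trans (map_zero _)
  constructor
  · intro x hx y hy
    obtain ⟨z, rfl⟩ := homCx_cocycle_exists hj x hx
    have h1 : CohomologyClass.mk (F i z) = CohomologyClass.mk (F i 0) := by
      rw [mk_eq_mk_iff hi]
      refine ⟨y, ?_⟩
      rw [F0, sub_zero, hF]
      exact hy
    have h2 := (hG i).1 (((hGF i z).symm.trans (congrArg _ h1)).trans (hGF i 0))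
    have h3 := (CohomologyClass.toHom_bijective X Y i).1 h2
    rw [mk_eq_mk_iff hi] at h3
    obtain ⟨b, hb⟩ := h3
    refine ⟨b, hb.trans ?_⟩
    exact sub_zero _
  · intro y hy
    obtain ⟨w, rfl⟩ := homCx_cocycle_exists hj y hy
    obtain ⟨g, hg⟩ := (hG i).2 (CohomologyClass.toHom (CohomologyClass.mk w))
    obtain ⟨c, rfl⟩ := (CohomologyClass.toHom_bijective X Y i).2 g
    obtain ⟨z, rfl⟩ := CohomologyClass.mk_surjective c
    rw [← hGF] at hg
    have h3 := (CohomologyClass.toHom_bijective X' Y' i).1 hg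
    rw [mk_eq_mk_iff hi] at h3
    obtain ⟨b, hb⟩ := h3
    refine ⟨(z : Cochain X Y i), Cocycle.δ_eq_zero z j, b, ?_⟩
    refine (hF i z).symm.trans ?_
    exact (eq_add_of_sub_eq' hb.symm)

/-- Postcomposition with a quasi-isomorphism is bijective on homotopy classes of maps out of a
K-projective complex. -/
theorem quotient_postcomp_bijective {P : Cx R} (hP : P.IsKProjective) {Y Y' : Cx R} (g : Y ⟶ Y')
    [QuasiIso g] : Function.Bijective
      (fun f : (HomotopyCategory.quotient _ (ComplexShape.up ℤ)).obj P ⟶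
        (HomotopyCategory.quotient _ _).obj Y => f ≫ (HomotopyCategory.quotient _ _).map g) := by
  have : IsIso (DerivedCategory.Qh.map ((HomotopyCategory.quotient _ (ComplexShape.up ℤ)).map g)) := by
    have : IsIso (DerivedCategory.Q.map g) := inferInstance
    rw [← NatIso.isIso_map_iff (DerivedCategory.quotientCompQhIso (ModuleCat.{u} R))] at this
    exact this
  -- On maps out of a K-projective complex the homotopy category and the derived category agree, and
  -- in the latter `g` is invertible.
  have h1 := CochainComplex.IsKProjective.Qh_map_bijective P
    ((HomotopyCategory.quotient _ _).obj Y)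
  have h2 := CochainComplex.IsKProjective.Qh_map_bijective P
    ((HomotopyCategory.quotient _ _).obj Y')
  rw [← Function.Bijective.of_comp_iff' h2]
  have h3 : Function.Bijective (fun f => f ≫ DerivedCategory.Qh.map
      ((HomotopyCategory.quotient _ (ComplexShape.up ℤ)).map g) :
      (DerivedCategory.Qh.obj ((HomotopyCategory.quotient _ _).obj P) ⟶ _) → _) :=
    ((asIso (DerivedCategory.Qh.map
      ((HomotopyCategory.quotient _ (ComplexShape.up ℤ)).map g))).homToEquiv).bijective
  convert h3.comp h1 using 1
  ext f
  simp

/-- `Hom_R(P, -)` preserves quasi-isomorphisms when `P` is K-projective. -/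
theorem quasiIso_homCxPostcomp {P : Cx R} (hP : P.IsKProjective) {Y Y' : Cx R} (g : Y ⟶ Y')
    [QuasiIso g] : QuasiIso (homCxPostcomp P g) := by
  refine quasiIso_of_bijective _ (fun n z => z.postcomp g) (fun n z => rfl)
    (fun n f => f ≫ (HomotopyCategory.quotient _ _).map (g⟦n⟧')) (fun n => ?_) (fun n z => ?_)
  · exact quotient_postcomp_bijective hP _
  · rw [CohomologyClass.toHom_mk, CohomologyClass.toHom_mk, Cocycle.equivHomShift_symm_postcomp,
      Functor.map_comp]

theorem quotient_isIso {P P' : Cx R} (hP : P.IsKProjective) (hP' : P'.IsKProjective) (w : P ⟶ P')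
    [QuasiIso w] : IsIso ((HomotopyCategory.quotient _ (ComplexShape.up ℤ)).map w) := by
  have := (CochainComplex.IsKProjective.quasiIso_iff w).1 inferInstance
  rwa [← HomotopyCategory.inverseImage_quotient_isomorphisms,
    MorphismProperty.inverseImage_iff, MorphismProperty.isomorphisms.iff] at this

/-- `Hom_R(-, Y)` takes quasi-isomorphisms of K-projective complexes to quasi-isomorphisms. -/
theorem quasiIso_homCxPrecomp {P P' : Cx R} (hP : P.IsKProjective) (hP' : P'.IsKProjective)
    (w : P ⟶ P') [QuasiIso w] (Y : Cx R) : QuasiIso (homCxPrecomp w Y) := by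
  have := quotient_isIso hP hP' w
  refine quasiIso_of_bijective _ (fun n z => z.precomp w) (fun n z => rfl)
    (fun n f => (HomotopyCategory.quotient _ _).map w ≫ f) (fun n => ?_) (fun n z => ?_)
  · exact ((asIso ((HomotopyCategory.quotient _ (ComplexShape.up ℤ)).map w)).homFromEquiv).symm.bijective
  · rw [CohomologyClass.toHom_mk, CohomologyClass.toHom_mk, Cocycle.equivHomShift_symm_precomp,
      Functor.map_comp]

end KProjective

end

end SemiDual

namespace SemiDual

noncomputable section

open scoped TensorProduct
open HomologicalComplex Limits

/-! ### Tensoring complexes with a module -/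

section Tensor

variable {R : Type u} [CommRing R]

/-- The functor `M ⊗_R -` on modules. -/
def tensModule (R : Type u) [CommRing R] (M : Type u) [AddCommGroup M] [Module R M] :
    ModuleCat.{u} R ⥤ ModuleCat.{u} R where
  obj X := ModuleCat.of R (M ⊗[R] X)
  map f := ModuleCat.ofHom (f.hom.lTensor M)
  map_id X := by
    ext : 1
    exact LinearMap.lTensor_id M X
  map_comp f g := by
    ext : 1
    exact LinearMap.lTensor_comp M g.hom f.hom

instance (M : Type u) [AddCommGroup M] [Module R M] : (tensModule R M).Additive where
  map_add {X Y f g} := by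
    ext : 1
    exact LinearMap.lTensor_add M f.hom g.hom

/-- The functor `M ⊗_R -` on complexes, for a module `M`. -/
abbrev tens (M : Type u) [AddCommGroup M] [Module R M] : Cx R ⥤ Cx R :=
  (tensModule R M).mapHomologicalComplex (ComplexShape.up ℤ)

variable {M M' M'' : Type u} [AddCommGroup M] [Module R M] [AddCommGroup M'] [Module R M']
  [AddCommGroup M''] [Module R M'']

instance [Module.Flat R M] : (tensModule R M).PreservesHomology :=
  Functor.preservesHomology_of_map_exact _ fun S hS => by
    rw [ShortComplex.ShortExact.moduleCat_exact_iff_function_exact] at hS ⊢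
    exact Module.Flat.lTensor_exact M hS

theorem quasiIso_tens [Module.Flat R M] {X Y : Cx R} (f : X ⟶ Y) [QuasiIso f] :
    QuasiIso ((tens M).map f) := inferInstance

theorem exactAt_tens [Module.Flat R M] {X : Cx R} {i : ℤ} (h : X.ExactAt i) :
    ((tens M).obj X).ExactAt i :=
  ShortComplex.Exact.map h (tensModule R M)

/-- The morphism `M ⊗ X → M' ⊗ X` induced by a linear map. -/
def tensMap (g : M →ₗ[R] M') (X : Cx R) : (tens M).obj X ⟶ (tens M').obj X where
  f i := ModuleCat.ofHom (X := M ⊗[R] X.X i) (Y := M' ⊗[R] X.X i) (g.rTensor (X.X i))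
  comm' i j _ := by
    ext : 1
    exact (LinearMap.lTensor_comp_rTensor M g (X.d i j).hom).trans
      (LinearMap.rTensor_comp_lTensor M g (X.d i j).hom).symm

theorem tensMap_naturality (g : M →ₗ[R] M') {X Y : Cx R} (f : X ⟶ Y) :
    tensMap g X ≫ (tens M').map f = (tens M).map f ≫ tensMap g Y := by
  ext i : 2
  exact (LinearMap.lTensor_comp_rTensor M g (f.f i).hom).trans
    (LinearMap.rTensor_comp_lTensor M g (f.f i).hom).symm

theorem tensMap_comp (g : M →ₗ[R] M') (g' : M' →ₗ[R] M'') (X : Cx R) :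
    tensMap (g' ∘ₗ g) X = tensMap g X ≫ tensMap g' X := by
  ext i : 2
  exact TensorProduct.ext' (R := R) (M := M) (N := X.X i) fun _ _ => rfl

theorem tensMap_zero (X : Cx R) : tensMap (0 : M →ₗ[R] M') X = 0 := by
  ext i : 2
  exact LinearMap.rTensor_zero (X.X i)

/-- The complexes `M ⊗ X → M' ⊗ X → M'' ⊗ X`. -/
def tensShortComplex (f : M →ₗ[R] M') (g : M' →ₗ[R] M'') (h : Function.Exact f g) (X : Cx R) :
    ShortComplex (Cx R) :=
  ShortComplex.mk (tensMap f X) (tensMap g X) (by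
    rw [← tensMap_comp, h.linearMap_comp_eq_zero, tensMap_zero])

/-- Injectivity comes from flatness of the terms of `X`, so the three modules can be arbitrary. This
is what permits dimension shifting along flat resolutions of the coefficients. -/
theorem shortExact_tensShortComplex {f : M →ₗ[R] M'} {g : M' →ₗ[R] M''} (hf : Function.Injective f)
    (h : Function.Exact f g) (hg : Function.Surjective g) (X : Cx R)
    (hX : ∀ i, Module.Flat R (X.X i)) : (tensShortComplex f g h X).ShortExact := by
  refine shortExact_of_degreewise_shortExact _ fun n => ?_
  refine ModuleCat.shortComplex_shortExact _ ?_ ?_ ?_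
  · exact rTensor_exact (X.X n) h hg
  · exact Module.Flat.rTensor_preserves_injective_linearMap f hf
  · exact LinearMap.rTensor_surjective (X.X n) hg

/-- The morphism `X → M ⊗ X`, `x ↦ m ⊗ x`. -/
def tensIns (m : M) (X : Cx R) : X ⟶ (tens M).obj X where
  f i := ModuleCat.ofHom (Y := M ⊗[R] X.X i) (TensorProduct.mk R M (X.X i) m)
  comm' _ _ _ := rfl

theorem tensIns_add (m m' : M) (X : Cx R) : tensIns (m + m') X = tensIns m X + tensIns m' X := by
  ext i x
  exact TensorProduct.add_tmul m m' x

theorem tensIns_smul (r : R) (m : M) (X : Cx R) : tensIns (r • m) X = r • tensIns m X := by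
  ext i x
  exact (TensorProduct.smul_tmul' r m x).symm

theorem tensIns_naturality (m : M) {X Y : Cx R} (f : X ⟶ Y) :
    tensIns m X ≫ (tens M).map f = f ≫ tensIns m Y := rfl

theorem tensIns_tensMap (m : M) (g : M →ₗ[R] M') (X : Cx R) :
    tensIns m X ≫ tensMap g X = tensIns (g m) X := rfl

/-- The degree `n` part of `M ⊗ Hom(P, Y) → Hom(P, M ⊗ Y)`. -/
def tensHomAux (M : Type u) [AddCommGroup M] [Module R M] (P Y : Cx R) (n : ℤ) :
    M ⊗[R] Cochain P Y n →ₗ[R] Cochain P ((tens M).obj Y) n :=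
  TensorProduct.lift
    { toFun := fun m =>
        { toFun := fun z => z.comp (Cochain.ofHom (tensIns m Y)) (add_zero n)
          map_add' := fun z w => Cochain.add_comp _ _ _ _
          map_smul' := fun r z => Cochain.smul_comp _ _ _ _ }
      map_add' := fun m m' => by
        ext1 z
        simp [tensIns_add]
      map_smul' := fun r m => by
        ext1 z
        ext p q h : 1
        simp [tensIns_smul] }

/-- The tensor evaluation morphism `M ⊗ Hom(P, Y) → Hom(P, M ⊗ Y)`. -/
def tensHom (M : Type u) [AddCommGroup M] [Module R M] (P Y : Cx R) :
    (tens M).obj (homCx P Y) ⟶ homCx P ((tens M).obj Y) where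
  f n := ModuleCat.ofHom (X := M ⊗[R] Cochain P Y n) (Y := Cochain P ((tens M).obj Y) n)
    (tensHomAux M P Y n)
  comm' i j _ := by
    ext : 1
    refine TensorProduct.ext' fun m (z : Cochain P Y i) => ?_
    exact δ_comp_ofHom z (tensIns m Y) j

/-- The elements m ⊗ x generate M ⊗ X. Compatibilities of tensor evaluation thus reduce to
identities between postcompositions with `tensIns m`. -/
theorem tens_hom_ext {X Z : Cx R} {f g : (tens M).obj X ⟶ Z}
    (h : ∀ m : M, tensIns m X ≫ f = tensIns m X ≫ g) : f = g := by
  ext n : 2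
  refine TensorProduct.ext' fun m x => ?_
  exact congrArg (fun k : X ⟶ Z => (k.f n).hom x) (h m)

theorem tensIns_tensHom (m : M) (P Y : Cx R) :
    tensIns m (homCx P Y) ≫ tensHom M P Y = homCxPostcomp P (tensIns m Y) := rfl

theorem tensHom_naturality (P : Cx R) {Y Y' : Cx R} (g : Y ⟶ Y') :
    tensHom M P Y ≫ homCxPostcomp P ((tens M).map g) =
      (tens M).map (homCxPostcomp P g) ≫ tensHom M P Y' := by
  refine tens_hom_ext fun m => ?_
  rw [← Category.assoc, tensIns_tensHom, ← homCxPostcomp_comp, tensIns_naturality,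
    ← Category.assoc, tensIns_naturality, Category.assoc, tensIns_tensHom, homCxPostcomp_comp]

theorem tensHom_tensMap (g : M →ₗ[R] M') (P Y : Cx R) :
    tensHom M P Y ≫ homCxPostcomp P (tensMap g Y) = tensMap g (homCx P Y) ≫ tensHom M' P Y := by
  refine tens_hom_ext fun m => ?_
  rw [← Category.assoc, tensIns_tensHom, ← homCxPostcomp_comp, tensIns_tensMap,
    ← Category.assoc, tensIns_tensMap, tensIns_tensHom]

end Tensor

/-! ### Bounded above complexes of finite free modules -/

section Classes

variable {R : Type u} [CommRing R]

/-- Bounded above complexes of finite free modules. -/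
structure IsFiniteFree (P : Cx R) : Prop where
  free : ∀ i, Module.Free R (P.X i)
  finite : ∀ i, Module.Finite R (P.X i)
  bound : ∃ b : ℤ, P.IsStrictlyLE b

theorem IsFiniteFree.projective {P : Cx R} (h : IsFiniteFree P) (i : ℤ) : Projective (P.X i) := by
  have := h.free i
  exact (IsProjective.iff_projective (P.X i)).1 inferInstance

theorem IsFiniteFree.flat {P : Cx R} (h : IsFiniteFree P) (i : ℤ) : Module.Flat R (P.X i) := by
  have := h.free i
  infer_instance

theorem IsFiniteFree.isKProjective {P : Cx R} (h : IsFiniteFree P) : P.IsKProjective := by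
  obtain ⟨b, hb⟩ := h.bound
  have := h.projective
  exact CochainComplex.isKProjective_of_projective P b

end Classes

/-! ### Tensor evaluation -/

section TensorEvaluation

variable {R : Type u} [CommRing R] {M : Type u} [AddCommGroup M] [Module R M]

theorem hom_eq_zero_of_isStrictlyLE {P Y : Cx R} {b p q : ℤ} (hb : P.IsStrictlyLE b) (hp : b < p)
    (f : P.X p ⟶ Y.X q) : f = 0 :=
  (P.isZero_of_isStrictlyLE b p hp).eq_of_src _ _

theorem hom_eq_zero_of_isStrictlyGE {P Y : Cx R} {a p q : ℤ} (ha : Y.IsStrictlyGE a) (hq : q < a)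
    (f : P.X p ⟶ Y.X q) : f = 0 :=
  (Y.isZero_of_isStrictlyGE a q hq).eq_of_tgt _ _

/-- Cochains from a bounded above complex to a bounded below one are finite families of maps. -/
def cochainEquivPi (P Y : Cx R) (n a b : ℤ) (hb : P.IsStrictlyLE b) (ha : Y.IsStrictlyGE a) :
    Cochain P Y n ≃ₗ[R] (∀ p : Finset.Icc (a - n) b, P.X p →ₗ[R] Y.X (p + n)) :=
  LinearEquiv.ofBijective
    ({ toFun := fun z p => (z.v p.1 (p.1 + n) rfl).hom
       map_add' := fun _ _ => rfl
       map_smul' := fun _ _ => rfl } :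
      Cochain P Y n →ₗ[R] (∀ p : Finset.Icc (a - n) b, P.X p →ₗ[R] Y.X (p + n)))
    (by
      -- For p > b the source vanishes, and for p < a - n the target, in degree p + n < a, does.
      have key : ∀ p, p ∉ Finset.Icc (a - n) b → ∀ q, p + n = q → ∀ f : P.X p ⟶ Y.X q, f = 0 := by
        intro p hp q hq f
        rw [Finset.mem_Icc, not_and_or, not_le, not_le] at hp
        rcases hp with hp | hp
        · exact hom_eq_zero_of_isStrictlyGE ha (by lia) f
        · exact hom_eq_zero_of_isStrictlyLE hb hp f
      constructor
      · intro z w h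
        ext1 p q hpq
        by_cases hp : p ∈ Finset.Icc (a - n) b
        · obtain rfl := hpq
          exact ModuleCat.hom_ext (congrFun h (⟨p, hp⟩ : Finset.Icc (a - n) b))
        · rw [key p hp q hpq (z.v p q hpq), key p hp q hpq (w.v p q hpq)]
      · intro f
        refine ⟨Cochain.mk fun p q h => if hp : p ∈ Finset.Icc (a - n) b then
          ModuleCat.ofHom (f ⟨p, hp⟩) ≫ (Y.XIsoOfEq h).hom else 0, ?_⟩
        funext ⟨p, hp⟩
        change (Cochain.v (Cochain.mk fun p q h => if hp : p ∈ Finset.Icc (a - n) b then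
          ModuleCat.ofHom (f ⟨p, hp⟩) ≫ (Y.XIsoOfEq h).hom else 0) p (p + n) rfl).hom = f ⟨p, hp⟩
        rw [Cochain.mk_v, dif_pos hp]
        simp)

theorem isStrictlyGE_tens {Y : Cx R} {a : ℤ} (ha : Y.IsStrictlyGE a) :
    ((tens M).obj Y).IsStrictlyGE a := inferInstance

/-- Under the strict bounds, degree n of the Hom complex is a finite product of modules of maps out
of finite free modules, and M ⊗ - commutes both with finite products and with such Hom modules. -/
theorem isIso_tensHom {P Y : Cx R} (hP : IsFiniteFree P) {a : ℤ} (ha : Y.IsStrictlyGE a) :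
    IsIso (tensHom M P Y) := by
  obtain ⟨b, hb⟩ := hP.bound
  have hfree := hP.free
  have hfin := hP.finite
  have : ∀ n, IsIso ((tensHom M P Y).f n) := by
    intro n
    rw [ConcreteCategory.isIso_iff_bijective]
    change Function.Bijective (tensHomAux M P Y n)
    let e₁ := cochainEquivPi P Y n a b hb ha
    let e₂ := cochainEquivPi P ((tens M).obj Y) n a b hb (isStrictlyGE_tens ha)
    let e₃ : (∀ p : Finset.Icc (a - n) b, M ⊗[R] (P.X p →ₗ[R] Y.X (p + n))) ≃ₗ[R]
        ∀ p : Finset.Icc (a - n) b, P.X p →ₗ[R] M ⊗[R] Y.X (p + n) :=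
      LinearEquiv.piCongrRight fun p => lTensorHomEquivHomLTensor R (P.X p) M (Y.X (p + n))
    let e : M ⊗[R] Cochain P Y n ≃ₗ[R] Cochain P ((tens M).obj Y) n :=
      (e₁.lTensor M).trans ((TensorProduct.piRight R R M _).trans (e₃.trans e₂.symm))
    have he : tensHomAux M P Y n = e.toLinearMap := by
      refine TensorProduct.ext' fun m z => ?_
      refine e₂.injective ?_
      refine Eq.trans ?_ (LinearEquiv.apply_symm_apply e₂ _).symm
      funext p
      refine LinearMap.ext fun x => ?_
      change _ = lTensorHomEquivHomLTensor R (P.X p) M (Y.X (p + n)) (m ⊗ₜ (e₁ z p)) x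
      rw [lTensorHomEquivHomLTensor_apply]
      change ((Cochain.v (Cochain.comp z (Cochain.ofHom (tensIns m Y)) (add_zero n)) p (p + n)
        rfl)).hom x = _
      rw [Cochain.comp_zero_cochain_v]
      rfl
    rw [he]
    exact e.bijective
  exact HomologicalComplex.Hom.isIso_of_components _

/-- Tensor evaluation: for `P` a bounded above complex of finite free modules, `M` flat and `Y`
cohomologically bounded below, `M ⊗ Hom(P, Y) → Hom(P, M ⊗ Y)` is a quasi-isomorphism. -/
theorem quasiIso_tensHom [Module.Flat R M] {P Y : Cx R} (hP : IsFiniteFree P) {a : ℤ}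
    (ha : Y.IsGE a) : QuasiIso (tensHom M P Y) := by
  -- Replacing `Y` by its truncation makes it strictly bounded below, where evaluation is an
  -- isomorphism. Flatness of `M` keeps the truncation map a quasi-isomorphism after tensoring.
  have h1 : QuasiIso (homCxPostcomp P ((tens M).map (Y.πTruncGE a))) :=
    quasiIso_homCxPostcomp hP.isKProjective _
  have h2 : QuasiIso ((tens M).map (homCxPostcomp P (Y.πTruncGE a))) := by
    have := quasiIso_homCxPostcomp hP.isKProjective (Y.πTruncGE a)
    exact quasiIso_tens _
  have h3 : IsIso (tensHom M P (Y.truncGE a)) := isIso_tensHom hP (a := a) inferInstance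
  have h4 := tensHom_naturality (M := M) P (Y.πTruncGE a)
  have h5 : QuasiIso (tensHom M P Y ≫ homCxPostcomp P ((tens M).map (Y.πTruncGE a))) := by
    rw [h4]
    infer_instance
  exact quasiIso_of_comp_right _ (homCxPostcomp P ((tens M).map (Y.πTruncGE a)))

end TensorEvaluation

section FiniteFlatDimension

variable {R : Type u} [CommRing R]

/-- The morphism `M ⊗ F → Hom(P, M ⊗ Q)` induced by `F → Hom(P, Q)`. -/
def tensAdj (M : Type u) [AddCommGroup M] [Module R M] {F P Q : Cx R} (β : F ⟶ homCx P Q) :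
    (tens M).obj F ⟶ homCx P ((tens M).obj Q) :=
  (tens M).map β ≫ tensHom M P Q

theorem tensAdj_tensMap {M M' : Type u} [AddCommGroup M] [Module R M] [AddCommGroup M']
    [Module R M'] (g : M →ₗ[R] M') {F P Q : Cx R} (β : F ⟶ homCx P Q) :
    tensAdj M β ≫ homCxPostcomp P (tensMap g Q) = tensMap g F ≫ tensAdj M' β := by
  rw [tensAdj, tensAdj, Category.assoc, tensHom_tensMap, ← Category.assoc, ← Category.assoc,
    tensMap_naturality]

/-- Tensor evaluation along modules of finite flat dimension. -/
theorem quasiIso_tensAdj {F P Q : Cx R} (β : F ⟶ homCx P Q) [QuasiIso β] (hP : IsFiniteFree P)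
    (hF : ∀ i, Module.Flat R (F.X i)) (hQ : ∀ i, Module.Flat R (Q.X i)) {a : ℤ} (ha : Q.IsGE a)
    (n : ℕ) (M : ModuleCat.{u} R) (hM : FlatDimLE n M) : QuasiIso (tensAdj M β) := by
  induction n generalizing M with
  | zero =>
    have : Module.Flat R M := hM
    have h1 := quasiIso_tensHom (M := M) hP ha
    have h2 := quasiIso_tens (M := M) β
    exact quasiIso_comp _ _
  | succ n ih =>
    obtain ⟨G, f, hG, hf, hK⟩ := hM
    have h1 := ih _ hK
    have h2 : QuasiIso (tensAdj G β) := by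
      have h1 := quasiIso_tensHom (M := G) hP ha
      have h2 := quasiIso_tens (M := G) β
      exact quasiIso_comp _ _
    have hex : Function.Exact (LinearMap.ker f).subtype f := f.exact_subtype_ker_map
    have s1 := shortExact_tensShortComplex (LinearMap.ker f).injective_subtype hex hf F hF
    have s2 := shortExact_homCx P hP.projective
      (shortExact_tensShortComplex (LinearMap.ker f).injective_subtype hex hf Q hQ)
    -- Dimension shift: evaluation is a map of short exact sequences of complexes, and it is a
    -- quasi-isomorphism on the terms for ker f and `G`, hence on the one for `M`.
    let φ : tensShortComplex (LinearMap.ker f).subtype f hex F ⟶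
        (tensShortComplex (LinearMap.ker f).subtype f hex Q).map (homCxFunctor P) :=
      { τ₁ := tensAdj (LinearMap.ker f) β
        τ₂ := tensAdj G β
        τ₃ := tensAdj M β
        comm₁₂ := tensAdj_tensMap _ β
        comm₂₃ := tensAdj_tensMap _ β }
    exact HomologySequence.quasiIso_τ₃ φ s1 s2 h1 h2

end FiniteFlatDimension

end

end SemiDual

namespace SemiDual

noncomputable section

open scoped TensorProduct
open HomologicalComplex Limits

section CochainValues

variable {R : Type u} [CommRing R]

theorem comp_ofHom_v_apply {X Y Y' : Cx R} {n : ℤ} (z : Cochain X Y n) (g : Y ⟶ Y') (p q : ℤ)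
    (h : p + n = q) (x : X.X p) :
    ((z.comp (Cochain.ofHom g) (add_zero n)).v p q h).hom x =
      (g.f q).hom ((z.v p q h).hom x) := by
  rw [Cochain.comp_zero_cochain_v, Cochain.ofHom_v, ModuleCat.hom_comp, LinearMap.comp_apply]

theorem ofHom_comp_v_apply {X X' Y : Cx R} {n : ℤ} (f : X ⟶ X') (z : Cochain X' Y n) (p q : ℤ)
    (h : p + n = q) (x : X.X p) :
    (((Cochain.ofHom f).comp z (zero_add n)).v p q h).hom x =
      (z.v p q h).hom ((f.f p).hom x) := by
  rw [Cochain.zero_cochain_comp_v, Cochain.ofHom_v, ModuleCat.hom_comp, LinearMap.comp_apply]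

end CochainValues

/-! ### Extension and restriction of scalars on Hom complexes -/

section ChangeOfRings

variable {A B : Type u} [CommRing A] [CommRing B] (φ : A →+* B)

instance : (ModuleCat.extendScalars.{u, u, u} φ).Additive where
  map_add {X Y f g} := by
    refine ModuleCat.ExtendScalars.hom_ext fun x => ?_
    exact TensorProduct.tmul_add (R := A) (M := (ModuleCat.restrictScalars.{u} φ).obj
      (ModuleCat.of B B)) (N := Y) (1 : B) (f.hom x) (g.hom x)

/-- Extension of scalars on complexes. -/
abbrev extCx : Cx A ⥤ Cx B :=
  (ModuleCat.extendScalars.{u, u, u} φ).mapHomologicalComplex (ComplexShape.up ℤ)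

/-- Restriction of scalars on complexes. -/
abbrev resCx : Cx B ⥤ Cx A :=
  (ModuleCat.restrictScalars.{u} φ).mapHomologicalComplex (ComplexShape.up ℤ)

/-- The map `X → B ⊗_A X`, `x ↦ 1 ⊗ x`. -/
abbrev oneTmul (X : ModuleCat.{u} A) :
    X ⟶ (ModuleCat.restrictScalars.{u} φ).obj ((ModuleCat.extendScalars.{u, u, u} φ).obj X) :=
  (ModuleCat.extendRestrictScalarsAdj.{u, u, u} φ).unit.app X

/-- The element `1 ⊗ x` of `B ⊗_A X`. -/
def tmulOne {X : ModuleCat.{u} A} (x : X) : (ModuleCat.extendScalars.{u, u, u} φ).obj X :=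
  (oneTmul φ X).hom x

variable {φ} in
theorem extendScalars_map_tmulOne {X Y : ModuleCat.{u} A} (f : X ⟶ Y) (x : X) :
    ((ModuleCat.extendScalars.{u, u, u} φ).map f).hom (tmulOne φ x) = tmulOne φ (f.hom x) := rfl

variable {φ} in
theorem extendScalars_hom_ext {X : ModuleCat.{u} A} {Y : ModuleCat.{u} B}
    {f g : (ModuleCat.extendScalars.{u, u, u} φ).obj X ⟶ Y}
    (h : ∀ x : X, f.hom (tmulOne φ x) = g.hom (tmulOne φ x)) : f = g :=
  ModuleCat.ExtendScalars.hom_ext h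

theorem tmulOne_smul {X : ModuleCat.{u} A} (r : A) (x : X) :
    tmulOne φ (r • x) = φ r • tmulOne φ x :=
  (oneTmul φ X).hom.map_smul r x

theorem tmulOne_units_smul {X : ModuleCat.{u} A} (r : ℤˣ) (x : X) :
    tmulOne φ (r • x) = r • tmulOne φ x := by
  rcases Int.units_eq_one_or r with rfl | rfl
  · rw [one_smul, one_smul]
  · rw [Units.neg_smul, Units.neg_smul, one_smul, one_smul]
    exact map_neg (oneTmul φ X).hom x

theorem extendScalars_map_smul {X Y : ModuleCat.{u} A} (r : A) (f : X ⟶ Y) :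
    (ModuleCat.extendScalars.{u, u, u} φ).map (r • f) =
      φ r • (ModuleCat.extendScalars.{u, u, u} φ).map f := by
  refine extendScalars_hom_ext fun x => ?_
  exact tmulOne_smul φ r (f.hom x)

/-- The morphism `X → B ⊗_A X` of complexes. -/
def oneTmulCx (X : Cx A) : X ⟶ (resCx φ).obj ((extCx φ).obj X) where
  f i := oneTmul φ (X.X i)
  comm' _ _ _ := rfl

theorem oneTmulCx_naturality {X Y : Cx A} (f : X ⟶ Y) :
    f ≫ oneTmulCx φ Y = oneTmulCx φ X ≫ (resCx φ).map ((extCx φ).map f) := rfl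

/-- The morphism `B ⊗_A X → Z` of `B`-complexes induced by a morphism `X → Z` of `A`-complexes. -/
def extDesc {X : Cx A} {Z : Cx B} (g : X ⟶ (resCx φ).obj Z) : (extCx φ).obj X ⟶ Z where
  f i := ((ModuleCat.extendRestrictScalarsAdj.{u, u, u} φ).homEquiv _ _).symm (g.f i)
  comm' i j _ := by
    have h1 := (ModuleCat.extendRestrictScalarsAdj.{u, u, u} φ).homEquiv_naturality_left_symm
      (X.d i j) (g.f j)
    have h2 := (ModuleCat.extendRestrictScalarsAdj.{u, u, u} φ).homEquiv_naturality_right_symm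
      (g.f i) (Z.d i j)
    exact h2.symm.trans ((congrArg _ (g.comm i j)).trans h1)

theorem oneTmulCx_extDesc {X : Cx A} {Z : Cx B} (g : X ⟶ (resCx φ).obj Z) :
    oneTmulCx φ X ≫ (resCx φ).map (extDesc φ g) = g := by
  ext i : 1
  have := ((ModuleCat.extendRestrictScalarsAdj.{u, u, u} φ).homEquiv _ _).apply_symm_apply (g.f i)
  rw [Adjunction.homEquiv_unit] at this
  exact this

theorem extDesc_tmulOne {X : Cx A} {Z : Cx B} (g : X ⟶ (resCx φ).obj Z) (i : ℤ) (x : X.X i) :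
    ((extDesc φ g).f i).hom (tmulOne φ x) = (g.f i).hom x :=
  congrArg (fun k : X ⟶ (resCx φ).obj Z => (k.f i).hom x) (oneTmulCx_extDesc φ g)

variable {φ} in
theorem extCx_hom_ext {X : Cx A} {Z : Cx B} {f g : (extCx φ).obj X ⟶ Z}
    (h : ∀ (i : ℤ) (x : X.X i), (f.f i).hom (tmulOne φ x) = (g.f i).hom (tmulOne φ x)) :
    f = g := by
  ext i : 1
  exact extendScalars_hom_ext (h i)

/-- `B` as an `A`-module. -/
abbrev ringAsModule : ModuleCat.{u} A := (ModuleCat.restrictScalars.{u} φ).obj (ModuleCat.of B B)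

/-- The comparison of `B ⊗_A X` as an `A`-module with the restriction of scalars of the
`B`-module `B ⊗_A X`. -/
def tensModuleHom (X : ModuleCat.{u} A) :
    (tensModule A (ringAsModule φ)).obj X ⟶
      (ModuleCat.restrictScalars.{u} φ).obj ((ModuleCat.extendScalars.{u, u, u} φ).obj X) :=
  ModuleCat.ofHom (X := (ringAsModule φ) ⊗[A] X)
    (Y := (ModuleCat.restrictScalars.{u} φ).obj ((ModuleCat.extendScalars.{u, u, u} φ).obj X))
    -- Both sides have the same underlying additive group; only the two actions of `A` have to be
    -- compared.
    { toFun := fun t => t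
      map_add' := fun _ _ => rfl
      map_smul' := fun r t => by
        refine TensorProduct.induction_on (R := A) (M := ringAsModule φ) (N := X) t ?_ ?_ ?_
        · exact (smul_zero r (A := (ringAsModule φ) ⊗[A] X)).trans (smul_zero (φ r)
            (A := (ModuleCat.extendScalars.{u, u, u} φ).obj X)).symm
        · intro b x
          rfl
        · intro s t hs ht
          exact (smul_add r s t (A := (ringAsModule φ) ⊗[A] X)).trans ((congrArg₂ _ hs ht).trans (smul_add (φ r) _ _
            (A := (ModuleCat.extendScalars.{u, u, u} φ).obj X)).symm) }

instance (X : ModuleCat.{u} A) : IsIso (tensModuleHom φ X) := by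
  rw [ConcreteCategory.isIso_iff_bijective]
  exact Function.bijective_id

/-- The underlying `A`-module of `B ⊗_A X`. -/
def tensModuleIso (X : ModuleCat.{u} A) :
    (tensModule A (ringAsModule φ)).obj X ≅
      (ModuleCat.restrictScalars.{u} φ).obj ((ModuleCat.extendScalars.{u, u, u} φ).obj X) :=
  asIso (tensModuleHom φ X)

/-- The underlying complex of `A`-modules of `B ⊗_A X`. -/
def tensIso (X : Cx A) :
    (tens (ringAsModule φ)).obj X ≅ (resCx φ).obj ((extCx φ).obj X) :=
  HomologicalComplex.Hom.isoOfComponents (fun i => tensModuleIso φ (X.X i)) (fun _ _ _ => rfl)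

theorem tensIns_tensIso (b : B) (X : Cx A) (i : ℤ) (x : X.X i) :
    ((tensIso φ X).hom.f i).hom (((tensIns (M := ringAsModule φ) b X).f i).hom x) =
      (b • tmulOne φ x : (ModuleCat.extendScalars.{u, u, u} φ).obj (X.X i)) := by
  have h := ModuleCat.ExtendScalars.smul_tmul φ b (1 : B) x
  rw [mul_one] at h
  exact h.symm

/-- The elementwise criterion does not mention scalars, so over both rings it is literally the same
statement. -/
theorem quasiIso_resCx_iff {X Y : Cx B} (f : X ⟶ Y) :
    QuasiIso ((resCx φ).map f) ↔ QuasiIso f := by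
  rw [quasiIso_iff_forall, quasiIso_iff_forall]
  rfl

theorem exactAt_resCx_iff (X : Cx B) (i : ℤ) : ((resCx φ).obj X).ExactAt i ↔ X.ExactAt i := by
  rw [exactAt_iff _ (i - 1) i (i + 1) (by lia) rfl, exactAt_iff _ (i - 1) i (i + 1) (by lia) rfl]
  rfl

/-- Base change of cochains as a morphism of complexes of `A`-modules. -/
def homCxExt (P Q : Cx A) :
    homCx P Q ⟶ (resCx φ).obj (homCx ((extCx φ).obj P) ((extCx φ).obj Q)) where
  f n := ModuleCat.ofHom (X := Cochain P Q n)
    (Y := (ModuleCat.restrictScalars.{u} φ).obj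
      ((homCx ((extCx φ).obj P) ((extCx φ).obj Q)).X n))
    { toFun := fun z => z.map (ModuleCat.extendScalars.{u, u, u} φ)
      map_add' := fun _ _ => Cochain.map_add _ _ _
      map_smul' := fun r z => by
        refine Cochain.ext _ _ fun p q h => ?_
        exact extendScalars_map_smul φ r (z.v p q h) }
  comm' n m _ := by
    ext z
    exact δ_map n m (K := P) (L := Q) z (ModuleCat.extendScalars.{u, u, u} φ)

/-- The adjunction isomorphism `Hom_B(B ⊗_A P, Y) → Hom_A(P, Y)`. -/
def homCxRes (P : Cx A) (Y : Cx B) :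
    (resCx φ).obj (homCx ((extCx φ).obj P) Y) ⟶ homCx P ((resCx φ).obj Y) where
  f n := ModuleCat.ofHom
    (X := (ModuleCat.restrictScalars.{u} φ).obj ((homCx ((extCx φ).obj P) Y).X n))
    (Y := Cochain P ((resCx φ).obj Y) n)
    { toFun := fun z => (Cochain.ofHom (oneTmulCx φ P)).comp
        (Cochain.map z (ModuleCat.restrictScalars.{u} φ)) (zero_add n)
      map_add' := fun z w => by
        rw [← Cochain.comp_add]
        rfl
      map_smul' := fun r z => by
        rw [RingHom.id_apply, ← Cochain.comp_smul]
        rfl }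
  comm' n m _ := by
    ext z
    refine (δ_ofHom_comp (oneTmulCx φ P) _ m).trans ?_
    exact congrArg (fun w => Cochain.comp (Cochain.ofHom (oneTmulCx φ P)) w (zero_add m))
      (δ_map n m (K := (extCx φ).obj P) (L := Y) z (ModuleCat.restrictScalars.{u} φ))

theorem homCxRes_apply (P : Cx A) (Y : Cx B) (n : ℤ) (z : Cochain ((extCx φ).obj P) Y n) (p q : ℤ)
    (h : p + n = q) (x : P.X p) :
    (Cochain.v (F := P) (G := (resCx φ).obj Y) (n := n)
      (((homCxRes φ P Y).f n).hom z) p q h).hom x = (z.v p q h).hom (tmulOne φ x) := by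
  change (Cochain.v (Cochain.comp (Cochain.ofHom (oneTmulCx φ P))
        (Cochain.map z (ModuleCat.restrictScalars.{u} φ)) (zero_add n)) p q h).hom x = _
  rw [Cochain.zero_cochain_comp_v]
  rfl

instance isIso_homCxRes (P : Cx A) (Y : Cx B) : IsIso (homCxRes φ P Y) := by
  have : ∀ n, IsIso ((homCxRes φ P Y).f n) := by
    intro n
    rw [ConcreteCategory.isIso_iff_bijective]
    constructor
    · intro (z : Cochain ((extCx φ).obj P) Y n) (w : Cochain ((extCx φ).obj P) Y n) h
      refine Cochain.ext _ _ fun p q hpq => ?_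
      refine extendScalars_hom_ext fun x => ?_
      refine (homCxRes_apply φ P Y n z p q hpq x).symm.trans
        (Eq.trans ?_ (homCxRes_apply φ P Y n w p q hpq x))
      exact congrArg (fun z => (Cochain.v (F := P) (G := (resCx φ).obj Y) (n := n)
        z p q hpq).hom x) h
    · intro (z : Cochain P ((resCx φ).obj Y) n)
      refine ⟨Cochain.mk (F := (extCx φ).obj P) (G := Y) (n := n) fun p q h =>
        ((ModuleCat.extendRestrictScalarsAdj.{u, u, u} φ).homEquiv _ _).symm (z.v p q h), ?_⟩
      refine Cochain.ext _ _ fun p q hpq => ?_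
      ext x
      refine (homCxRes_apply φ P Y n _ p q hpq x).trans ?_
      have := ((ModuleCat.extendRestrictScalarsAdj.{u, u, u} φ).homEquiv _ _).apply_symm_apply
        (z.v p q hpq)
      rw [Adjunction.homEquiv_unit] at this
      exact congrArg (fun k : P.X p ⟶ (ModuleCat.restrictScalars.{u} φ).obj (Y.X q) => k.hom x) this
  exact HomologicalComplex.Hom.isIso_of_components _

/-- The base change `B ⊗ F → Hom_B(B ⊗ P, B ⊗ Q)` of a morphism `F → Hom_A(P, Q)`. -/
def homCxBaseChange {F P Q : Cx A} (β : F ⟶ homCx P Q) :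
    (extCx φ).obj F ⟶ homCx ((extCx φ).obj P) ((extCx φ).obj Q) :=
  extDesc φ (β ≫ homCxExt φ P Q)

theorem homCxBaseChange_tmulOne {F P Q : Cx A} (β : F ⟶ homCx P Q) (i : ℤ) (x : F.X i) :
    ((homCxBaseChange φ β).f i).hom (tmulOne φ x) =
      Cochain.map (K := P) (L := Q) (n := i) ((β.f i).hom x)
        (ModuleCat.extendScalars.{u, u, u} φ) :=
  extDesc_tmulOne φ _ i x

/-- Both composites send b ⊗ x to the cochain y ↦ b ⊗ β(x)(y). Up to isomorphism this identifies the
base change over `B` with tensor evaluation for the `A`-module `B`, so that the flat dimension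
argument can be run over `A`. -/
theorem tensAdj_eq_homCxBaseChange {F P Q : Cx A} (β : F ⟶ homCx P Q) :
    tensAdj (ringAsModule φ) β ≫ homCxPostcomp P (tensIso φ Q).hom =
      (tensIso φ F).hom ≫ (resCx φ).map (homCxBaseChange φ β) ≫ homCxRes φ P _ := by
  refine tens_hom_ext fun (b : B) => ?_
  ext n x
  refine Cochain.ext _ _ fun p q h => ?_
  ext y
  let z : Cochain P Q n := (β.f n).hom x
  have h1 : ((homCxBaseChange φ β).f n).hom (((tensIso φ F).hom.f n).hom
      (((tensIns (M := ringAsModule φ) b F).f n).hom x)) =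
      (b • z.map (ModuleCat.extendScalars.{u, u, u} φ) :
        Cochain ((extCx φ).obj P) ((extCx φ).obj Q) n) := by
    rw [tensIns_tensIso]
    refine (map_smul ((homCxBaseChange φ β).f n).hom b (tmulOne φ x)).trans ?_
    exact congrArg (fun w : Cochain ((extCx φ).obj P) ((extCx φ).obj Q) n => b • w)
      (homCxBaseChange_tmulOne φ β n x)
  have h2 : (Cochain.v (F := P) (G := (resCx φ).obj ((extCx φ).obj Q)) (n := n)
      (((homCxRes φ P ((extCx φ).obj Q)).f n).hom (b • z.map (ModuleCat.extendScalars.{u, u, u} φ) :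
        Cochain ((extCx φ).obj P) ((extCx φ).obj Q) n)) p q h).hom y = (b • tmulOne φ ((z.v p q h).hom y) :
          (ModuleCat.extendScalars.{u, u, u} φ).obj (Q.X q)) := by
    rw [homCxRes_apply]
    rfl
  refine Eq.trans ?_ (h2.symm.trans ?_)
  · refine Eq.trans ?_ (tensIns_tensIso φ b Q q ((z.v p q h).hom y))
    have h3 : Cochain.v (Cochain.comp (Cochain.comp z
        (Cochain.ofHom (tensIns (M := ringAsModule φ) b Q)) (add_zero n))
        (Cochain.ofHom (tensIso φ Q).hom) (add_zero n)) p q h =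
        z.v p q h ≫ (tensIns (M := ringAsModule φ) b Q).f q ≫ (tensIso φ Q).hom.f q := by
      rw [Cochain.comp_zero_cochain_v, Cochain.comp_zero_cochain_v, Cochain.ofHom_v,
        Cochain.ofHom_v, Category.assoc]
    exact congrArg (fun k : P.X p ⟶ ((resCx φ).obj ((extCx φ).obj Q)).X q => k.hom y) h3
  · exact congrArg (fun w => (Cochain.v (F := P) (G := (resCx φ).obj ((extCx φ).obj Q)) (n := n)
      (((homCxRes φ P ((extCx φ).obj Q)).f n).hom w) p q h).hom y) h1.symm

/-- Base change along a ring homomorphism of finite flat dimension preserves perfect pairings. -/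
theorem quasiIso_homCxBaseChange {φ : A →+* B} (hφ : FiniteFlatDim φ) {F P Q : Cx A}
    (β : F ⟶ homCx P Q) [QuasiIso β] (hP : IsFiniteFree P)
    (hF : ∀ i, Module.Flat A (F.X i)) (hQ : ∀ i, Module.Flat A (Q.X i)) {a : ℤ} (ha : Q.IsGE a) :
    QuasiIso (homCxBaseChange φ β) := by
  obtain ⟨n, hn⟩ := hφ
  have h1 : QuasiIso (tensAdj (ringAsModule φ) β) := quasiIso_tensAdj β hP hF hQ ha n _ hn
  have h2 : QuasiIso (homCxPostcomp P (tensIso φ Q).hom) :=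
    quasiIso_homCxPostcomp hP.isKProjective _
  have h3 : QuasiIso ((tensIso φ F).hom ≫ (resCx φ).map (homCxBaseChange φ β) ≫
      homCxRes φ P _) := by
    rw [← tensAdj_eq_homCxBaseChange]
    exact quasiIso_comp _ _
  rw [← quasiIso_resCx_iff φ]
  have h4 := quasiIso_of_comp_left (tensIso φ F).hom ((resCx φ).map (homCxBaseChange φ β) ≫
      homCxRes φ P _)
  exact quasiIso_of_comp_right _ (homCxRes φ P _)

end ChangeOfRings

/-! ### Transposes of pairings -/

section Transpose

variable {R : Type u} [CommRing R]

/-- The transpose `P → Hom(F, Q)` of a morphism `F → Hom(P, Q)`. -/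
def transpose {F P Q : Cx R} (β : F ⟶ homCx P Q) : P ⟶ homCx F Q :=
  biduality P Q ≫ homCxPrecomp β Q

theorem transpose_v {F P Q : Cx R} (β : F ⟶ homCx P Q) (i : ℤ) (x : P.X i) (p q : ℤ)
    (h : p + i = q) (f : F.X p) :
    (Cochain.v (F := F) (G := Q) (n := i) (((transpose β).f i).hom x) p q h).hom f =
      (p * i).negOnePow •
        (Cochain.v (F := P) (G := Q) (n := p) ((β.f p).hom f) i q (by lia)).hom x := by
  change (Cochain.v (Cochain.comp (Cochain.ofHom β) (bidualityCochain P Q i x) (zero_add i))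
    p q h).hom f = _
  rw [Cochain.zero_cochain_comp_v, ModuleCat.hom_comp, LinearMap.comp_apply, bidualityCochain_v,
    Cochain.ofHom_v]

theorem transpose_postcomp {F P Q Q' : Cx R} (β : F ⟶ homCx P Q) (g : Q ⟶ Q') :
    transpose (β ≫ homCxPostcomp P g) = transpose β ≫ homCxPostcomp F g := by
  ext i x
  refine Cochain.ext _ _ fun p q h => ?_
  ext f
  refine (transpose_v _ i x p q h f).trans ?_
  refine Eq.trans ?_ (comp_ofHom_v_apply (((transpose β).f i).hom x) g p q h f).symm
  rw [transpose_v]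
  have h2 := comp_ofHom_v_apply (X := P) ((β.f p).hom f) g i q (by lia) x
  refine (congrArg (fun y => (p * i).negOnePow • y) h2).trans ?_
  simp [Units.smul_def]

theorem transpose_precomp {F P P' Q : Cx R} (β : F ⟶ homCx P Q) (w : P' ⟶ P) :
    transpose (β ≫ homCxPrecomp w Q) = w ≫ transpose β := by
  ext i x
  refine Cochain.ext _ _ fun p q h => ?_
  ext f
  refine (transpose_v _ i x p q h f).trans ?_
  refine Eq.trans ?_ (transpose_v β i ((w.f i).hom x) p q h f).symm
  refine congrArg (fun y => (p * i).negOnePow • y) ?_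
  exact ofHom_comp_v_apply (Y := Q) w ((β.f p).hom f) i q (by lia) x

theorem transpose_comp {F F' P Q : Cx R} (β : F ⟶ homCx P Q) (v : F' ⟶ F) :
    transpose (v ≫ β) = transpose β ≫ homCxPrecomp v Q := by
  rw [transpose, transpose, homCxPrecomp_comp, Category.assoc]

/-- Evaluated on 1 ⊗ x and 1 ⊗ f, both sides give the original value of the pairing with the same
sign. Hence the second half of reflexivity is transported by the same base change theorem as the
first. -/
theorem transpose_homCxBaseChange {A B : Type u} [CommRing A] [CommRing B] (φ : A →+* B)
    {F P Q : Cx A} (β : F ⟶ homCx P Q) :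
    transpose (homCxBaseChange φ β) = homCxBaseChange φ (transpose β) := by
  refine extCx_hom_ext fun i x => ?_
  refine Eq.trans ?_ (homCxBaseChange_tmulOne φ (transpose β) i x).symm
  refine Cochain.ext _ _ fun p q h => ?_
  refine extendScalars_hom_ext fun f => ?_
  have h1 := transpose_v (homCxBaseChange φ β) i (tmulOne φ x) p q h (tmulOne φ f)
  have h2 : (Cochain.v (F := (extCx φ).obj P) (G := (extCx φ).obj Q) (n := p)
      (((homCxBaseChange φ β).f p).hom (tmulOne φ f)) i q (by lia)).hom (tmulOne φ x) =
      tmulOne φ ((Cochain.v (F := P) (G := Q) (n := p) ((β.f p).hom f) i q (by lia)).hom x) :=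
    congrArg (fun w : Cochain ((extCx φ).obj P) ((extCx φ).obj Q) p =>
      (w.v i q (by lia)).hom (tmulOne φ x)) (homCxBaseChange_tmulOne φ β p f)
  have h3 : (Cochain.v (Cochain.map (K := F) (L := Q) (n := i) (((transpose β).f i).hom x)
      (ModuleCat.extendScalars.{u, u, u} φ)) p q h).hom (tmulOne φ f) =
      tmulOne φ ((Cochain.v (F := F) (G := Q) (n := i) (((transpose β).f i).hom x) p q h).hom f) :=
    rfl
  have h4 := congrArg (tmulOne φ) (transpose_v β i x p q h f)
  have h5 := tmulOne_units_smul φ (p * i).negOnePow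
    ((Cochain.v (F := P) (G := Q) (n := p) ((β.f p).hom f) i q (by lia)).hom x)
  exact h1.trans ((congrArg (fun w => (p * i).negOnePow • w) h2).trans
    (h5.symm.trans (h4.symm.trans h3.symm)))

end Transpose

end

end SemiDual

namespace SemiDual

noncomputable section

open scoped TensorProduct
open HomologicalComplex Limits

/-! ### Finiteness and boundedness of cohomology -/

section Homology

variable {R : Type u} [CommRing R]

/-- The cocycles of a complex of modules. -/
abbrev cyclesSub (X : Cx R) (i j : ℤ) : Submodule R (X.X i) := LinearMap.ker (X.d i j).hom

/-- The coboundaries, as a submodule of the cocycles. -/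
abbrev boundarySub (X : Cx R) (h i j : ℤ) : Submodule R (cyclesSub X i j) :=
  (LinearMap.range (X.d h i).hom).comap (cyclesSub X i j).subtype

theorem homology_linearEquiv (X : Cx R) (h i j : ℤ) (hi : h + 1 = i) (hj : i + 1 = j) :
    Nonempty (X.homology i ≃ₗ[R] cyclesSub X i j ⧸ boundarySub X h i j) := by
  have e1 : X.homology i ≅ (X.sc' h i j).homology :=
    ShortComplex.homologyMapIso (X.isoSc' h i j (by simp; lia) (by simp; lia))
  have e2 := (X.sc' h i j).moduleCatHomologyIso
  refine ⟨(e1 ≪≫ e2).toLinearEquiv.trans (Submodule.quotEquivOfEq _ _ ?_)⟩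
  ext ⟨x, hx⟩
  constructor
  · rintro ⟨y, hy⟩
    exact ⟨y, congrArg Subtype.val hy⟩
  · rintro ⟨y, hy⟩
    exact ⟨y, Subtype.ext hy⟩

theorem finite_homology (X : Cx R) [IsNoetherianRing R] (i : ℤ) (hX : Module.Finite R (X.X i)) :
    Module.Finite R (X.homology i) := by
  obtain ⟨e⟩ := homology_linearEquiv X (i - 1) i (i + 1) (by lia) rfl
  exact Module.Finite.equiv e.symm

/-- Generators of cocycles modulo coboundaries lift to cocycles because the module `Fin s → R` is
free. -/
theorem exists_generators_homology (X : Cx R) (h i j : ℤ) (hi : h + 1 = i) (hj : i + 1 = j)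
    (hX : Module.Finite R (X.homology i)) : ∃ (s : ℕ) (y : (Fin s → R) →ₗ[R] X.X i),
      (∀ c, (X.d i j).hom (y c) = 0) ∧ ∀ x, (X.d i j).hom x = 0 →
        ∃ c, ∃ w : X.X h, y c = x + (X.d h i).hom w := by
  obtain ⟨e⟩ := homology_linearEquiv X h i j hi hj
  have : Module.Finite R (cyclesSub X i j ⧸ boundarySub X h i j) := Module.Finite.equiv e
  obtain ⟨s, y, hy⟩ := Module.Finite.exists_fin' R (cyclesSub X i j ⧸ boundarySub X h i j)
  obtain ⟨y', hy'⟩ := Module.projective_lifting_property (boundarySub X h i j).mkQ y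
    (Submodule.mkQ_surjective _)
  refine ⟨s, (cyclesSub X i j).subtype ∘ₗ y', fun c => (y' c).2, fun x hx => ?_⟩
  obtain ⟨c, hc⟩ := hy (Submodule.Quotient.mk ⟨x, hx⟩)
  rw [← hy', LinearMap.comp_apply, Submodule.mkQ_apply, Submodule.Quotient.eq] at hc
  obtain ⟨w, hw⟩ := hc
  refine ⟨c, w, eq_add_of_sub_eq' ?_⟩
  exact hw.symm

theorem homologicallyFinite_iff (X : Cx R) :
    HomologicallyFinite X ↔ (∀ i, Module.Finite R (X.homology i)) ∧ HomologicallyBounded X := by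
  classical
  constructor
  · intro hX
    have hX' : Module.Finite R (⨁ i : ℤ, X.homology i) := hX
    refine ⟨fun i => Module.Finite.of_surjective (DirectSum.component R ℤ (fun i => X.homology i) i)
      fun x => ⟨DirectSum.lof R ℤ _ i x,
        DirectSum.component.lof_self R (M := fun i => X.homology i) i x⟩, ?_⟩
    obtain ⟨s, hs⟩ := hX'.fg_top
    -- Finitely many generators involve only finitely many degrees; the projection to any other
    -- degree kills all of them, hence everything.
    let t : Finset ℤ := s.biUnion fun x => DFinsupp.support x
    refine ⟨t.sup Int.natAbs, fun i hi => ?_⟩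
    have hit : i ∉ t := by
      intro h
      have := Finset.le_sup (f := Int.natAbs) h
      rw [Int.abs_eq_natAbs] at hi
      lia
    have h0 : DirectSum.component R ℤ (fun i => X.homology i) i = 0 := by
      refine LinearMap.ext_on hs fun x hx => ?_
      have : i ∉ DFinsupp.support x := fun h => hit (Finset.mem_biUnion.2 ⟨x, hx, h⟩)
      exact DFinsupp.notMem_support_iff.1 this
    refine ⟨fun x y => ?_⟩
    rw [← DirectSum.component.lof_self R (M := fun i => X.homology i) i x, ← DirectSum.component.lof_self R (M := fun i => X.homology i) i y, h0]
    rfl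
  · rintro ⟨hX, n, hn⟩
    let f : (∀ i : Finset.Icc (-n : ℤ) n, X.homology i) →ₗ[R] ⨁ i : ℤ, X.homology i :=
      ∑ i : Finset.Icc (-n : ℤ) n, (DirectSum.lof R ℤ (fun i => X.homology i) i.1) ∘ₗ
        LinearMap.proj i
    refine Module.Finite.of_surjective f ?_
    rw [← LinearMap.range_eq_top, eq_top_iff]
    rintro x -
    induction x using DirectSum.induction_on with
    | zero => exact zero_mem _
    | add x y hx hy => exact add_mem hx hy
    | of i x =>
      by_cases hi : i ∈ Finset.Icc (-n : ℤ) n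
      · refine ⟨Pi.single ⟨i, hi⟩ x, ?_⟩
        rw [LinearMap.sum_apply, Finset.sum_eq_single ⟨i, hi⟩]
        · rw [LinearMap.comp_apply, LinearMap.proj_apply, Pi.single_eq_same]
          rfl
        · intro j _ hj
          rw [LinearMap.comp_apply, LinearMap.proj_apply, Pi.single_eq_of_ne hj, map_zero]
        · intro h
          exact absurd (Finset.mem_univ _) h
      · have := hn i (by
          rw [Finset.mem_Icc] at hi
          by_contra h
          rw [not_lt, abs_le] at h
          exact hi h)
        rw [Subsingleton.elim x 0, map_zero]
        exact zero_mem _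

theorem homologicallyBounded_iff (X : Cx R) :
    HomologicallyBounded X ↔ ∃ a b : ℤ, X.IsGE a ∧ X.IsLE b := by
  constructor
  · rintro ⟨n, hn⟩
    refine ⟨-n, n, (X.isGE_iff _).2 fun i hi => ?_, (X.isLE_iff _).2 fun i hi => ?_⟩
    · rw [exactAt_iff_subsingleton]
      exact hn i (by rw [lt_abs]; lia)
    · rw [exactAt_iff_subsingleton]
      exact hn i (by rw [lt_abs]; lia)
  · rintro ⟨a, b, ha, hb⟩
    refine ⟨max a.natAbs b.natAbs, fun i hi => ?_⟩
    rw [← exactAt_iff_subsingleton]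
    rcases lt_abs.1 hi with hi | hi
    · exact X.exactAt_of_isLE b i (by lia)
    · exact X.exactAt_of_isGE a i (by lia)

end Homology

/-! ### Resolutions by finite free modules -/

section Resolution

variable {R : Type u} [CommRing R]

/-- A stage of the construction of a free resolution of `X`: a finite free module with a submodule
of prescribed cocycles and a map to the terms of `X`. -/
structure ResolutionStage (X : Cx R) where
  rank : ℕ
  cocycles : Submodule R (Fin rank → R)
  -- Landing in the family of all terms lets the stages of every degree share one type, so the
  -- recursion over degrees is not dependently typed. Only the component in the degree of the stage
  -- is used.
  toTerm : (Fin rank → R) →ₗ[R] ∀ i, X.X i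

/-- The map to `X` is surjective on cohomology in degree `i`. -/
def ResolutionStage.Covers {X : Cx R} (s : ResolutionStage X) (i : ℤ) : Prop :=
  ∀ y : X.X i, (X.d i (i + 1)).hom y = 0 → ∃ z ∈ s.cocycles, ∃ w : X.X (i - 1),
    s.toTerm z i = y + (X.d (i - 1) i).hom w

/-- The differential `d` extends a stage in degree `i + 1` by one in degree `i`. -/
structure ResolutionStage.Extends {X : Cx R} (s' s : ResolutionStage X) (i : ℤ)
    (d : (Fin s'.rank → R) →ₗ[R] (Fin s.rank → R)) : Prop where
  ker_eq : LinearMap.ker d = s'.cocycles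
  mem_range_iff : ∀ z, z ∈ LinearMap.range d ↔
    z ∈ s.cocycles ∧ ∃ x, (X.d i (i + 1)).hom x = s.toTerm z (i + 1)
  comm : ∀ c, (X.d i (i + 1)).hom (s'.toTerm c i) = s.toTerm (d c) (i + 1)

/-- The stage `s'` in degree `i` can be placed before the stage `s` in degree `i + 1`. -/
def ResolutionStage.Precedes {X : Cx R} (s' s : ResolutionStage X) (i : ℤ) : Prop :=
  ∃ d, s'.Extends s i d

/-- Two kinds of basis vectors are used. The first `r` map onto the cocycles of `s` whose image in
`X` is a boundary; there are finitely many since the ring is Noetherian, and freeness supplies the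
bounding elements in `X`. The last `m` have differential zero and map to generators of the
cohomology of `X` in degree `i`. -/
theorem ResolutionStage.exists_extends [IsNoetherianRing R] {X : Cx R}
    (hX : ∀ i, Module.Finite R (X.homology i)) (s : ResolutionStage X) (i : ℤ) :
    ∃ s' : ResolutionStage X, s'.Covers i ∧ s'.Precedes s i := by
  classical
  obtain ⟨m, y, hy, hy'⟩ := exists_generators_homology X (i - 1) i (i + 1) (by lia) rfl (hX i)
  let N : Submodule R (Fin s.rank → R) := s.cocycles ⊓
    (LinearMap.range (X.d i (i + 1)).hom).comap (LinearMap.proj (i + 1) ∘ₗ s.toTerm)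
  obtain ⟨r, g, hg⟩ := Module.Finite.exists_fin' R N
  have : ∃ x : (Fin r → R) →ₗ[R] X.X i, ∀ c,
      (X.d i (i + 1)).hom (x c) = s.toTerm (g c) (i + 1) := by
    have h : ∀ c, s.toTerm (g c) (i + 1) ∈ LinearMap.range (X.d i (i + 1)).hom :=
      fun c => (g c).2.2
    let k : (Fin r → R) →ₗ[R] LinearMap.range (X.d i (i + 1)).hom :=
      LinearMap.codRestrict _ (LinearMap.proj (i + 1) ∘ₗ s.toTerm ∘ₗ N.subtype ∘ₗ g) h
    obtain ⟨x, hx⟩ := Module.projective_lifting_property (X.d i (i + 1)).hom.rangeRestrict k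
      (LinearMap.surjective_rangeRestrict _)
    exact ⟨x, fun c => congrArg Subtype.val (LinearMap.congr_fun hx c)⟩
  obtain ⟨x, hx⟩ := this
  let e : (Fin (r + m) → R) ≃ₗ[R] (Fin r → R) × (Fin m → R) :=
    (LinearEquiv.funCongrLeft R R finSumFinEquiv).trans
      (LinearEquiv.sumArrowLequivProdArrow (Fin r) (Fin m) R R)
  let d : (Fin (r + m) → R) →ₗ[R] (Fin s.rank → R) :=
    N.subtype ∘ₗ g ∘ₗ LinearMap.fst _ _ _ ∘ₗ e.toLinearMap
  let t : (Fin (r + m) → R) →ₗ[R] X.X i := LinearMap.coprod x y ∘ₗ e.toLinearMap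
  have hd : ∀ c, (X.d i (i + 1)).hom (t c) = s.toTerm (d c) (i + 1) := by
    intro c
    change (X.d i (i + 1)).hom (x (e c).1 + y (e c).2) = _
    rw [map_add, hy, add_zero, hx]
    rfl
  refine ⟨⟨r + m, LinearMap.ker d, LinearMap.single R (fun i => X.X i) i ∘ₗ t⟩, ?_, d,
    ⟨rfl, ?_, ?_⟩⟩
  · intro v hv
    obtain ⟨c, w, hc⟩ := hy' v hv
    refine ⟨e.symm (0, c), ?_, w, ?_⟩
    · rw [LinearMap.mem_ker]
      change (g (e (e.symm (0, c))).1 : Fin s.rank → R) = 0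
      rw [e.apply_symm_apply, map_zero]
      rfl
    · rw [LinearMap.comp_apply, LinearMap.single_apply, Pi.single_eq_same, ← hc]
      change x (e (e.symm (0, c))).1 + y (e (e.symm (0, c))).2 = _
      rw [e.apply_symm_apply, map_zero, zero_add]
  · intro z
    constructor
    · rintro ⟨c, rfl⟩
      exact (g (e c).1).2
    · intro hz
      obtain ⟨c, hc⟩ := hg ⟨z, hz⟩
      refine ⟨e.symm (c, 0), ?_⟩
      change (g (e (e.symm (c, 0))).1 : Fin s.rank → R) = z
      rw [e.apply_symm_apply, hc]
  · intro c
    rw [LinearMap.comp_apply, LinearMap.single_apply, Pi.single_eq_same, hd]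

/-- A strictly bounded above complex with finite cohomology has stages in all degrees. -/
theorem exists_resolutionStages [IsNoetherianRing R] {X : Cx R}
    (hX : ∀ i, Module.Finite R (X.homology i)) (b : ℤ) (hb : X.IsStrictlyLE b) :
    ∃ st : ℤ → ResolutionStage X, (∀ i, (st i).Covers i) ∧
      (∀ i, (st i).Precedes (st (i + 1)) i) ∧ ∀ i, b < i → (st i).rank = 0 := by
  choose step hstep using fun (i : ℤ) (s : ResolutionStage X) => s.exists_extends hX i
  let z : ResolutionStage X := ⟨0, ⊥, 0⟩
  have hsub : ∀ i, b < i → ∀ x : X.X i, x = 0 := fun i hi x => by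
    have := ModuleCat.subsingleton_of_isZero (X.isZero_of_isStrictlyLE b i hi)
    exact Subsingleton.elim _ _
  have hz : ∀ i, b < i → z.Covers i := fun i hi =>
    fun y _ => ⟨0, zero_mem _, 0, by rw [hsub i hi (y + _)]; exact hsub i hi _⟩
  -- `G n` is the stage in degree b + 1 - n, so `G 0` is the zero stage just above the bound, and `G
  -- (n + 1)` is built in degree b - n.
  let G : ℕ → ResolutionStage X := fun n => Nat.rec z (fun n s => step (b - n) s) n
  have hG0 : G 0 = z := rfl
  have hGs : ∀ n : ℕ, G (n + 1) = step (b - n) (G n) := fun n => rfl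
  have hst0 : ∀ i, b < i → G (b + 1 - i).toNat = z := fun i hi => by
    rw [show (b + 1 - i).toNat = 0 by lia, hG0]
  have hstep' : ∀ i, i ≤ b → G (b + 1 - i).toNat = step i (G (b + 1 - (i + 1)).toNat) := by
    intro i hi
    rw [show (b + 1 - i).toNat = (b + 1 - (i + 1)).toNat + 1 by lia, hGs,
      show b - (((b + 1 - (i + 1)).toNat : ℕ) : ℤ) = i by lia]
  refine ⟨fun i => G (b + 1 - i).toNat, fun i => ?_, fun i => ?_, fun i hi => ?_⟩
  · rcases lt_or_ge b i with hi | hi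
    · simp only
      rw [hst0 i hi]
      exact hz i hi
    · simp only
      rw [hstep' i hi]
      exact (hstep i _).1
  · rcases lt_or_ge b i with hi | hi
    · simp only
      rw [hst0 i hi, hst0 (i + 1) (by lia)]
      refine ⟨0, ?_, fun v => ?_, fun v => ?_⟩
      · exact Subsingleton.elim (α := Submodule R (Fin 0 → R)) _ _
      · have hv : v = 0 := Subsingleton.elim (α := Fin 0 → R) _ _
        subst hv
        exact ⟨fun _ => ⟨zero_mem _, 0, by rw [map_zero, map_zero]; rfl⟩, fun _ => zero_mem _⟩
      · exact (hsub (i + 1) (by lia) _).trans (hsub (i + 1) (by lia) _).symm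
    · simp only
      rw [hstep' i hi]
      exact (hstep i _).2
  · simp only
    rw [hst0 i hi]

/-- The stages are assembled into a complex. Injectivity on cohomology holds because the image of d
consists of all cocycles that become boundaries in `X`; surjectivity is `ResolutionStage.Covers`. -/
theorem exists_isFiniteFree_of_isStrictlyLE [IsNoetherianRing R] {X : Cx R}
    (hX : ∀ i, Module.Finite R (X.homology i)) (b : ℤ) (hb : X.IsStrictlyLE b) :
    ∃ (P : Cx R) (π : P ⟶ X), IsFiniteFree P ∧ QuasiIso π ∧ P.IsStrictlyLE b := by
  obtain ⟨st, hst, hd, hst0⟩ := exists_resolutionStages hX b hb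
  choose d hd using hd
  have hst' : ∀ h i, h + 1 = i → ∀ y : X.X i, (X.d i (i + 1)).hom y = 0 →
      ∃ z ∈ (st i).cocycles, ∃ w : X.X h, (st i).toTerm z i = y + (X.d h i).hom w := by
    intro h i hi
    obtain rfl : h = i - 1 := by lia
    exact hst i
  have hdd : ∀ i (c : Fin (st i).rank → R), d (i + 1) (d i c) = 0 := fun i c => by
    have h1 := ((hd i).mem_range_iff (d i c)).1 ⟨c, rfl⟩
    rw [← (hd (i + 1)).ker_eq] at h1
    exact h1.1
  let P : Cx R := CochainComplex.of (fun i => ModuleCat.of R (Fin (st i).rank → R))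
    (fun i => ModuleCat.ofHom (d i)) (fun i => by ext1; exact LinearMap.ext (hdd i))
  have hPd : ∀ i, P.d i (i + 1) = ModuleCat.ofHom (d i) := fun i => by
    exact CochainComplex.of_d (fun i => ModuleCat.of R (Fin (st i).rank → R))
      (fun i => ModuleCat.ofHom (d i)) i
  let π : P ⟶ X :=
    { f := fun i => ModuleCat.ofHom (X := Fin (st i).rank → R)
        (LinearMap.proj i ∘ₗ (st i).toTerm)
      comm' := by
        rintro i _ rfl
        rw [hPd]
        ext1
        exact LinearMap.ext (hd i).comm }
  have hPb : P.IsStrictlyLE b := by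
    rw [CochainComplex.isStrictlyLE_iff]
    intro i hi
    rw [ModuleCat.isZero_iff_subsingleton]
    change Subsingleton (Fin (st i).rank → R)
    rw [hst0 i hi]
    infer_instance
  refine ⟨P, π, ⟨fun i => ?_, fun i => ?_, b, hPb⟩, ?_, hPb⟩
  · exact inferInstanceAs (Module.Free R (Fin (st i).rank → R))
  · exact inferInstanceAs (Module.Finite R (Fin (st i).rank → R))
  · rw [quasiIso_iff_forall]
    rintro h _ _ rfl rfl
    constructor
    · intro x hx y hy
      rw [hPd] at hx ⊢
      refine ((hd h).mem_range_iff x).2 ⟨?_, y, hy⟩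
      rw [← (hd (h + 1)).ker_eq]
      exact hx
    · intro y hy
      obtain ⟨z, hz, w, hw⟩ := hst' h (h + 1) rfl y hy
      refine ⟨z, ?_, w, hw⟩
      rw [hPd]
      rw [← (hd (h + 1)).ker_eq] at hz
      exact hz

/-- A complex with finite, bounded above cohomology over a Noetherian ring has a resolution by
finite free modules. -/
theorem exists_isFiniteFree [IsNoetherianRing R] {X : Cx R}
    (hX : ∀ i, Module.Finite R (X.homology i)) {b : ℤ} (hb : X.IsLE b) :
    ∃ (P : Cx R) (π : P ⟶ X), IsFiniteFree P ∧ QuasiIso π ∧ P.IsStrictlyLE b := by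
  have hq : QuasiIso (X.ιTruncLE b) := inferInstance
  obtain ⟨P, π, hP, hπ, hPb⟩ := exists_isFiniteFree_of_isStrictlyLE (X := X.truncLE b) (fun i => by
    have e := (asIso (homologyMap (X.ιTruncLE b) i)).toLinearEquiv
    have := hX i
    exact Module.Finite.equiv e.symm) b inferInstance
  exact ⟨P, π ≫ X.ιTruncLE b, hP, quasiIso_comp _ _, hPb⟩

end Resolution

end

end SemiDual

namespace SemiDual

noncomputable section

open scoped TensorProduct
open HomologicalComplex Limits

/-! ### The homothety morphism and its base change -/

section Single

variable {R : Type u} [CommRing R]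

/-- The element of `asComplex M` in degree `0` given by an element of `M`. -/
def singleElt {M : ModuleCat.{u} R} (x : M) : (asComplex M).X 0 :=
  (singleObjXSelf (ComplexShape.up ℤ) 0 M).inv.hom x

theorem asComplex_hom_ext {M : ModuleCat.{u} R} {Y : Cx R} {f g : asComplex M ⟶ Y}
    (h : ∀ x : M, (f.f 0).hom (singleElt x) = (g.f 0).hom (singleElt x)) : f = g := by
  refine from_single_hom_ext ?_
  rw [← cancel_epi (singleObjXSelf (ComplexShape.up ℤ) 0 M).inv]
  ext x
  exact h x

theorem homothety_singleElt (X : Cx R) (r : R) :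
    ((homothety X).f 0).hom (singleElt (M := ModuleCat.of R R) r) =
      (r • Cochain.ofHom (𝟙 X) : Cochain X X 0) := by
  have h : (singleObjXSelf (ComplexShape.up ℤ) 0 (ModuleCat.of R R)).inv ≫ (homothety X).f 0 =
      homothetyZero X := by
    rw [homothety, mkHomFromSingle_f, Iso.inv_hom_id_assoc]
  exact congrArg (fun k : ModuleCat.of R R ⟶ (homCx X X).X 0 => k.hom r) h

theorem single_map_singleElt {M N : ModuleCat.{u} R} (f : M ⟶ N) (x : M) :
    (((HomologicalComplex.single (ModuleCat.{u} R) (ComplexShape.up ℤ) 0).map f).f 0).hom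
      (singleElt x) = singleElt (f.hom x) := by
  have h : (singleObjXSelf (ComplexShape.up ℤ) 0 M).inv ≫
      ((HomologicalComplex.single (ModuleCat.{u} R) (ComplexShape.up ℤ) 0).map f).f 0 =
      f ≫ (singleObjXSelf (ComplexShape.up ℤ) 0 N).inv := by
    rw [single_map_f_self, Iso.inv_hom_id_assoc]
  exact congrArg (fun k : M ⟶ (asComplex N).X 0 => k.hom x) h

theorem flat_asComplex_ring (i : ℤ) : Module.Flat R ((asComplex (ModuleCat.of R R)).X i) := by
  by_cases hi : i = 0
  · subst hi
    exact Module.Flat.of_linearEquiv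
      (singleObjXSelf (ComplexShape.up ℤ) 0 (ModuleCat.of R R)).toLinearEquiv
  · have := ModuleCat.subsingleton_of_isZero
      (isZero_single_obj_X (ComplexShape.up ℤ) 0 (ModuleCat.of R R) i hi)
    infer_instance

/-- Both composites send r to r·w. This makes the semidualizing condition independent of the chosen
resolution. -/
theorem homothety_postcomp {P P' : Cx R} (w : P ⟶ P') :
    homothety P ≫ homCxPostcomp P w = homothety P' ≫ homCxPrecomp w P' := by
  refine asComplex_hom_ext fun (r : R) => ?_
  have h1 := congrArg (fun z : Cochain P P 0 => ((homCxPostcomp P w).f 0).hom z)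
    (homothety_singleElt P r)
  have h2 := congrArg (fun z : Cochain P' P' 0 => ((homCxPrecomp w P').f 0).hom z)
    (homothety_singleElt P' r)
  refine h1.trans (Eq.trans ?_ h2.symm)
  refine Cochain.ext _ _ fun p q h => ?_
  ext x
  refine (comp_ofHom_v_apply (r • Cochain.ofHom (𝟙 P)) w p q h x).trans ?_
  refine Eq.trans ?_ (ofHom_comp_v_apply w (r • Cochain.ofHom (𝟙 P')) p q h x).symm
  obtain rfl : p = q := by lia
  simp

end Single

section HomothetyBaseChange

variable {A B : Type u} [CommRing A] [CommRing B] (φ : A →+* B)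

/-- The ring homomorphism as a linear map. -/
def extRingAux : ModuleCat.of A A ⟶ ringAsModule φ :=
  ModuleCat.ofHom (X := A) (Y := (ModuleCat.restrictScalars.{u} φ).obj (ModuleCat.of B B))
    { toFun := fun a => φ a
      map_add' := map_add φ
      map_smul' := map_mul φ }

/-- `B ≅ B ⊗_A A`. -/
def extRingIso : ModuleCat.of B B ≅ (ModuleCat.extendScalars.{u, u, u} φ).obj (ModuleCat.of A A) where
  hom := ModuleCat.ofHom (X := B) (Y := (ModuleCat.extendScalars.{u, u, u} φ).obj (ModuleCat.of A A))
    (LinearMap.toSpanSingleton B ((ModuleCat.extendScalars.{u, u, u} φ).obj (ModuleCat.of A A))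
      (tmulOne φ (X := ModuleCat.of A A) (1 : A)))
  inv := ((ModuleCat.extendRestrictScalarsAdj.{u, u, u} φ).homEquiv _ _).symm
    (extRingAux φ)
  hom_inv_id := by
    ext
    have h := ((ModuleCat.extendRestrictScalarsAdj.{u, u, u} φ).homEquiv _ _).apply_symm_apply
      (extRingAux φ)
    rw [Adjunction.homEquiv_unit] at h
    have h1 := congrArg (fun k : ModuleCat.of A A ⟶ ringAsModule φ => k.hom (1 : A)) h
    refine (congrArg (((ModuleCat.extendRestrictScalarsAdj.{u, u, u} φ).homEquiv _ _).symm
      (extRingAux φ)).hom (one_smul B (tmulOne φ (X := ModuleCat.of A A) (1 : A)))).trans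
      (h1.trans (map_one φ))
  inv_hom_id := by
    refine extendScalars_hom_ext fun x => ?_
    have h := ((ModuleCat.extendRestrictScalarsAdj.{u, u, u} φ).homEquiv _ _).apply_symm_apply
      (extRingAux φ)
    rw [Adjunction.homEquiv_unit] at h
    have h1 := congrArg (fun k : ModuleCat.of A A ⟶ ringAsModule φ => k.hom x) h
    refine (congrArg (LinearMap.toSpanSingleton B
      ((ModuleCat.extendScalars.{u, u, u} φ).obj (ModuleCat.of A A))
      (tmulOne φ (X := ModuleCat.of A A) (1 : A))) h1).trans ?_
    refine (tmulOne_smul φ x (1 : ModuleCat.of A A)).symm.trans ?_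
    exact congrArg (tmulOne φ (X := ModuleCat.of A A)) (mul_one x)

/-- `B → B ⊗_A A` as complexes. -/
def extRingCxIso : asComplex (ModuleCat.of B B) ≅ (extCx φ).obj (asComplex (ModuleCat.of A A)) :=
  (HomologicalComplex.single (ModuleCat.{u} B) (ComplexShape.up ℤ) 0).mapIso (extRingIso φ) ≪≫
    ((singleMapHomologicalComplex (ModuleCat.extendScalars.{u, u, u} φ)
      (ComplexShape.up ℤ) 0).app (ModuleCat.of A A)).symm

theorem extRingCxIso_singleElt (b : B) :
    ((extRingCxIso φ).hom.f 0).hom (singleElt (M := ModuleCat.of B B) b) =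
      (b • tmulOne φ (singleElt (M := ModuleCat.of A A) (1 : A)) :
        (ModuleCat.extendScalars.{u, u, u} φ).obj ((asComplex (ModuleCat.of A A)).X 0)) := by
  have h1 := congrArg (((singleMapHomologicalComplex (ModuleCat.extendScalars.{u, u, u} φ)
      (ComplexShape.up ℤ) 0).inv.app (ModuleCat.of A A)).f 0).hom
      (single_map_singleElt (extRingIso φ).hom b)
  refine h1.trans ?_
  have h2 : (singleObjXSelf (ComplexShape.up ℤ) 0
      ((ModuleCat.extendScalars.{u, u, u} φ).obj (ModuleCat.of A A))).inv ≫
      ((singleMapHomologicalComplex (ModuleCat.extendScalars.{u, u, u} φ)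
      (ComplexShape.up ℤ) 0).inv.app (ModuleCat.of A A)).f 0 =
      (ModuleCat.extendScalars.{u, u, u} φ).map
        (singleObjXSelf (ComplexShape.up ℤ) 0 (ModuleCat.of A A)).inv := by
    rw [singleMapHomologicalComplex_inv_app_self]
    exact Iso.inv_hom_id_assoc _ _
  refine (congrArg (fun k : (ModuleCat.extendScalars.{u, u, u} φ).obj (ModuleCat.of A A) ⟶
    (ModuleCat.extendScalars.{u, u, u} φ).obj ((asComplex (ModuleCat.of A A)).X 0) =>
      k.hom ((extRingIso φ).hom.hom b)) h2).trans ?_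
  exact map_smul ((ModuleCat.extendScalars.{u, u, u} φ).map
    (singleObjXSelf (ComplexShape.up ℤ) 0 (ModuleCat.of A A)).inv).hom b
    (tmulOne φ (X := ModuleCat.of A A) (1 : A))

/-- Both maps are `B`-linear and send 1 to the identity. So preservation of semidualizing complexes
is the instance F = A, P = Q of the base change theorem for pairings. -/
theorem homothety_extCx (P : Cx A) :
    (extRingCxIso φ).hom ≫ homCxBaseChange φ (homothety P) = homothety ((extCx φ).obj P) := by
  refine asComplex_hom_ext fun (b : B) => ?_
  refine Eq.trans ?_ (homothety_singleElt _ b).symm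
  refine (congrArg ((homCxBaseChange φ (homothety P)).f 0).hom (extRingCxIso_singleElt φ b)).trans ?_
  refine (map_smul ((homCxBaseChange φ (homothety P)).f 0).hom b _).trans ?_
  refine congrArg (fun w : Cochain ((extCx φ).obj P) ((extCx φ).obj P) 0 => b • w) ?_
  refine (homCxBaseChange_tmulOne φ (homothety P) 0 _).trans ?_
  refine (congrArg (fun w : Cochain P P 0 => w.map (ModuleCat.extendScalars.{u, u, u} φ))
    (homothety_singleElt P 1)).trans ?_
  rw [one_smul, Cochain.map_ofHom]
  exact congrArg Cochain.ofHom ((extCx φ).map_id P)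

theorem quasiIso_homothety_extCx {φ : A →+* B} (hφ : FiniteFlatDim φ) {P : Cx A}
    (hP : IsFiniteFree P) {a : ℤ} (ha : P.IsGE a) [QuasiIso (homothety P)] :
    QuasiIso (homothety ((extCx φ).obj P)) := by
  have := quasiIso_homCxBaseChange hφ (homothety P) hP flat_asComplex_ring hP.flat ha
  rw [← homothety_extCx]
  exact quasiIso_comp _ _

theorem isFiniteFree_extCx {P : Cx A} (hP : IsFiniteFree P) : IsFiniteFree ((extCx φ).obj P) := by
  obtain ⟨b, hb⟩ := hP.bound
  refine ⟨fun i => ?_, fun i => ?_, b, ?_⟩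
  · have := hP.free i
    let := φ.toAlgebra
    exact inferInstanceAs (Module.Free B (B ⊗[A] P.X i))
  · have := hP.finite i
    let := φ.toAlgebra
    exact inferInstanceAs (Module.Finite B (B ⊗[A] P.X i))
  · infer_instance

end HomothetyBaseChange

/-! ### Boundedness under base change -/

section Bounded

variable {R : Type u} [CommRing R]

theorem exactAt_X₃_of_exactAt {S : ShortComplex (Cx R)} (hS : S.ShortExact) (i j : ℤ)
    (hij : i + 1 = j) (h₂ : S.X₂.ExactAt i) (h₁ : S.X₁.ExactAt j) : S.X₃.ExactAt i := by
  rw [exactAt_iff_isZero_homology] at h₁ h₂ ⊢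
  exact (hS.homology_exact₃ i j hij).isZero_X₂ (h₂.eq_of_src _ _) (h₁.eq_of_tgt _ _)

/-- Each step of a flat resolution of the coefficients lowers the bound by at most one, through the
long exact sequence. -/
theorem isGE_tens {P : Cx R} (hP : ∀ i, Module.Flat R (P.X i)) {a : ℤ} (ha : P.IsGE a) (n : ℕ)
    (M : ModuleCat.{u} R) (hM : FlatDimLE n M) : ((tens M).obj P).IsGE (a - n) := by
  rw [CochainComplex.isGE_iff]
  induction n generalizing M with
  | zero =>
    have : Module.Flat R M := hM
    exact fun i hi => exactAt_tens (P.exactAt_of_isGE a i (by simpa using hi))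
  | succ n ih =>
    obtain ⟨G, f, hG, hf, hK⟩ := hM
    intro i hi
    have hex : Function.Exact (LinearMap.ker f).subtype f := f.exact_subtype_ker_map
    have s1 := shortExact_tensShortComplex (LinearMap.ker f).injective_subtype hex hf P hP
    refine exactAt_X₃_of_exactAt s1 i (i + 1) rfl ?_ ?_
    · exact exactAt_tens (P.exactAt_of_isGE a i (by push_cast at hi; lia))
    · exact ih _ hK _ (by push_cast at hi; lia)

theorem isGE_extCx {A B : Type u} [CommRing A] [CommRing B] {φ : A →+* B} (hφ : FiniteFlatDim φ)
    {P : Cx A} (hP : ∀ i, Module.Flat A (P.X i)) {a : ℤ} (ha : P.IsGE a) :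
    ∃ a', ((extCx φ).obj P).IsGE a' := by
  obtain ⟨n, hn⟩ := hφ
  refine ⟨a - n, ?_⟩
  have h := isGE_tens hP ha n _ hn
  rw [CochainComplex.isGE_iff] at h ⊢
  intro i hi
  rw [← exactAt_resCx_iff φ, ← exactAt_of_quasiIso (tensIso φ P).hom]
  exact h i hi

theorem IsFiniteFree.homologicallyFinite [IsNoetherianRing R] {P : Cx R} (hP : IsFiniteFree P)
    {a : ℤ} (ha : P.IsGE a) : HomologicallyFinite P := by
  obtain ⟨b, hb⟩ := hP.bound
  rw [homologicallyFinite_iff, homologicallyBounded_iff]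
  exact ⟨fun i => finite_homology P i (hP.finite i), a, b, ha, inferInstance⟩

end Bounded

/-! ### Isomorphism in the derived category and independence of resolutions -/

section Derived

variable {R : Type u} [CommRing R]

theorem DerivedIso.of_quasiIso {X Y : Cx R} (f : X ⟶ Y) [QuasiIso f] : DerivedIso X Y :=
  ⟨asIso (DerivedCategory.Q.map f)⟩

theorem quasiIso_iff_isIso_Q {X Y : Cx R} (f : X ⟶ Y) :
    QuasiIso f ↔ IsIso (DerivedCategory.Q.map f) :=
  (DerivedCategory.isIso_Q_map_iff_quasiIso _ f).symm

/-- Maps in the derived category out of K-projective complexes come from maps of complexes. -/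
theorem exists_Q_map_eq {P X : Cx R} (hP : P.IsKProjective)
    (e : DerivedCategory.Q.obj P ⟶ DerivedCategory.Q.obj X) :
    ∃ f : P ⟶ X, DerivedCategory.Q.map f = e := by
  let κ := DerivedCategory.quotientCompQhIso (ModuleCat.{u} R)
  obtain ⟨g, hg⟩ := (CochainComplex.IsKProjective.Qh_map_bijective P
    ((HomotopyCategory.quotient _ _).obj X)).2 (κ.hom.app P ≫ e ≫ κ.inv.app X)
  obtain ⟨f, rfl⟩ := (HomotopyCategory.quotient _ (ComplexShape.up ℤ)).map_surjective g
  refine ⟨f, ?_⟩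
  have h := κ.hom.naturality f
  rw [Functor.comp_map] at h
  rw [hg, Category.assoc, Category.assoc, Iso.inv_hom_id_app, Category.comp_id] at h
  exact ((cancel_epi _).1 h).symm

theorem DerivedIso.exists_quasiIso {P X : Cx R} (h : DerivedIso P X) (hP : P.IsKProjective) :
    ∃ f : P ⟶ X, QuasiIso f := by
  obtain ⟨e⟩ := h
  obtain ⟨f, hf⟩ := exists_Q_map_eq hP e.hom
  exact ⟨f, by rw [quasiIso_iff_isIso_Q, hf]; infer_instance⟩

theorem DerivedIso.homologyEquiv {X Y : Cx R} (h : DerivedIso X Y) (i : ℤ) :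
    Nonempty (X.homology i ≅ Y.homology i) := by
  obtain ⟨e⟩ := h
  let F := DerivedCategory.homologyFunctorFactors (ModuleCat.{u} R) i
  exact ⟨(F.app X).symm ≪≫ (DerivedCategory.homologyFunctor _ i).mapIso e ≪≫ F.app Y⟩

theorem DerivedIso.exactAt_iff {X Y : Cx R} (h : DerivedIso X Y) (i : ℤ) :
    X.ExactAt i ↔ Y.ExactAt i := by
  obtain ⟨e⟩ := h.homologyEquiv i
  rw [exactAt_iff_isZero_homology, exactAt_iff_isZero_homology]
  exact e.isZero_iff

theorem DerivedIso.homologicallyBounded {X Y : Cx R} (h : DerivedIso X Y)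
    (hX : HomologicallyBounded X) : HomologicallyBounded Y := by
  obtain ⟨n, hn⟩ := hX
  refine ⟨n, fun i hi => ?_⟩
  rw [← exactAt_iff_subsingleton, ← h.exactAt_iff, exactAt_iff_subsingleton]
  exact hn i hi

theorem DerivedIso.homologicallyFinite {X Y : Cx R} (h : DerivedIso X Y)
    (hX : HomologicallyFinite X) : HomologicallyFinite Y := by
  rw [homologicallyFinite_iff] at hX ⊢
  refine ⟨fun i => ?_, h.homologicallyBounded hX.2⟩
  obtain ⟨e⟩ := h.homologyEquiv i
  have := hX.1 i
  exact Module.Finite.equiv e.toLinearEquiv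

theorem DerivedIso.quasiIso_homothety_iff {P P' : Cx R} (h : DerivedIso P P')
    (hP : P.IsKProjective) (hP' : P'.IsKProjective) :
    QuasiIso (homothety P) ↔ QuasiIso (homothety P') := by
  obtain ⟨w, hw⟩ := h.exists_quasiIso hP
  have h1 := quasiIso_homCxPostcomp hP w
  have h2 := quasiIso_homCxPrecomp hP hP' w P'
  rw [← quasiIso_iff_comp_right (homothety P) (homCxPostcomp P w), homothety_postcomp,
    quasiIso_iff_comp_right]

theorem ProjRes.derivedIso {X : Cx R} (ρ : ProjRes X) : DerivedIso ρ.P X :=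
  have := ρ.quasiIso
  DerivedIso.of_quasiIso ρ.π

/-- Any two K-projective resolutions are joined by a quasi-isomorphism, so the existential over
resolutions can be tested on a given one. -/
theorem isSemidualizing_iff {K P : Cx R} (h : DerivedIso P K) (hP : P.IsKProjective) :
    IsSemidualizing K ↔ HomologicallyFinite K ∧ QuasiIso (homothety P) := by
  refine and_congr_right fun _ => ⟨?_, fun hq => ?_⟩
  · rintro ⟨ρ, hρ⟩
    exact ((ρ.derivedIso.trans h.symm).quasiIso_homothety_iff ρ.kProjective hP).1 hρ
  · obtain ⟨f, hf⟩ := h.exists_quasiIso hP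
    exact ⟨⟨P, hP, f, hf⟩, hq⟩

theorem HomologicallyFinite.exists_resolution [IsNoetherianRing R] {K : Cx R}
    (hK : HomologicallyFinite K) : ∃ P : Cx R, IsFiniteFree P ∧ DerivedIso P K ∧
      ∃ a : ℤ, P.IsGE a := by
  rw [homologicallyFinite_iff, homologicallyBounded_iff] at hK
  obtain ⟨hK, a, b, ha, hb⟩ := hK
  obtain ⟨P, π, hP, hπ, -⟩ := exists_isFiniteFree hK hb
  have h := DerivedIso.of_quasiIso π
  refine ⟨P, hP, h, a, ?_⟩
  rw [CochainComplex.isGE_iff]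
  exact fun i hi => (h.exactAt_iff i).2 (K.exactAt_of_isGE a i hi)

theorem DerivedIso.isSemidualizing {K L : Cx R} (h : DerivedIso K L) [IsNoetherianRing R]
    (hK : IsSemidualizing K) : IsSemidualizing L := by
  obtain ⟨P, hP, hPK, -⟩ := hK.1.exists_resolution
  rw [isSemidualizing_iff hPK hP.isKProjective] at hK
  rw [isSemidualizing_iff (hPK.trans h) hP.isKProjective]
  exact ⟨h.homologicallyFinite hK.1, hK.2⟩

end Derived

/-! ### Derived base change of semidualizing complexes -/

section BaseChange

variable {A B : Type u} [CommRing A] [CommRing B] (φ : A →+* B)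

/-- Extension of scalars preserves isomorphisms in the derived category between K-projective
complexes. -/
theorem DerivedIso.extCx {P P' : Cx A} (h : DerivedIso P P') (hP : P.IsKProjective)
    (hP' : P'.IsKProjective) :
    DerivedIso ((SemiDual.extCx φ).obj P) ((SemiDual.extCx φ).obj P') := by
  obtain ⟨w, hw⟩ := h.exists_quasiIso hP
  have := quotient_isIso hP hP' w
  let e := HomotopyCategory.homotopyEquivOfIso
    (asIso ((HomotopyCategory.quotient _ (ComplexShape.up ℤ)).map w))
  have : QuasiIso ((ModuleCat.extendScalars.{u, u, u} φ).mapHomotopyEquiv e).hom := inferInstance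
  exact DerivedIso.of_quasiIso ((ModuleCat.extendScalars.{u, u, u} φ).mapHomotopyEquiv e).hom

theorem isDerivedBaseChange_iff {K P : Cx A} (h : DerivedIso P K) (hP : P.IsKProjective)
    (L : Cx B) : IsDerivedBaseChange φ K L ↔ DerivedIso L ((extCx φ).obj P) := by
  constructor
  · rintro ⟨ρ, hρ⟩
    exact hρ.trans ((ρ.derivedIso.trans h.symm).extCx φ ρ.kProjective hP)
  · intro hL
    obtain ⟨f, hf⟩ := h.exists_quasiIso hP
    exact ⟨⟨P, hP, f, hf⟩, hL⟩

theorem isSemidualizing_extCx [IsNoetherianRing A] [IsNoetherianRing B] {φ : A →+* B}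
    (hφ : FiniteFlatDim φ) {P : Cx A} (hP : IsFiniteFree P) (hPs : IsSemidualizing P) :
    IsSemidualizing ((extCx φ).obj P) := by
  have hB := isFiniteFree_extCx φ hP
  have h1 := hPs.1
  rw [homologicallyFinite_iff, homologicallyBounded_iff] at h1
  obtain ⟨-, a, b, ha, -⟩ := h1
  rw [isSemidualizing_iff (DerivedIso.refl _) hB.isKProjective]
  rw [isSemidualizing_iff (DerivedIso.refl _) hP.isKProjective] at hPs
  obtain ⟨a', ha'⟩ := isGE_extCx hφ hP.flat ha
  have := hPs.2
  exact ⟨hB.homologicallyFinite ha', quasiIso_homothety_extCx hφ hP ha⟩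

theorem shiftIso_extCx {P P' : Cx A} (h : ShiftIso P P') (hP : P.IsKProjective)
    (hP' : P'.IsKProjective) : ShiftIso ((extCx φ).obj P) ((extCx φ).obj P') := by
  obtain ⟨n, h⟩ := h
  refine ⟨n, (h.extCx φ hP inferInstance).trans (DerivedIso.of_iso ?_)⟩
  exact ((ModuleCat.extendScalars.{u, u, u} φ).mapCochainComplexShiftIso n).app P'

end BaseChange

end

end SemiDual

namespace SemiDual

noncomputable section

open scoped TensorProduct
open HomologicalComplex Limits

/-! ### Homotopy invariance of the transpose -/

section HomotopyInvariance

variable {R : Type u} [CommRing R]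

/-- The two ends of the cylinder of `F` are sections of one quasi-isomorphism between K-projective
complexes. They therefore induce the same map in the derived category after Hom(-, Y), and the
homotopy factors β and β' through these ends. -/
theorem Q_map_homCxPrecomp_eq {F Z : Cx R} (hF : F.IsKProjective) {β β' : F ⟶ Z}
    (h : Homotopy β β') (Y : Cx R) :
    DerivedCategory.Q.map (homCxPrecomp β Y) = DerivedCategory.Q.map (homCxPrecomp β' Y) := by
  have hc : ∀ j : ℤ, ∃ i, (ComplexShape.up ℤ).Rel i j := fun j => ⟨j - 1, by simp⟩
  let e := cylinder.homotopyEquiv F hc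
  have hC : CochainComplex.IsKProjective F.cylinder := e.symm.isKProjective
  have hq : QuasiIso (cylinder.π F) := inferInstanceAs (QuasiIso e.hom)
  have h1 := quasiIso_homCxPrecomp hC hF (cylinder.π F) Y
  have h2 : DerivedCategory.Q.map (homCxPrecomp (cylinder.ι₀ F) Y) =
      DerivedCategory.Q.map (homCxPrecomp (cylinder.ι₁ F) Y) := by
    rw [← cancel_epi (DerivedCategory.Q.map (homCxPrecomp (cylinder.π F) Y)), ← Functor.map_comp,
      ← Functor.map_comp, ← homCxPrecomp_comp, ← homCxPrecomp_comp, cylinder.ι₀_π, cylinder.ι₁_π]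
  rw [← cylinder.ι₀_desc β β' h, homCxPrecomp_comp, Functor.map_comp, h2, ← Functor.map_comp,
    ← homCxPrecomp_comp, cylinder.ι₁_desc]

theorem homotopy_of_Q_map_eq {F Z : Cx R} (hF : F.IsKProjective) {β β' : F ⟶ Z}
    (h : DerivedCategory.Q.map β = DerivedCategory.Q.map β') : Nonempty (Homotopy β β') := by
  refine ⟨HomotopyCategory.homotopyOfEq _ _ ?_⟩
  refine (CochainComplex.IsKProjective.Qh_map_bijective F
    ((HomotopyCategory.quotient _ _).obj Z)).1 ?_
  let κ := DerivedCategory.quotientCompQhIso (ModuleCat.{u} R)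
  rw [← cancel_mono (κ.hom.app Z)]
  exact (κ.hom.naturality β).trans ((congrArg _ h).trans (κ.hom.naturality β').symm)

/-- Two resolutions of the same complex have comparable transposes. -/
theorem quasiIso_transpose_iff {F F' P Y : Cx R} (hF : F.IsKProjective) (hF' : F'.IsKProjective)
    (β : F ⟶ homCx P Y) (β' : F' ⟶ homCx P Y) [QuasiIso β] [QuasiIso β'] :
    QuasiIso (transpose β) ↔ QuasiIso (transpose β') := by
  -- The comparison of resolutions commutes with β and β' only up to homotopy, which is why the
  -- transposes are compared in the derived category.
  obtain ⟨v, hv⟩ := exists_Q_map_eq hF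
    (DerivedCategory.Q.map β ≫ inv (DerivedCategory.Q.map β'))
  have hvq : QuasiIso v := by
    rw [quasiIso_iff_isIso_Q, hv]
    infer_instance
  obtain ⟨h⟩ := homotopy_of_Q_map_eq hF (β := v ≫ β') (β' := β) (by
    rw [Functor.map_comp, hv, Category.assoc, IsIso.inv_hom_id, Category.comp_id])
  have h1 : DerivedCategory.Q.map (transpose (v ≫ β')) = DerivedCategory.Q.map (transpose β) := by
    rw [transpose, transpose, Functor.map_comp, Functor.map_comp, Q_map_homCxPrecomp_eq hF h]
  have h2 := quasiIso_homCxPrecomp hF hF' v Y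
  rw [quasiIso_iff_isIso_Q, ← h1, ← quasiIso_iff_isIso_Q, transpose_comp, quasiIso_iff_comp_right]

end HomotopyInvariance

/-! ### Finiteness of Hom complexes -/

section FiniteHom

variable {R : Type u} [CommRing R]

theorem finite_homCx_X {P Y : Cx R} (hP : IsFiniteFree P) {a : ℤ} (ha : Y.IsStrictlyGE a)
    (hY : ∀ i, Module.Finite R (Y.X i)) (n : ℤ) : Module.Finite R ((homCx P Y).X n) := by
  obtain ⟨b, hb⟩ := hP.bound
  have := hP.free
  have := hP.finite
  have : Module.Finite R (∀ p : Finset.Icc (a - n) b, P.X p →ₗ[R] Y.X (p + n)) := inferInstance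
  exact Module.Finite.equiv (cochainEquivPi P Y n a b hb ha).symm

theorem finite_truncGE {Y : Cx R} (a : ℤ) (hY : ∀ i, Module.Finite R (Y.X i)) (i : ℤ) :
    Module.Finite R ((Y.truncGE a).X i) := by
  have := hY i
  exact Module.Finite.of_surjective ((Y.πTruncGE a).f i).hom
    ((ModuleCat.epi_iff_surjective _).1
      (inferInstanceAs (Epi ((HomologicalComplex.πTruncGE Y
        (ComplexShape.embeddingUpIntGE a)).f i))))

/-- After truncating `Y` below, each degree of the Hom complex is a finite product of finite
modules. -/
theorem finite_homology_homCx [IsNoetherianRing R] {P Y : Cx R} (hP : IsFiniteFree P) {a : ℤ} (ha : Y.IsGE a)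
    (hY : ∀ i, Module.Finite R (Y.X i)) (n : ℤ) : Module.Finite R ((homCx P Y).homology n) := by
  have h1 := quasiIso_homCxPostcomp hP.isKProjective (Y.πTruncGE a)
  have h2 := finite_homology (homCx P (Y.truncGE a)) n
    (finite_homCx_X hP (a := a) inferInstance (finite_truncGE a hY) n)
  exact Module.Finite.equiv
    (asIso (homologyMap (homCxPostcomp P (Y.πTruncGE a)) n)).symm.toLinearEquiv

end FiniteHom

/-! ### Reflexivity as a perfect pairing -/

section Reflexivity

variable {R : Type u} [CommRing R]

/-- The complexes `P` and `Q` are related by a perfect pairing `F ⊗ P → Q` with `F` a complex of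
finite free modules with bounded cohomology. -/
def IsPerfectlyPaired (P Q : Cx R) : Prop :=
  ∃ (F : Cx R) (β : F ⟶ homCx P Q), IsFiniteFree F ∧ (∃ a, F.IsGE a) ∧ QuasiIso β ∧
    QuasiIso (transpose β)

/-- Hom(P, Q) represents RHom(X, K) and has finite cohomology in each degree. Boundedness is thus
what is needed for a resolution β from a finite free complex `F` with bounded cohomology, and
computed with this resolution biduality becomes the transpose of β. The resulting condition involves
finite free complexes only and can be base changed. -/
theorem isReflexive_iff [IsNoetherianRing R] {K X P Q : Cx R} (hPX : DerivedIso P X)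
    (hQK : DerivedIso Q K) (hP : IsFiniteFree P) (hQ : IsFiniteFree Q) {a : ℤ} (ha : Q.IsGE a) :
    IsReflexive K X ↔ HomologicallyFinite X ∧ IsPerfectlyPaired P Q := by
  have hP' := hP.isKProjective
  obtain ⟨q, hq⟩ := hQK.exists_quasiIso hQ.isKProjective
  have hqP := quasiIso_homCxPostcomp hP' q
  refine and_congr_right fun _ => ⟨?_, ?_⟩
  · rintro ⟨ρ, hb, σ, hσ⟩
    obtain ⟨w, hw⟩ := (hPX.trans ρ.derivedIso.symm).exists_quasiIso hP'
    have hwK := quasiIso_homCxPrecomp hP' ρ.kProjective w K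
    have hσq := σ.quasiIso
    have hb' : HomologicallyBounded (homCx P Q) :=
      ((DerivedIso.of_quasiIso (homCxPrecomp w K)).trans
        (DerivedIso.of_quasiIso (homCxPostcomp P q)).symm).homologicallyBounded hb
    obtain ⟨F, hF, hFZ, hFa⟩ := HomologicallyFinite.exists_resolution
      ((homologicallyFinite_iff (homCx P Q)).2
        ⟨finite_homology_homCx hP ha hQ.finite, hb'⟩)
    obtain ⟨β, hβ⟩ := hFZ.exists_quasiIso hF.isKProjective
    refine ⟨F, β, hF, hFa, hβ, ?_⟩
    have hqF := quasiIso_homCxPostcomp hF.isKProjective q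
    -- `F` and `σ.P` both resolve Hom(P, K), the first through Q → K and the second through P →
    -- `ρ.P`, so their transposes can be compared.
    rw [← quasiIso_iff_comp_right (transpose β) (homCxPostcomp F q), ← transpose_postcomp,
      quasiIso_transpose_iff hF.isKProjective σ.kProjective (β ≫ homCxPostcomp P q)
        (σ.π ≫ homCxPrecomp w K), transpose_precomp]
    have : QuasiIso (transpose σ.π) := hσ
    infer_instance
  · rintro ⟨F, β, hF, hFa, hβ, hβ'⟩
    obtain ⟨w, hw⟩ := hPX.exists_quasiIso hP'
    have hb : HomologicallyBounded F := by
      obtain ⟨a, ha⟩ := hFa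
      obtain ⟨b, hb⟩ := hF.bound
      exact (homologicallyBounded_iff F).2 ⟨a, b, ha, inferInstance⟩
    have hqF := quasiIso_homCxPostcomp hF.isKProjective q
    refine ⟨⟨P, hP', w, hw⟩, ?_, ⟨F, hF.isKProjective, β ≫ homCxPostcomp P q, inferInstance⟩, ?_⟩
    · exact (DerivedIso.of_quasiIso (β ≫ homCxPostcomp P q)).homologicallyBounded hb
    · change QuasiIso (transpose (β ≫ homCxPostcomp P q))
      rw [transpose_postcomp]
      infer_instance

theorem IsPerfectlyPaired.extCx {A B : Type u} [CommRing A] [CommRing B] {φ : A →+* B}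
    (hφ : FiniteFlatDim φ) {P Q : Cx A} (h : IsPerfectlyPaired P Q) (hP : IsFiniteFree P)
    (hQ : IsFiniteFree Q) {a : ℤ} (ha : Q.IsGE a) :
    IsPerfectlyPaired ((SemiDual.extCx φ).obj P) ((SemiDual.extCx φ).obj Q) := by
  obtain ⟨F, β, hF, ⟨a', ha'⟩, hβ, hβ'⟩ := h
  refine ⟨(SemiDual.extCx φ).obj F, homCxBaseChange φ β, isFiniteFree_extCx φ hF,
    isGE_extCx hφ hF.flat ha', quasiIso_homCxBaseChange hφ β hP hF.flat hQ.flat ha, ?_⟩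
  rw [transpose_homCxBaseChange]
  exact quasiIso_homCxBaseChange hφ (transpose β) hF hP.flat hQ.flat ha

/-- Reflexivity is preserved by base change along a homomorphism of finite flat dimension. -/
theorem IsReflexive.baseChange {A B : Type u} [CommRing A] [CommRing B] [IsNoetherianRing A]
    [IsNoetherianRing B] {φ : A →+* B} (hφ : FiniteFlatDim φ) {K X : Cx A} {K' X' : Cx B}
    (h : IsReflexive K X) (hK : HomologicallyFinite K) (hK' : IsDerivedBaseChange φ K K')
    (hX' : IsDerivedBaseChange φ X X') : IsReflexive K' X' := by
  obtain ⟨P, hP, hPX, a, ha⟩ := h.1.exists_resolution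
  obtain ⟨Q, hQ, hQK, a', ha'⟩ := hK.exists_resolution
  rw [isDerivedBaseChange_iff φ hPX hP.isKProjective] at hX'
  rw [isDerivedBaseChange_iff φ hQK hQ.isKProjective] at hK'
  obtain ⟨c, hc⟩ := isGE_extCx hφ hP.flat ha
  obtain ⟨c', hc'⟩ := isGE_extCx hφ hQ.flat ha'
  rw [isReflexive_iff hPX hQK hP hQ ha'] at h
  rw [isReflexive_iff hX'.symm hK'.symm (isFiniteFree_extCx φ hP) (isFiniteFree_extCx φ hQ) hc']
  exact ⟨hX'.symm.homologicallyFinite ((isFiniteFree_extCx φ hP).homologicallyFinite hc),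
    h.2.extCx hφ hP hQ ha'⟩

end Reflexivity

end

end SemiDual

namespace SemiDual

noncomputable section

open scoped TensorProduct
open HomologicalComplex Limits CochainComplex

/-! ### Lifting cocycles in short exact sequences -/

section Elementwise

variable {R : Type u} [CommRing R]

theorem shortExact_exists_lift {S : ShortComplex (Cx R)} (hS : S.ShortExact) {i : ℤ} (x : S.X₂.X i)
    (hx : (S.g.f i).hom x = 0) : ∃ y : S.X₁.X i, (S.f.f i).hom y = x := by
  have h := (hS.map_of_exact (eval (ModuleCat.{u} R) (ComplexShape.up ℤ) i)).exact
  rw [ShortComplex.moduleCat_exact_iff] at h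
  exact h x hx

theorem shortExact_surjective {S : ShortComplex (Cx R)} (hS : S.ShortExact) (i : ℤ) :
    Function.Surjective (S.g.f i).hom := by
  have h := (hS.map_of_exact (eval (ModuleCat.{u} R) (ComplexShape.up ℤ) i)).epi_g
  exact (ModuleCat.epi_iff_surjective _).1 h

theorem shortExact_injective {S : ShortComplex (Cx R)} (hS : S.ShortExact) (i : ℤ) :
    Function.Injective (S.f.f i).hom := by
  have h := (hS.map_of_exact (eval (ModuleCat.{u} R) (ComplexShape.up ℤ) i)).mono_f
  exact (ModuleCat.mono_iff_injective _).1 h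

theorem shortExact_comp_apply (S : ShortComplex (Cx R)) {i : ℤ} (y : S.X₁.X i) :
    (S.g.f i).hom ((S.f.f i).hom y) = 0 :=
  congrArg (fun k : S.X₁ ⟶ S.X₃ => (k.f i).hom y) S.zero

/-- A cocycle of the middle term comes from the first one, up to a coboundary, when the last term
is exact. -/
theorem exists_cocycle_of_exactAt_X₃ {S : ShortComplex (Cx R)} (hS : S.ShortExact) {h i j : ℤ}
    (hi : h + 1 = i) (hj : i + 1 = j) (hX : S.X₃.ExactAt i) (x : S.X₂.X i)
    (hx : (S.X₂.d i j).hom x = 0) : ∃ y : S.X₁.X i, (S.X₁.d i j).hom y = 0 ∧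
      ∃ w : S.X₂.X h, (S.f.f i).hom y = x + (S.X₂.d h i).hom w := by
  rw [exactAt_iff _ h i j hi hj] at hX
  obtain ⟨u, hu⟩ := hX ((S.g.f i).hom x) (by rw [f_d_apply, hx, map_zero])
  obtain ⟨w, rfl⟩ := shortExact_surjective hS h u
  obtain ⟨y, hy⟩ := shortExact_exists_lift hS (x - (S.X₂.d h i).hom w) (by
    rw [map_sub, ← f_d_apply, hu, sub_self])
  refine ⟨y, ?_, -w, by rw [hy, map_neg, sub_eq_add_neg]⟩
  refine shortExact_injective hS j ?_
  rw [← f_d_apply, hy, map_sub, hx, d_d_apply, sub_zero, map_zero]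

/-- A cocycle of the last term lifts to the middle one when the first term is exact in the next
degree. -/
theorem exists_cocycle_of_exactAt_X₁ {S : ShortComplex (Cx R)} (hS : S.ShortExact) {i j k : ℤ}
    (hj : i + 1 = j) (hk : j + 1 = k) (hX : S.X₁.ExactAt j) (x : S.X₃.X i)
    (hx : (S.X₃.d i j).hom x = 0) :
    ∃ y : S.X₂.X i, (S.X₂.d i j).hom y = 0 ∧ (S.g.f i).hom y = x := by
  rw [exactAt_iff _ i j k hj hk] at hX
  obtain ⟨v, rfl⟩ := shortExact_surjective hS i x
  obtain ⟨w, hw⟩ := shortExact_exists_lift hS ((S.X₂.d i j).hom v) (by rw [← f_d_apply, hx])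
  obtain ⟨w', rfl⟩ := hX w (by
    refine shortExact_injective hS k ?_
    rw [← f_d_apply, hw, d_d_apply, map_zero])
  refine ⟨v - (S.f.f i).hom w', ?_, ?_⟩
  · rw [map_sub, f_d_apply, hw, sub_self]
  · rw [map_sub, shortExact_comp_apply, sub_zero]

end Elementwise

/-! ### Flat modules in short exact sequences -/

section Flat

variable {R : Type u} [CommRing R] {A B C : Type u} [AddCommGroup A] [Module R A] [AddCommGroup B]
  [Module R B] [AddCommGroup C] [Module R C]

/-- An extension of flat modules is flat. -/
theorem flat_of_exact {f : A →ₗ[R] B} {g : B →ₗ[R] C} (h : Function.Exact f g)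
    (hf : Function.Injective f) (hg : Function.Surjective g) (hA : Module.Flat R A)
    (hC : Module.Flat R C) : Module.Flat R B := by
  rw [Module.Flat.iff_rTensor_preserves_injective_linearMap]
  intro N N' _ _ _ _ i hi
  have hN' : Function.Injective (f.lTensor N') :=
    LinearMap.lTensor_injective_of_exact_of_flat g hg f hf h N'
  rw [← LinearMap.ker_eq_bot, LinearMap.ker_eq_bot']
  intro x hx
  have h1 : (i.rTensor C) ((g.lTensor N) x) = 0 := by
    rw [← LinearMap.comp_apply, LinearMap.rTensor_comp_lTensor, ← LinearMap.lTensor_comp_rTensor,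
      LinearMap.comp_apply, hx, map_zero]
  rw [← map_zero (i.rTensor C)] at h1
  have h2 := Module.Flat.rTensor_preserves_injective_linearMap i hi h1
  obtain ⟨y, rfl⟩ := (lTensor_exact N h hg x).1 h2
  have h3 : (f.lTensor N') ((i.rTensor A) y) = 0 := by
    rw [← LinearMap.comp_apply, LinearMap.lTensor_comp_rTensor, ← LinearMap.rTensor_comp_lTensor,
      LinearMap.comp_apply, hx]
  rw [← map_zero (f.lTensor N')] at h3
  have h4 := hN' h3
  rw [← map_zero (i.rTensor A)] at h4
  rw [Module.Flat.rTensor_preserves_injective_linearMap i hi h4, map_zero]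

/-- The kernel of a surjection between flat modules is flat. -/
theorem flat_of_exact_of_flat {f : A →ₗ[R] B} {g : B →ₗ[R] C} (h : Function.Exact f g)
    (hf : Function.Injective f) (hg : Function.Surjective g) (hB : Module.Flat R B)
    (hC : Module.Flat R C) : Module.Flat R A := by
  rw [Module.Flat.iff_rTensor_preserves_injective_linearMap]
  intro N N' _ _ _ _ i hi
  have hN : Function.Injective (f.lTensor N) :=
    LinearMap.lTensor_injective_of_exact_of_flat g hg f hf h N
  have h1 : Function.Injective (i.rTensor B ∘ₗ f.lTensor N) :=
    (Module.Flat.rTensor_preserves_injective_linearMap i hi).comp hN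
  rw [LinearMap.rTensor_comp_lTensor, ← LinearMap.lTensor_comp_rTensor, LinearMap.coe_comp] at h1
  exact h1.of_comp

end Flat

/-! ### Shifts and mapping cones -/

section Shift

variable {R : Type u} [CommRing R]

theorem exactAt_homCx_shift {P Y : Cx R} {i j : ℤ} (hij : i + 1 = j)
    (h : (homCx P Y).ExactAt j) : (homCx P (Y⟦(1 : ℤ)⟧)).ExactAt i := by
  rw [exactAt_iff _ i j (j + 1) hij rfl] at h
  rw [exactAt_iff _ (i - 1) i j (by lia) hij]
  intro (z : Cochain P (Y⟦(1 : ℤ)⟧) i) hz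
  have hz : δ i j z = 0 := hz
  obtain ⟨(y : Cochain P Y i), hy⟩ := h (z.rightUnshift j hij) (by
    change δ j (j + 1) (z.rightUnshift j hij) = 0
    rw [Cochain.δ_rightUnshift z j hij (j + 1) j rfl, hz]
    simp)
  have hy : δ i j y = z.rightUnshift j hij := hy
  -- The sign compensates for the right shift by one anticommuting with the differential.
  refine ⟨(y.rightShift 1 (i - 1) (by lia) : Cochain P (Y⟦(1 : ℤ)⟧) (i - 1)) |> fun t => -t, ?_⟩
  change δ (i - 1) i (-(y.rightShift 1 (i - 1) (by lia))) = z
  rw [δ_neg, Cochain.δ_rightShift y 1 (i - 1) i (by lia) j hij, hy,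
    Cochain.rightShift_rightUnshift]
  simp

/-- The extension of `K⟦1⟧` by `L` given by a mapping cone is exact. -/
theorem shortExact_mappingCone {K L : Cx R} (u : K ⟶ L) :
    (mappingCone.triangleRotateShortComplex u).ShortExact :=
  shortExact_of_degreewise_shortExact _ fun n =>
    (mappingCone.triangleRotateShortComplexSplitting u n).shortExact

theorem exactAt_homCx_mappingCone {P K L : Cx R} (hP : ∀ i, Projective (P.X i)) (u : K ⟶ L)
    {i j : ℤ} (hij : i + 1 = j) (hL : (homCx P L).ExactAt i) (hK : (homCx P K).ExactAt j) :
    (homCx P (mappingCone u)).ExactAt i :=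
  (shortExact_homCx P hP (shortExact_mappingCone u)).exactAt_X₂ i hL (exactAt_homCx_shift hij hK)

theorem flat_mappingCone {K L : Cx R} (u : K ⟶ L) (hK : ∀ i, Module.Flat R (K.X i))
    (hL : ∀ i, Module.Flat R (L.X i)) (i : ℤ) : Module.Flat R ((mappingCone u).X i) := by
  have h := (mappingCone.triangleRotateShortComplexSplitting u i).shortExact
  refine flat_of_exact ((ShortComplex.ShortExact.moduleCat_exact_iff_function_exact _).1 h.exact) ?_ ?_
    (hL i) (hK (i + 1))
  · exact (ModuleCat.mono_iff_injective _).1 h.mono_f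
  · exact (ModuleCat.epi_iff_surjective _).1 h.epi_g

/-- The last term of a short exact sequence is quasi-isomorphic to the cone of the first map, and
this cone only depends on the first term up to quasi-isomorphism. It allows a non-flat first term to
be replaced by a flat one. -/
theorem quasiIso_mappingCone_desc {S : ShortComplex (Cx R)} (hS : S.ShortExact) {K : Cx R}
    (w : K ⟶ S.X₁) [QuasiIso w] :
    ∃ f : mappingCone (w ≫ S.f) ⟶ S.X₃, QuasiIso f := by
  have h1 := mappingCone.quasiIso_descShortComplex hS
  let m : mappingCone (w ≫ S.f) ⟶ mappingCone S.f :=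
    mappingCone.map (w ≫ S.f) S.f w (𝟙 _) (by simp)
  have h2 : QuasiIso m := by
    rw [quasiIso_iff_isIso_Q]
    let τ := DerivedCategory.Q.mapTriangle.map
      (mappingCone.triangleMap (w ≫ S.f) S.f w (𝟙 _) (by simp))
    have i1 : IsIso τ.hom₁ := inferInstanceAs (IsIso (DerivedCategory.Q.map w))
    have i2 : IsIso τ.hom₂ := inferInstanceAs (IsIso (DerivedCategory.Q.map (𝟙 S.X₂)))
    exact Pretriangulated.isIso₃_of_isIso₁₂ τ
      (DerivedCategory.mappingCone_triangle_distinguished (w ≫ S.f))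
      (DerivedCategory.mappingCone_triangle_distinguished S.f) i1 i2
  exact ⟨m ≫ mappingCone.descShortComplex S, quasiIso_comp _ _⟩

end Shift

/-! ### Flat models of iterated tensor products -/

section Tower

variable {R : Type u} [CommRing R]

theorem leftComm_comp_lTensor (M N : Type u) [AddCommGroup M] [Module R M] [AddCommGroup N]
    [Module R N] {X Y : Type u} [AddCommGroup X] [Module R X] [AddCommGroup Y] [Module R Y]
    (f : X →ₗ[R] Y) : (f.lTensor M).lTensor N ∘ₗ (TensorProduct.leftComm R M N X).toLinearMap =
      (TensorProduct.leftComm R M N Y).toLinearMap ∘ₗ (f.lTensor N).lTensor M := by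
  ext m n x
  rfl

/-- `M ⊗ (N ⊗ W) ≅ N ⊗ (M ⊗ W)`. -/
def tensLeftComm (M N : Type u) [AddCommGroup M] [Module R M] [AddCommGroup N] [Module R N]
    (W : Cx R) : (tens M).obj ((tens N).obj W) ≅ (tens N).obj ((tens M).obj W) :=
  Hom.isoOfComponents (fun i => (TensorProduct.leftComm R M N (W.X i)).toModuleIso)
    (fun i j _ => ModuleCat.hom_ext (leftComm_comp_lTensor M N (W.d i j).hom))

/-- By tensor evaluation the complex is quasi-isomorphic to N ⊗ Hom(P, Y), and flat `N` preserves
exactness. -/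
theorem exactAt_homCx_tens_of_flat {P Y : Cx R} (hP : IsFiniteFree P) {a : ℤ} (ha : Y.IsGE a)
    (N : Type u) [AddCommGroup N] [Module R N] [Module.Flat R N] {i : ℤ}
    (h : (homCx P Y).ExactAt i) : (homCx P ((tens N).obj Y)).ExactAt i := by
  have := quasiIso_tensHom (M := N) hP ha
  rw [← exactAt_of_quasiIso (tensHom N P Y)]
  exact exactAt_tens h

/-- Vanishing of the positive cohomology of `Hom(P, M ⊗ Q)` for all `M` of finite flat dimension. -/
theorem exactAt_homCx_tens {P Q : Cx R} (hP : IsFiniteFree P) (hQ : ∀ i, Module.Flat R (Q.X i))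
    {a : ℤ} (ha : Q.IsGE a) (h : ∀ i, 1 ≤ i → (homCx P Q).ExactAt i) (n : ℕ)
    (M : ModuleCat.{u} R) (hM : FlatDimLE n M) (i : ℤ) (hi : 1 ≤ i) :
    (homCx P ((tens M).obj Q)).ExactAt i := by
  induction n generalizing M i with
  | zero =>
    have : Module.Flat R M := hM
    exact exactAt_homCx_tens_of_flat hP ha M (h i hi)
  | succ n ih =>
    obtain ⟨G, f, hG, hf, hK⟩ := hM
    have hex : Function.Exact (LinearMap.ker f).subtype f := f.exact_subtype_ker_map
    have s := shortExact_homCx P hP.projective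
      (shortExact_tensShortComplex (LinearMap.ker f).injective_subtype hex hf Q hQ)
    exact exactAt_X₃_of_exactAt s i (i + 1) rfl
      (exactAt_homCx_tens_of_flat hP ha G (h i hi)) (ih _ hK (i + 1) (by lia))

/-- A flat complex `W` with bounded below cohomology such that `Hom(P, M ⊗ W)` has no cohomology
in positive degrees. -/
structure IsAcyclicFor (P : Cx R) (M : ModuleCat.{u} R) (W : Cx R) : Prop where
  flat : ∀ i, Module.Flat R (W.X i)
  bound : ∃ a, W.IsGE a
  exactAt : ∀ i, 1 ≤ i → (homCx P ((tens M).obj W)).ExactAt i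

/-- M ⊗ (N ⊗ W) is N ⊗ (M ⊗ W), where M ⊗ W is cohomologically bounded below since M has finite flat
dimension. Hence flat coefficients can be pulled out. -/
theorem IsAcyclicFor.tens_of_flat {P W : Cx R} (hP : IsFiniteFree P) {M : ModuleCat.{u} R} {m : ℕ}
    (hM : FlatDimLE m M) (hW : IsAcyclicFor P M W) (N : Type u) [AddCommGroup N] [Module R N]
    [Module.Flat R N] : IsAcyclicFor P M ((tens N).obj W) := by
  obtain ⟨a, ha⟩ := hW.bound
  refine ⟨fun i => ?_, ⟨a, ?_⟩, fun i hi => ?_⟩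
  · have := hW.flat i
    exact inferInstanceAs (Module.Flat R (N ⊗[R] W.X i))
  · rw [isGE_iff]
    exact fun i hi => exactAt_tens (W.exactAt_of_isGE a i hi)
  · have := quasiIso_homCxPostcomp hP.isKProjective (tensLeftComm M N W).hom
    rw [exactAt_of_quasiIso (homCxPostcomp P (tensLeftComm M N W).hom)]
    exact exactAt_homCx_tens_of_flat hP (isGE_tens hW.flat ha m M hM) N (hW.exactAt i hi)

/-- The model is the cone of V → X₂. Its vanishing in degree i needs X₂ in degree i and V in degree
i + 1, and the range i ≥ 1 is closed under this shift. -/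
theorem IsAcyclicFor.exists_of_shortExact {P : Cx R} (hP : IsFiniteFree P) {M : ModuleCat.{u} R}
    {S : ShortComplex (Cx R)} (hS : S.ShortExact) (h₂ : IsAcyclicFor P M S.X₂) {V : Cx R}
    (hV : IsAcyclicFor P M V) (v : V ⟶ S.X₁) (hv : QuasiIso v) {a : ℤ} (ha : S.X₃.IsGE a) :
    ∃ (W : Cx R) (w : W ⟶ S.X₃), IsAcyclicFor P M W ∧ QuasiIso w := by
  obtain ⟨w, hw⟩ := quasiIso_mappingCone_desc hS v
  refine ⟨_, w, ⟨flat_mappingCone _ hV.flat h₂.flat, ⟨a, ?_⟩, fun i hi => ?_⟩, hw⟩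
  · rw [isGE_iff]
    intro i hi
    rw [exactAt_of_quasiIso w]
    exact exactAt_of_isGE _ a i hi
  · let e := mappingCone.mapHomologicalComplexIso (v ≫ S.f) (tensModule R M)
    have := quasiIso_homCxPostcomp hP.isKProjective e.hom
    rw [exactAt_of_quasiIso (homCxPostcomp P e.hom)]
    exact exactAt_homCx_mappingCone hP.projective _ rfl (h₂.exactAt i hi)
      (hV.exactAt (i + 1) (by lia))

/-- N ⊗ W need not have flat terms, so it is replaced by iterated cones along a flat resolution of
`N`; this keeps the hypotheses available for tensoring again. -/
theorem IsAcyclicFor.exists_tens {P W : Cx R} (hP : IsFiniteFree P) {M : ModuleCat.{u} R} {m : ℕ}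
    (hM : FlatDimLE m M) (hW : IsAcyclicFor P M W) (n : ℕ) (N : ModuleCat.{u} R)
    (hN : FlatDimLE n N) : ∃ (W' : Cx R) (w : W' ⟶ (tens N).obj W),
      IsAcyclicFor P M W' ∧ QuasiIso w := by
  induction n generalizing N with
  | zero =>
    have : Module.Flat R N := hN
    exact ⟨_, 𝟙 _, hW.tens_of_flat hP hM N, inferInstance⟩
  | succ n ih =>
    obtain ⟨a, ha⟩ := hW.bound
    have hGE := isGE_tens hW.flat ha _ _ hN
    obtain ⟨G, f, hG, hf, hK⟩ := hN
    obtain ⟨V, v, hV, hv⟩ := ih _ hK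
    have hex : Function.Exact (LinearMap.ker f).subtype f := f.exact_subtype_ker_map
    have s := shortExact_tensShortComplex (LinearMap.ker f).injective_subtype hex hf W hW.flat
    exact IsAcyclicFor.exists_of_shortExact hP s (hW.tens_of_flat hP hM G) hV v hv hGE

end Tower

end

end SemiDual

namespace SemiDual

noncomputable section

open scoped TensorProduct
open HomologicalComplex Limits CochainComplex

/-! ### Flat dimension and Schanuel's lemma -/

section FlatDim

variable {R : Type u} [CommRing R]

theorem FlatDimLE.of_linearEquiv {n : ℕ} {M M' : ModuleCat.{u} R} (e : M ≃ₗ[R] M')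
    (h : FlatDimLE n M) : FlatDimLE n M' := by
  cases n with
  | zero =>
    have : Module.Flat R M := h
    exact Module.Flat.of_linearEquiv e.symm
  | succ n =>
    obtain ⟨F, f, hF, hf, hK⟩ := h
    refine ⟨F, e.toLinearMap ∘ₗ f, hF, e.surjective.comp hf, ?_⟩
    rwa [LinearEquiv.ker_comp]

theorem FlatDimLE.prod {n : ℕ} {M : ModuleCat.{u} R} (h : FlatDimLE n M) (G : Type u)
    [AddCommGroup G] [Module R G] [Module.Flat R G] : FlatDimLE n (ModuleCat.of R (M × G)) := by
  cases n with
  | zero =>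
    exact flat_of_exact (f := LinearMap.inl R M G) (g := LinearMap.snd R M G) .inl_snd
      LinearMap.inl_injective LinearMap.snd_surjective h inferInstance
  | succ n =>
    obtain ⟨F, f, hF, hf, hK⟩ := h
    refine ⟨ModuleCat.of R (F × G), f.prodMap LinearMap.id,
      flat_of_exact (f := LinearMap.inl R F G) (g := LinearMap.snd R F G) .inl_snd
        LinearMap.inl_injective LinearMap.snd_surjective hF inferInstance,
      hf.prodMap Function.surjective_id, ?_⟩
    refine hK.of_linearEquiv (M' := ModuleCat.of R _) ?_
    exact
      { toFun := fun x => ⟨(x.1, 0), by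
          rw [LinearMap.mem_ker]
          exact Prod.ext x.2 rfl⟩
        invFun := fun x => ⟨x.1.1, congrArg Prod.fst x.2⟩
        left_inv := fun _ => rfl
        right_inv := fun x => Subtype.ext (Prod.ext rfl (congrArg Prod.snd x.2).symm)
        map_add' := fun x y => Subtype.ext (Prod.ext rfl (add_zero 0).symm)
        map_smul' := fun r x => Subtype.ext (Prod.ext rfl (smul_zero r).symm) }

/-- The kernel of a surjection to a flat module. -/
theorem FlatDimLE.ker_of_flat {n : ℕ} {M : ModuleCat.{u} R} (h : FlatDimLE n M) {G : Type u}
    [AddCommGroup G] [Module R G] [hG : Module.Flat R G] (g : M →ₗ[R] G)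
    (hg : Function.Surjective g) : FlatDimLE n (ModuleCat.of R (LinearMap.ker g)) := by
  cases n with
  | zero =>
    exact flat_of_exact_of_flat (LinearMap.exact_subtype_ker_map g)
      (LinearMap.ker g).injective_subtype hg h hG
  | succ n =>
    obtain ⟨F, f, hF, hf, hK⟩ := h
    have hgf : ∀ x ∈ LinearMap.ker (g ∘ₗ f), f x ∈ LinearMap.ker g := fun x hx => hx
    -- The kernel of g ∘ f is flat and covers ker g, and the kernel of this cover is again ker f.
    refine ⟨ModuleCat.of R (LinearMap.ker (g ∘ₗ f)), f.restrict hgf,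
      flat_of_exact_of_flat (LinearMap.exact_subtype_ker_map _)
        (LinearMap.ker _).injective_subtype (hg.comp hf) hF hG, ?_, ?_⟩
    · rintro ⟨x, hx⟩
      obtain ⟨y, rfl⟩ := hf x
      exact ⟨⟨y, hx⟩, rfl⟩
    · refine hK.of_linearEquiv (M' := ModuleCat.of R _) ?_
      exact
        { toFun := fun x => ⟨⟨x.1, by
            rw [LinearMap.mem_ker, LinearMap.comp_apply, LinearMap.mem_ker.1 x.2, map_zero]⟩,
            Subtype.ext x.2⟩
          invFun := fun x => ⟨x.1.1, congrArg Subtype.val x.2⟩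
          left_inv := fun _ => rfl
          right_inv := fun _ => rfl
          map_add' := fun _ _ => rfl
          map_smul' := fun _ _ => rfl }

/-- The kernel of a surjection from a projective module. -/
theorem FlatDimLE.ker_of_projective {n : ℕ} {M : ModuleCat.{u} R} (h : FlatDimLE n M) {G : Type u}
    [AddCommGroup G] [Module R G] [Module.Projective R G] (p : G →ₗ[R] M)
    (hp : Function.Surjective p) : FlatDimLE (n - 1) (ModuleCat.of R (LinearMap.ker p)) := by
  cases n with
  | zero =>
    exact flat_of_exact_of_flat (LinearMap.exact_subtype_ker_map p)
      (LinearMap.ker p).injective_subtype hp inferInstance h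
  | succ n =>
    obtain ⟨F, f, hF, hf, hK⟩ := h
    obtain ⟨s, hs⟩ := Module.projective_lifting_property f p hf
    have hs' : ∀ x, f (s x) = p x := LinearMap.congr_fun hs
    -- Schanuel's trick: the kernel of ker f × G → F is isomorphic to ker p, and it is also the
    -- kernel of a surjection onto the flat module `F`.
    let c : (LinearMap.ker f × G) →ₗ[R] F := (LinearMap.ker f).subtype.coprod s
    have hc : Function.Surjective c := fun x => by
      obtain ⟨g, hg⟩ := hp (f x)
      refine ⟨(⟨x - s g, ?_⟩, g), ?_⟩
      · rw [LinearMap.mem_ker, map_sub, hs', hg, sub_self]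
      · exact sub_add_cancel x (s g)
    have h1 := (hK.prod G).ker_of_flat c hc
    refine h1.of_linearEquiv (M' := ModuleCat.of R _) ?_
    have hker : ∀ x : LinearMap.ker c, (x.1.1 : F) = - s x.1.2 := fun x =>
      eq_neg_of_add_eq_zero_left x.2
    exact
      { toFun := fun x => ⟨x.1.2, by
          have h1 : f x.1.1 = 0 := x.1.1.2
          rw [hker, map_neg, neg_eq_zero, hs'] at h1
          exact h1⟩
        invFun := fun x => ⟨(⟨- s x.1, by
          rw [LinearMap.mem_ker, map_neg, hs', LinearMap.mem_ker.1 x.2, neg_zero]⟩, x.1), by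
            rw [LinearMap.mem_ker]
            exact neg_add_cancel (s x.1)⟩
        left_inv := fun x => Subtype.ext (Prod.ext (Subtype.ext (hker x).symm) rfl)
        right_inv := fun _ => rfl
        map_add' := fun _ _ => rfl
        map_smul' := fun _ _ => rfl }

end FlatDim

/-! ### Vanishing of positive cohomology by Krull's intersection theorem -/

section Krull

variable {R : Type u} [CommRing R]

/-- The morphism is surjective on cohomology in degree `i`. -/
def HomologySurjAt {X Y : Cx R} (f : X ⟶ Y) (i : ℤ) : Prop :=
  ∀ y : Y.X i, (Y.d i (i + 1)).hom y = 0 → ∃ x : X.X i, (X.d i (i + 1)).hom x = 0 ∧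
    ∃ w : Y.X (i - 1), (f.f i).hom x = y + (Y.d (i - 1) i).hom w

theorem HomologySurjAt.comp {X Y Z : Cx R} {f : X ⟶ Y} {g : Y ⟶ Z} {i : ℤ}
    (hf : HomologySurjAt f i) (hg : HomologySurjAt g i) : HomologySurjAt (f ≫ g) i := by
  intro z hz
  obtain ⟨y, hy, w, hw⟩ := hg z hz
  obtain ⟨x, hx, w', hw'⟩ := hf y hy
  refine ⟨x, hx, w + (g.f (i - 1)).hom w', ?_⟩
  rw [comp_f, ModuleCat.hom_comp, LinearMap.comp_apply, hw', map_add, hw, map_add, f_d_apply,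
    add_assoc]

theorem homologySurjAt_of_quasiIso {X Y : Cx R} (f : X ⟶ Y) [QuasiIso f] (i : ℤ) :
    HomologySurjAt f i :=
  ((quasiIso_iff_forall f).1 inferInstance _ _ _ (by lia) rfl).2

theorem homologySurjAt_of_exactAt {S : ShortComplex (Cx R)} (hS : S.ShortExact) {i : ℤ}
    (h : S.X₃.ExactAt i) : HomologySurjAt S.f i :=
  exists_cocycle_of_exactAt_X₃ hS (by lia) rfl h

/-- `R ⊗ W ≅ W`. -/
def tensLid (W : Cx R) : (tens R).obj W ≅ W :=
  Hom.isoOfComponents (fun i => (TensorProduct.lid R (W.X i)).toModuleIso) (fun i j _ => by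
    ext : 1
    exact TensorProduct.ext' fun r x => ((W.d i j).hom.map_smul r x))

/-- The action `N ⊗ W → W` of an ideal. -/
def tensAct (N : Ideal R) (W : Cx R) : (tens N).obj W ⟶ W :=
  tensMap N.subtype W ≫ (tensLid W).hom

theorem tensAct_mem {N : Ideal R} {W Q : Cx R} (w : W ⟶ Q) {J : Ideal R}
    (hw : ∀ i x, (w.f i).hom x ∈ (J • ⊤ : Submodule R (Q.X i))) (i : ℤ)
    (t : ((tens N).obj W).X i) :
    ((tensAct N W ≫ w).f i).hom t ∈ ((N * J) • ⊤ : Submodule R (Q.X i)) := by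
  refine TensorProduct.induction_on (R := R) (M := N) (N := W.X i) t ?_ ?_ ?_
  · exact (map_zero ((tensAct N W ≫ w).f i).hom).symm ▸ zero_mem _
  · intro r x
    have : ((tensAct N W ≫ w).f i).hom (r ⊗ₜ x : N ⊗[R] W.X i) = (r : R) • (w.f i).hom x :=
      (w.f i).hom.map_smul (r : R) x
    rw [this, Submodule.mul_smul]
    exact Submodule.smul_mem_smul r.2 (hw i x)
  · intro s t hs ht
    exact (map_add ((tensAct N W ≫ w).f i).hom s t).symm ▸ add_mem hs ht

/-- Let N = ker f. Since Hom(P, M ⊗ W) is exact in positive degrees, the sequence N → R → M shows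
that Hom(P, N ⊗ W) → Hom(P, W) is surjective on positive cohomology. Iterating with a flat model of
N ⊗ W in place of W keeps this surjectivity, and each step puts the image in `Q` into one more power
of N. -/
theorem exists_tower {P Q : Cx R} (hP : IsFiniteFree P) {M : ModuleCat.{u} R} {m n : ℕ}
    (hM : FlatDimLE m M) (f : R →ₗ[R] M) (hf : Function.Surjective f)
    (hN : FlatDimLE n (ModuleCat.of R (LinearMap.ker f))) (hQ : IsAcyclicFor P M Q) (k : ℕ) :
    ∃ (W : Cx R) (w : W ⟶ Q), IsAcyclicFor P M W ∧
      (∀ i, 1 ≤ i → HomologySurjAt (homCxPostcomp P w) i) ∧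
      ∀ i x, (w.f i).hom x ∈ ((LinearMap.ker f : Ideal R) ^ k • ⊤ : Submodule R (Q.X i)) := by
  induction k with
  | zero =>
    refine ⟨Q, 𝟙 Q, hQ, fun i _ => ?_, fun i x => ?_⟩
    · have := quasiIso_homCxPostcomp hP.isKProjective (𝟙 Q)
      exact homologySurjAt_of_quasiIso _ i
    · rw [pow_zero, Ideal.one_eq_top, Submodule.top_smul]
      exact Submodule.mem_top
  | succ k ih =>
    obtain ⟨W, w, hW, hw, hwk⟩ := ih
    obtain ⟨W', w', hW', hw'⟩ := hW.exists_tens hP hM n _ hN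
    have hex : Function.Exact (LinearMap.ker f).subtype f := f.exact_subtype_ker_map
    have s := shortExact_homCx P hP.projective
      (shortExact_tensShortComplex (LinearMap.ker f).injective_subtype hex hf W hW.flat)
    refine ⟨W', w' ≫ tensAct (LinearMap.ker f) W ≫ w, hW', fun i hi => ?_, fun i x => ?_⟩
    · rw [homCxPostcomp_comp, homCxPostcomp_comp, tensAct, homCxPostcomp_comp]
      have h1 := quasiIso_homCxPostcomp hP.isKProjective w'
      have h2 := quasiIso_homCxPostcomp hP.isKProjective (tensLid W).hom
      refine (homologySurjAt_of_quasiIso _ i).comp (HomologySurjAt.comp (HomologySurjAt.comp ?_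
        (homologySurjAt_of_quasiIso _ i)) (hw i hi))
      exact homologySurjAt_of_exactAt s (hW.exactAt i hi)
    · rw [pow_succ', comp_f, ModuleCat.hom_comp, LinearMap.comp_apply]
      exact tensAct_mem w hwk i _

/-- In a finite basis, g is the sum of the coordinate functionals times the values g(b_j), so
membership of the values passes to g. Finiteness of the basis is essential. -/
theorem hom_mem_smul_top {F Y : Type u} [AddCommGroup F] [Module R F] [Module.Free R F]
    [Module.Finite R F] [AddCommGroup Y] [Module R Y] (J : Ideal R) (g : F →ₗ[R] Y)
    (hg : ∀ x, g x ∈ (J • ⊤ : Submodule R Y)) : g ∈ (J • ⊤ : Submodule R (F →ₗ[R] Y)) := by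
  let b := Module.Free.chooseBasis R F
  let t : ∀ j, Y →ₗ[R] (F →ₗ[R] Y) := fun j => LinearMap.smulRightₗ (b.coord j)
  have h1 : g = ∑ j, t j (g (b j)) := by
    refine LinearMap.ext fun x => ?_
    rw [LinearMap.sum_apply]
    conv_lhs => rw [← b.sum_repr x]
    rw [map_sum]
    refine Finset.sum_congr rfl fun j _ => ?_
    rw [map_smul]
    rfl
  rw [h1]
  exact sum_mem fun j _ => Submodule.smul_top_le_comap_smul_top J (t j) (hg (b j))

theorem cochain_mem_smul_top {P Y : Cx R} (hP : IsFiniteFree P) {a : ℤ} (ha : Y.IsStrictlyGE a)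
    (J : Ideal R) {n : ℤ} (z : Cochain P Y n)
    (hz : ∀ p q h x, (z.v p q h).hom x ∈ (J • ⊤ : Submodule R (Y.X q))) :
    z ∈ (J • ⊤ : Submodule R (Cochain P Y n)) := by
  classical
  obtain ⟨b, hb⟩ := hP.bound
  let e := cochainEquivPi P Y n a b hb ha
  have h1 : e z ∈ (J • ⊤ : Submodule R (∀ p : Finset.Icc (a - n) b, P.X p →ₗ[R] Y.X (p + n))) := by
    have h2 : e z = ∑ p, LinearMap.single R (fun p : Finset.Icc (a - n) b =>
        P.X p →ₗ[R] Y.X (p + n)) p (e z p) := (Finset.univ_sum_single (e z)).symm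
    rw [h2]
    refine sum_mem fun p _ => Submodule.smul_top_le_comap_smul_top J _ ?_
    have := hP.free p
    have := hP.finite p
    exact hom_mem_smul_top J _ (hz p (p + n) rfl)
  have h3 := Submodule.smul_top_le_comap_smul_top J e.symm.toLinearMap h1
  rw [Submodule.mem_comap] at h3
  have h4 : e.symm.toLinearMap (e z) = z := e.symm_apply_apply z
  rwa [h4] at h3

/-- If `Hom(P, M ⊗ Q)` has no cohomology in positive degrees, for a cyclic module `M` defined by an
ideal inside the Jacobson radical and of finite flat dimension, then neither has `Hom(P, Q)`. -/
theorem exactAt_homCx_of_tens [IsNoetherianRing R] {P Q : Cx R} (hP : IsFiniteFree P)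
    (hQ : IsFiniteFree Q) {a : ℤ} (ha : Q.IsGE a) {M : ModuleCat.{u} R} {m : ℕ}
    (hM : FlatDimLE m M) (f : R →ₗ[R] M) (hf : Function.Surjective f)
    (hI : (LinearMap.ker f : Ideal R) ≤ Ideal.jacobson ⊥)
    (h : ∀ i, 1 ≤ i → (homCx P ((tens M).obj Q)).ExactAt i) (i : ℤ) (hi : 1 ≤ i) :
    (homCx P Q).ExactAt i := by
  have hN := hM.ker_of_projective f hf
  -- Truncation makes the degree `i` part of the Hom complex a finite module, as Krull's theorem
  -- requires.
  let q := Q.πTruncGE a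
  have hq := quasiIso_homCxPostcomp hP.isKProjective q
  rw [exactAt_of_quasiIso (homCxPostcomp P q), exactAt_iff _ (i - 1) i (i + 1) (by lia) rfl]
  intro z hz
  let C := (homCx P (Q.truncGE a)).X i
  let B : Submodule R C := LinearMap.range ((homCx P (Q.truncGE a)).d (i - 1) i).hom
  have hC : Module.Finite R C :=
    finite_homCx_X hP (a := a) inferInstance (finite_truncGE a hQ.finite) i
  -- Modulo coboundaries `z` comes from the k-th level of the tower, hence lies in the k-th power of
  -- the ideal times the finite module C/B, for every k.
  have key : B.mkQ z ∈ (⨅ k : ℕ, (LinearMap.ker f : Ideal R) ^ k • ⊤ : Submodule R (C ⧸ B)) := by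
    rw [Submodule.mem_iInf]
    intro k
    obtain ⟨W, w, -, hw, hwk⟩ := exists_tower hP hM f hf hN ⟨hQ.flat, ⟨a, ha⟩, h⟩ k
    obtain ⟨(x : Cochain P W i), -, y, hy⟩ :=
      (hw i hi).comp (homologySurjAt_of_quasiIso (homCxPostcomp P q) i) z hz
    rw [← homCxPostcomp_comp] at hy
    have h1 : ((homCxPostcomp P (w ≫ q)).f i).hom x ∈
        ((LinearMap.ker f : Ideal R) ^ k • ⊤ : Submodule R C) := by
      refine cochain_mem_smul_top hP (a := a) inferInstance _
        (x.comp (Cochain.ofHom (w ≫ q)) (add_zero i)) fun p p' hp t => ?_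
      rw [comp_ofHom_v_apply]
      exact Submodule.smul_top_le_comap_smul_top _ (q.f p').hom (hwk p' _)
    have h2 : B.mkQ (((homCxPostcomp P (w ≫ q)).f i).hom x) = B.mkQ z := by
      rw [hy, map_add, add_eq_left, Submodule.mkQ_apply, Submodule.Quotient.mk_eq_zero]
      exact ⟨y, rfl⟩
    rw [← h2]
    exact Submodule.smul_top_le_comap_smul_top _ B.mkQ h1
  rw [Ideal.iInf_pow_smul_eq_bot_of_le_jacobson _ hI, Submodule.mem_bot, Submodule.mkQ_apply,
    Submodule.Quotient.mk_eq_zero] at key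
  exact key

end Krull

end

end SemiDual

namespace SemiDual

noncomputable section

open scoped TensorProduct
open HomologicalComplex Limits CochainComplex

/-! ### Descent along the retraction -/

section Retract

variable {A B : Type u} [CommRing A] [CommRing B]

/-- Extending scalars along a section and its retraction. -/
def extendScalarsRetractIso {φ : A →+* B} {ψ : B →+* A} (h : ψ.comp φ = RingHom.id A) :
    ModuleCat.extendScalars.{u, u, u} φ ⋙ ModuleCat.extendScalars.{u, u, u} ψ ≅
      𝟭 (ModuleCat.{u} A) :=
  (ModuleCat.extendScalarsComp φ ψ).symm ≪≫
    eqToIso (congrArg ModuleCat.extendScalars.{u, u, u} h) ≪≫ ModuleCat.extendScalarsId.{u, u} A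

/-- Extending scalars of complexes along a section and its retraction. -/
def extCxRetractIso {φ : A →+* B} {ψ : B →+* A} (h : ψ.comp φ = RingHom.id A) (Y : Cx A) :
    (extCx ψ).obj ((extCx φ).obj Y) ≅ Y :=
  Hom.isoOfComponents (fun i => (extendScalarsRetractIso h).app (Y.X i)) (fun i j _ =>
    ((extendScalarsRetractIso h).hom.naturality (Y.d i j)).symm)

theorem exactAt_asComplex (M : ModuleCat.{u} A) {i : ℤ} (hi : i ≠ 0) :
    (asComplex M).ExactAt i := by
  rw [exactAt_iff_isZero_homology]
  exact isZero_single_obj_homology _ _ _ _ hi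

theorem ker_extRingAux (ψ : B →+* A) :
    (LinearMap.ker (extRingAux ψ).hom : Ideal B) = RingHom.ker ψ := rfl

theorem extRingAux_surjective {ψ : B →+* A} (h : Function.Surjective ψ) :
    Function.Surjective (extRingAux ψ).hom := h

theorem tensLid_oneTmulCx (ψ : B →+* A) (Q : Cx B) :
    (tensLid Q).hom ≫ oneTmulCx ψ Q = tensMap (extRingAux ψ).hom Q ≫ (tensIso ψ Q).hom := by
  refine tens_hom_ext fun (b : B) => ?_
  ext i x
  refine Eq.trans ?_ (tensIns_tensIso ψ (ψ b) Q i x).symm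
  exact tmulOne_smul ψ b x

/-- Nakayama's lemma: a finite module with `A ⊗_B N = 0` vanishes. -/
theorem subsingleton_of_tmulOne_eq_zero {ψ : B →+* A} (hψ : Function.Surjective ψ)
    (hI : RingHom.ker ψ ≤ Ring.jacobson B) (N : ModuleCat.{u} B) [Module.Finite B N]
    (h : ∀ x : N, tmulOne ψ x = 0) : Subsingleton N := by
  have hex : Function.Exact (LinearMap.ker (extRingAux ψ).hom).subtype (extRingAux ψ).hom :=
    LinearMap.exact_subtype_ker_map _
  have h1 : (⊤ : Submodule B N) ≤ RingHom.ker ψ • ⊤ := by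
    intro x _
    -- As 1 ⊗ x dies in A ⊗ N, right exactness brings it from ker ψ ⊗ N, so x lies in ker ψ · N.
    have h2 : ((extRingAux ψ).hom.rTensor N) ((1 : B) ⊗ₜ[B] x) = 0 := by
      have h3 : (tensModuleHom ψ N).hom (((extRingAux ψ).hom.rTensor N) ((1 : B) ⊗ₜ[B] x)) = 0 := by
        refine Eq.trans ?_ (h x)
        refine congrArg (fun a : A => (a ⊗ₜ[B] x : ringAsModule ψ ⊗[B] N)) (map_one ψ)
      have h4 : Function.Injective (tensModuleHom ψ N).hom := Function.injective_id
      exact h4 (h3.trans (map_zero (tensModuleHom ψ N).hom).symm)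
    obtain ⟨t, ht⟩ := ((rTensor_exact N hex (extRingAux_surjective hψ)) _).1 h2
    have h5 : ∀ t : LinearMap.ker (extRingAux ψ).hom ⊗[B] N,
        TensorProduct.lid B N ((LinearMap.ker (extRingAux ψ).hom).subtype.rTensor N t) ∈
          (RingHom.ker ψ • ⊤ : Submodule B N) := by
      intro t
      induction t using TensorProduct.induction_on with
      | zero => simp
      | tmul r n => exact Submodule.smul_mem_smul r.2 Submodule.mem_top
      | add s t hs ht =>
        rw [map_add, map_add]
        exact add_mem hs ht
    have h6 := h5 t
    rw [ht, TensorProduct.lid_tmul, one_smul] at h6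
    exact h6
  have h7 := Submodule.eq_bot_of_le_smul_of_le_jacobson_bot (RingHom.ker ψ) ⊤
    (Module.Finite.fg_top) h1 (hI.trans (by rw [Ideal.jacobson_bot]))
  exact (Submodule.subsingleton_iff B).1 (subsingleton_of_bot_eq_top h7.symm)

/-- Nakayama applied to the cokernel gives surjectivity. Projectivity of `N` then splits f, so the
kernel is a finite direct summand of `M` and dies after base change; Nakayama applies again. -/
theorem isIso_of_extendScalars {ψ : B →+* A} (hψ : Function.Surjective ψ)
    (hI : RingHom.ker ψ ≤ Ring.jacobson B) {M N : ModuleCat.{u} B} [Module.Finite B M]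
    [Module.Finite B N] [Module.Projective B N] (f : M ⟶ N)
    [IsIso ((ModuleCat.extendScalars.{u, u, u} ψ).map f)] : IsIso f := by
  have hs : Function.Surjective f.hom := by
    let C := ModuleCat.of B (N ⧸ LinearMap.range f.hom)
    let p : N ⟶ C := ModuleCat.ofHom (LinearMap.range f.hom).mkQ
    have hp : (ModuleCat.extendScalars.{u, u, u} ψ).map p = 0 := by
      rw [← cancel_epi ((ModuleCat.extendScalars.{u, u, u} ψ).map f), ← Functor.map_comp,
        comp_zero]
      have : f ≫ p = 0 := by
        ext x
        exact (Submodule.Quotient.mk_eq_zero _).2 ⟨x, rfl⟩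
      rw [this, Functor.map_zero]
    have : Subsingleton C := subsingleton_of_tmulOne_eq_zero hψ hI C fun x => by
      obtain ⟨y, rfl⟩ := Submodule.mkQ_surjective _ x
      have h1 := extendScalars_map_tmulOne (φ := ψ) p y
      rw [hp] at h1
      exact h1.symm
    rw [← LinearMap.range_eq_top]
    exact Submodule.Quotient.subsingleton_iff.1 this
  obtain ⟨s, hs'⟩ := Module.projective_lifting_property f.hom LinearMap.id hs
  let K := ModuleCat.of B (LinearMap.ker f.hom)
  let r : M ⟶ K := ModuleCat.ofHom (Y := LinearMap.ker f.hom)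
    (LinearMap.codRestrict _ (LinearMap.id - s ∘ₗ f.hom) fun x => by
    have := LinearMap.congr_fun hs' (f.hom x)
    rw [LinearMap.mem_ker, LinearMap.sub_apply, map_sub, sub_eq_zero]
    exact this.symm)
  have hr : ∀ x : K, r.hom x.1 = x := fun x => Subtype.ext (by
    change x.1 - s (f.hom x.1) = x.1
    rw [LinearMap.mem_ker.1 x.2, map_zero, sub_zero])
  have : Module.Finite B K := Module.Finite.of_surjective r.hom fun x => ⟨x.1, hr x⟩
  have : Subsingleton K := subsingleton_of_tmulOne_eq_zero hψ hI K fun x => by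
    have h1 := extendScalars_map_tmulOne (φ := ψ) f x.1
    have h2 : f.hom x.1 = 0 := x.2
    rw [h2] at h1
    have h3 : tmulOne ψ (0 : N) = 0 := map_zero (oneTmul ψ N).hom
    have h4 : Function.Injective ((ModuleCat.extendScalars.{u, u, u} ψ).map f).hom :=
      ((ConcreteCategory.isIso_iff_bijective _).1 inferInstance).1
    have h5 := h4 ((h1.trans h3).trans (map_zero _).symm)
    have h6 := extendScalars_map_tmulOne (φ := ψ) r x.1
    rw [h5, map_zero, hr] at h6
    exact h6.symm
  rw [ConcreteCategory.isIso_iff_bijective]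
  refine ⟨?_, hs⟩
  refine LinearMap.ker_eq_bot.1 ?_
  exact (Submodule.subsingleton_iff_eq_bot).1 this

variable [IsNoetherianRing B]

/-- A semidualizing complex over `B` descends along a retraction. -/
theorem exists_iso_extCx_extCx {φ : A →+* B} {ψ : B →+* A} (hψ : FiniteFlatDim ψ)
    (h : ψ.comp φ = RingHom.id A) (hI : RingHom.ker ψ ≤ Ring.jacobson B) {P : Cx B}
    (hP : IsFiniteFree P) {a : ℤ} (ha : P.IsGE a) [QuasiIso (homothety ((extCx ψ).obj P))]
    (hφ : FiniteFlatDim φ) : Nonempty (P ≅ (extCx φ).obj ((extCx ψ).obj P)) := by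
  have hs : Function.Surjective ψ := fun x => ⟨φ x, RingHom.congr_fun h x⟩
  let P' := (extCx ψ).obj P
  let Q := (extCx φ).obj P'
  have hP' : IsFiniteFree P' := isFiniteFree_extCx ψ hP
  have hQ : IsFiniteFree Q := isFiniteFree_extCx φ hP'
  obtain ⟨a', ha'⟩ := isGE_extCx hψ hP.flat ha
  obtain ⟨c, hc⟩ := isGE_extCx hφ hP'.flat ha'
  obtain ⟨m, hm⟩ := hψ
  let θ : (extCx ψ).obj Q ≅ P' := extCxRetractIso h P'
  -- The map to be lifted: P → A ⊗ P = P', followed by P' ≅ A ⊗ Q.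
  let g : P ⟶ (tens (ringAsModule ψ)).obj Q :=
    oneTmulCx ψ P ≫ (resCx ψ).map θ.inv ≫ (tensIso ψ Q).inv
  -- By adjunction Hom_B(P, A ⊗ Q) is Hom_A(P', P'), and the homothety identifies its cohomology
  -- with `A` in degree 0.
  have h1 : ∀ i, 1 ≤ i → (homCx P ((tens (ringAsModule ψ)).obj Q)).ExactAt i := by
    intro i hi
    have q1 := quasiIso_homCxPostcomp hP.isKProjective ((tensIso ψ Q).hom ≫ (resCx ψ).map θ.hom)
    rw [exactAt_of_quasiIso (homCxPostcomp P ((tensIso ψ Q).hom ≫ (resCx ψ).map θ.hom)),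
      ← exactAt_of_quasiIso (homCxRes ψ P P'), exactAt_resCx_iff,
      ← exactAt_of_quasiIso (homothety P')]
    exact exactAt_asComplex _ (by lia)
  have hI' : (LinearMap.ker (extRingAux ψ).hom : Ideal B) ≤ Ideal.jacobson ⊥ :=
    (ker_extRingAux ψ).le.trans (hI.trans (by rw [Ideal.jacobson_bot]))
  have h2 := exactAt_homCx_of_tens hP hQ hc hm (extRingAux ψ).hom (extRingAux_surjective hs) hI' h1
  have h3 := exactAt_homCx_tens hP hQ.flat hc h2 _ _
    (hm.ker_of_projective (extRingAux ψ).hom (extRingAux_surjective hs)) 1 le_rfl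
  have hex : Function.Exact (LinearMap.ker (extRingAux ψ).hom).subtype (extRingAux ψ).hom :=
    LinearMap.exact_subtype_ker_map _
  have s := shortExact_homCx P hP.projective
    (shortExact_tensShortComplex (LinearMap.ker (extRingAux ψ).hom).injective_subtype hex
      (extRingAux_surjective hs) Q hQ.flat)
  -- The obstruction to lifting the degree 0 cocycle g along B ⊗ Q → A ⊗ Q lies in H¹ of Hom(P, ker
  -- ψ ⊗ Q), which is zero by `h3`.
  obtain ⟨(y : Cochain P ((tens B).obj Q) 0), hy, hy'⟩ := exists_cocycle_of_exactAt_X₁ s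
    (i := 0) (j := 1) (k := 2) rfl rfl h3 (Cochain.ofHom g) (δ_ofHom g)
  let f' : P ⟶ (tens B).obj Q := Cocycle.homOf (Cocycle.mk y 1 rfl hy)
  have hf' : f' ≫ tensMap (extRingAux ψ).hom Q = g := by
    refine Cochain.ofHom_injective ?_
    rw [Cochain.ofHom_comp, Cocycle.cochain_ofHom_homOf_eq_coe]
    exact hy'
  let f : P ⟶ Q := f' ≫ (tensLid Q).hom
  have hf : oneTmulCx ψ P ≫ (resCx ψ).map ((extCx ψ).map f) =
      oneTmulCx ψ P ≫ (resCx ψ).map θ.inv := by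
    rw [← oneTmulCx_naturality, Category.assoc, tensLid_oneTmulCx, ← Category.assoc, hf',
      Category.assoc, Category.assoc, Iso.inv_hom_id, Category.comp_id]
  -- The lift reduces to θ⁻¹ on the nose, not just up to homotopy, so Nakayama can be applied term
  -- by term.
  have hf2 : (extCx ψ).map f = θ.inv := extCx_hom_ext fun i x =>
    congrArg (fun k : P ⟶ (resCx ψ).obj ((extCx ψ).obj Q) => (k.f i).hom x) hf
  have hiso : ∀ i, IsIso (f.f i) := by
    intro i
    have := hP.finite i
    have := hQ.finite i
    have := hQ.free i
    have : IsIso ((ModuleCat.extendScalars.{u, u, u} ψ).map (f.f i)) := by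
      have : IsIso ((extCx ψ).map f) := by
        rw [hf2]
        infer_instance
      exact inferInstanceAs (IsIso (((extCx ψ).map f).f i))
    exact isIso_of_extendScalars hs hI (f.f i)
  have : IsIso f := HomologicalComplex.Hom.isIso_of_components f
  exact ⟨asIso f⟩

end Retract

end

end SemiDual

namespace SemiDual

noncomputable section

open HomologicalComplex Limits CochainComplex

/-- A map with an inverse, both order preserving, is a perfectly order-respecting bijection. -/
theorem isPerfectBijection_of_inverse {α β : Type*} {r : α → α → Prop} {s : β → β → Prop}
    {f : α → β} {g : β → α} (hgf : ∀ a, g (f a) = a) (hfg : ∀ b, f (g b) = b)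
    (hf : ∀ a b, r a b → s (f a) (f b)) (hg : ∀ a b, s a b → r (g a) (g b)) :
    IsPerfectBijection r s f := by
  refine ⟨⟨Function.LeftInverse.injective hgf, Function.RightInverse.surjective hfg⟩,
    fun a b => ⟨hf a b, fun h => ?_⟩⟩
  have := hg _ _ h
  rwa [hgf, hgf] at this

/-! ### The induced bijections on semidualizing complexes -/

section Complexes

variable {A B : Type u} [CommRing A] [CommRing B]

theorem S.mk_eq_mk {K L : Cx A} {hK : IsSemidualizing K} {hL : IsSemidualizing L}
    (h : ShiftIso K L) : S.mk K hK = S.mk L hL := Quotient.sound h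

theorem DerivedIso.shiftIso {K L : Cx A} (h : DerivedIso K L) : ShiftIso K L :=
  ⟨0, h.trans (DerivedIso.of_iso ((shiftFunctorZero (Cx A) ℤ).app L).symm)⟩

theorem IsInducedMap.mk_eq {φ : A →+* B} {f : S A → S B} (hf : IsInducedMap φ f) {P : Cx A}
    (hP : P.IsKProjective) (h : IsSemidualizing P) :
    ∃ h' : IsSemidualizing ((extCx φ).obj P), f (S.mk P h) = S.mk _ h' :=
  (hf P h).2 _ ((isDerivedBaseChange_iff φ (DerivedIso.refl P) hP _).2 (DerivedIso.refl _))

variable [IsNoetherianRing A] [IsNoetherianRing B]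

/-- A semidualizing complex has a resolution by finite free modules which is semidualizing. -/
theorem IsSemidualizing.exists_resolution {K : Cx A} (hK : IsSemidualizing K) :
    ∃ P : Cx A, IsFiniteFree P ∧ DerivedIso P K ∧ (∃ a : ℤ, P.IsGE a) ∧ IsSemidualizing P := by
  obtain ⟨P, hP, hPK, ha⟩ := hK.1.exists_resolution
  exact ⟨P, hP, hPK, ha, hPK.symm.isSemidualizing hK⟩

/-- A homomorphism of finite flat dimension induces a map on shift-isomorphism classes of
semidualizing complexes. -/
theorem exists_isInducedMap {φ : A →+* B} (hφ : FiniteFlatDim φ) :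
    ∃ f : S A → S B, IsInducedMap φ f := by
  choose P hP hPK _ hPs using fun K : {K : Cx A // IsSemidualizing K} => K.2.exists_resolution
  refine ⟨Quotient.lift (fun K => S.mk _ (isSemidualizing_extCx hφ (hP K) (hPs K)))
    fun K L (h : ShiftIso K.1 L.1) => S.mk_eq_mk (shiftIso_extCx φ
      (((hPK K).shiftIso.trans h).trans (hPK L).symm.shiftIso)
      (hP K).isKProjective (hP L).isKProjective), fun K hK => ⟨?_, fun L hL => ?_⟩⟩
  · exact ⟨_, (isDerivedBaseChange_iff φ (hPK ⟨K, hK⟩) (hP _).isKProjective _).2 (DerivedIso.refl _)⟩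
  · rw [isDerivedBaseChange_iff φ (hPK ⟨K, hK⟩) (hP _).isKProjective] at hL
    exact ⟨hL.symm.isSemidualizing (isSemidualizing_extCx hφ (hP ⟨K, hK⟩) (hPs _)),
      S.mk_eq_mk hL.symm.shiftIso⟩

theorem IsInducedMap.le {φ : A →+* B} (hφ : FiniteFlatDim φ) {f : S A → S B}
    (hf : IsInducedMap φ f) {a b : S A} (h : S.le a b) : S.le (f a) (f b) := by
  obtain ⟨K, L, hK, hL, rfl, rfl, h⟩ := h
  obtain ⟨⟨K', hK'⟩, hfK⟩ := hf K hK
  obtain ⟨⟨L', hL'⟩, hfL⟩ := hf L hL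
  obtain ⟨hK's, eK⟩ := hfK K' hK'
  obtain ⟨hL's, eL⟩ := hfL L' hL'
  exact ⟨K', L', hK's, hL's, eK, eL, h.baseChange hφ hK.1 hK' hL'⟩

theorem S.exists_rep (a : S A) : ∃ (P : Cx A) (h : IsSemidualizing P), IsFiniteFree P ∧
    (∃ c : ℤ, P.IsGE c) ∧ a = S.mk P h := by
  induction a using Quotient.inductionOn with | h K =>
  obtain ⟨P, hP, hPK, hc, hPs⟩ := K.2.exists_resolution
  exact ⟨P, hPs, hP, hc, S.mk_eq_mk hPK.symm.shiftIso⟩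

theorem IsInducedMap.retract {A B : Type u} [CommRing A] [CommRing B] [IsNoetherianRing A]
    {φ : A →+* B} {ψ : B →+* A} (h : ψ.comp φ = RingHom.id A)
    {f : S A → S B} {g : S B → S A} (hf : IsInducedMap φ f) (hg : IsInducedMap ψ g) (a : S A) :
    g (f a) = a := by
  obtain ⟨P, hPs, hP, -, rfl⟩ := a.exists_rep
  obtain ⟨h1, e1⟩ := hf.mk_eq hP.isKProjective hPs
  obtain ⟨h2, e2⟩ := hg.mk_eq (isFiniteFree_extCx φ hP).isKProjective h1
  rw [e1, e2]
  exact S.mk_eq_mk (DerivedIso.of_iso (extCxRetractIso h P)).shiftIso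

theorem IsInducedMap.section {A B : Type u} [CommRing A] [CommRing B] [IsNoetherianRing B]
    {φ : A →+* B} {ψ : B →+* A} (h : IsRetractPair φ ψ)
    {f : S A → S B} {g : S B → S A} (hf : IsInducedMap φ f) (hg : IsInducedMap ψ g) (b : S B) :
    f (g b) = b := by
  obtain ⟨P, hPs, hP, ⟨a, ha⟩, rfl⟩ := b.exists_rep
  obtain ⟨h1, e1⟩ := hg.mk_eq hP.isKProjective hPs
  have hP' := isFiniteFree_extCx ψ hP
  obtain ⟨h2, e2⟩ := hf.mk_eq hP'.isKProjective h1
  rw [e1, e2]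
  have := ((isSemidualizing_iff (DerivedIso.refl _) hP'.isKProjective).1 h1).2
  obtain ⟨e⟩ := exists_iso_extCx_extCx h.finiteFlatDim_right h.comp_eq_id h.ker_le_jacobson hP ha
    h.finiteFlatDim_left
  exact S.mk_eq_mk (DerivedIso.of_iso e.symm).shiftIso

/-- A retract pair induces mutually inverse order isomorphisms on semidualizing complexes. -/
theorem IsRetractPair.exists_isPerfectBijection {φ : A →+* B} {ψ : B →+* A}
    (h : IsRetractPair φ ψ) :
    (∃ f : S A → S B, IsInducedMap φ f ∧ IsPerfectBijection S.le S.le f) ∧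
      ∃ g : S B → S A, IsInducedMap ψ g ∧ IsPerfectBijection S.le S.le g := by
  obtain ⟨f, hf⟩ := exists_isInducedMap h.finiteFlatDim_left
  obtain ⟨g, hg⟩ := exists_isInducedMap h.finiteFlatDim_right
  have h1 := hf.retract h.comp_eq_id hg
  have h2 := hf.section h hg
  have h3 := fun a b : S A => hf.le h.finiteFlatDim_left (a := a) (b := b)
  have h4 := fun a b : S B => hg.le h.finiteFlatDim_right (a := a) (b := b)
  exact ⟨⟨f, hf, isPerfectBijection_of_inverse h1 h2 h3 h4⟩,
    ⟨g, hg, isPerfectBijection_of_inverse h2 h1 h4 h3⟩⟩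

end Complexes

end

end SemiDual

namespace SemiDual

noncomputable section

open HomologicalComplex Limits CochainComplex

/-! ### Resolutions of a module by a complex in nonpositive degrees -/

section Augmentation

variable {R : Type u} [CommRing R]

/-- The linear map in degree `0` of a morphism to a module. -/
def augmentation {P : Cx R} {M : ModuleCat.{u} R} (π : P ⟶ asComplex M) : P.X 0 ⟶ M :=
  π.f 0 ≫ (singleObjXSelf (ComplexShape.up ℤ) 0 M).hom

theorem exists_singleElt {M : ModuleCat.{u} R} (x : (asComplex M).X 0) :
    ∃ y : M, singleElt y = x :=
  ⟨(singleObjXSelf (ComplexShape.up ℤ) 0 M).hom.hom x,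
    congrArg (fun k : (asComplex M).X 0 ⟶ (asComplex M).X 0 => k.hom x)
      (singleObjXSelf (ComplexShape.up ℤ) 0 M).hom_inv_id⟩

theorem singleElt_zero {M : ModuleCat.{u} R} : singleElt (0 : M) = 0 :=
  map_zero (singleObjXSelf (ComplexShape.up ℤ) 0 M).inv.hom

theorem singleElt_injective {M : ModuleCat.{u} R} :
    Function.Injective (singleElt : M → (asComplex M).X 0) :=
  ((ConcreteCategory.isIso_iff_bijective (singleObjXSelf (ComplexShape.up ℤ) 0 M).inv).1
    inferInstance).1

theorem singleElt_augmentation {P : Cx R} {M : ModuleCat.{u} R} (π : P ⟶ asComplex M)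
    (x : P.X 0) : singleElt ((augmentation π).hom x) = (π.f 0).hom x :=
  congrArg (fun k : P.X 0 ⟶ (asComplex M).X 0 => k.hom x)
    ((Category.assoc _ _ _).trans ((congrArg (π.f 0 ≫ ·)
      (singleObjXSelf (ComplexShape.up ℤ) 0 M).hom_inv_id).trans (Category.comp_id _)))

theorem augmentation_comp_single_map {P : Cx R} {M N : ModuleCat.{u} R} (π : P ⟶ asComplex M)
    (u : M ⟶ N) :
    augmentation (π ≫ (HomologicalComplex.single (ModuleCat.{u} R) (ComplexShape.up ℤ) 0).map u) =
      augmentation π ≫ u := by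
  rw [augmentation, augmentation, comp_f, single_map_f_self]
  simp

theorem subsingleton_asComplex {M : ModuleCat.{u} R} {i : ℤ} (hi : i ≠ 0) :
    Subsingleton ((asComplex M).X i) :=
  ModuleCat.subsingleton_of_isZero (isZero_single_obj_X (ComplexShape.up ℤ) 0 M i hi)

theorem hom_asComplex_ext {P : Cx R} {M : ModuleCat.{u} R} {f g : P ⟶ asComplex M}
    (h : ∀ x, (augmentation f).hom x = (augmentation g).hom x) : f = g := by
  refine to_single_hom_ext ?_
  ext x
  rw [← singleElt_augmentation, ← singleElt_augmentation, h]

theorem augmentation_d {P : Cx R} {M : ModuleCat.{u} R} (π : P ⟶ asComplex M) (x : P.X (-1)) :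
    (augmentation π).hom ((P.d (-1) 0).hom x) = 0 := by
  refine singleElt_injective ?_
  rw [singleElt_augmentation, ← f_d_apply]
  have : Subsingleton ((asComplex M).X (-1)) := subsingleton_asComplex (by lia)
  rw [Subsingleton.elim ((π.f (-1)).hom x) 0, map_zero]
  exact singleElt_zero.symm

theorem subsingleton_of_isStrictlyLE {P : Cx R} {b : ℤ} (hP : P.IsStrictlyLE b) {i : ℤ}
    (hi : b < i) : Subsingleton (P.X i) :=
  ModuleCat.subsingleton_of_isZero (P.isZero_of_isStrictlyLE b i hi)

theorem exactAt_of_subsingleton {X : Cx R} {i : ℤ} (h : Subsingleton (X.X i)) : X.ExactAt i := by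
  rw [exactAt_iff X (i - 1) i (i + 1) (by lia) rfl]
  exact fun x _ => ⟨0, Subsingleton.elim _ _⟩

/-- Resolutions of a module. -/
theorem quasiIso_asComplex_iff {P : Cx R} (hP : P.IsStrictlyLE 0) {M : ModuleCat.{u} R}
    (π : P ⟶ asComplex M) : QuasiIso π ↔ (∀ i < 0, P.ExactAt i) ∧
      Function.Exact (P.d (-1) 0).hom (augmentation π).hom ∧
      Function.Surjective (augmentation π).hom := by
  have h1 : ∀ i, i ≠ 0 → (QuasiIsoAt π i ↔ P.ExactAt i) := fun i hi =>
    quasiIsoAt_iff_exactAt' π i (exactAt_asComplex M hi)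
  have h0 : QuasiIsoAt π 0 ↔ Function.Exact (P.d (-1) 0).hom (augmentation π).hom ∧
      Function.Surjective (augmentation π).hom := by
    rw [quasiIsoAt_iff π (-1) 0 1 rfl rfl]
    have s1 : Subsingleton (P.X 1) := subsingleton_of_isStrictlyLE hP (by lia)
    have s2 : Subsingleton ((asComplex M).X (-1)) := subsingleton_asComplex (by lia)
    have s3 : Subsingleton ((asComplex M).X 1) := subsingleton_asComplex (by lia)
    refine and_congr ⟨fun H x => ⟨fun hx => ?_, ?_⟩, fun H x _ y hy => ?_⟩
      ⟨fun H y => ?_, fun H y _ => ?_⟩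
    · refine H x (Subsingleton.elim _ _) 0 ?_
      rw [map_zero, ← singleElt_augmentation, hx]
      exact singleElt_zero.symm
    · rintro ⟨y, rfl⟩
      exact augmentation_d π y
    · refine (H x).1 (singleElt_injective ?_)
      rw [singleElt_augmentation, ← hy, Subsingleton.elim y 0, map_zero]
      exact singleElt_zero.symm
    · obtain ⟨x, -, w, hw⟩ := H (singleElt y) (Subsingleton.elim _ _)
      refine ⟨x, singleElt_injective ?_⟩
      rw [singleElt_augmentation, hw, Subsingleton.elim w 0, map_zero, add_zero]
    · obtain ⟨y, rfl⟩ := exists_singleElt y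
      obtain ⟨x, rfl⟩ := H y
      exact ⟨x, Subsingleton.elim _ _, 0, by rw [map_zero, add_zero, singleElt_augmentation]⟩
  rw [quasiIso_iff]
  constructor
  · intro H
    exact ⟨fun i hi => (h1 i hi.ne).1 (H i), h0.1 (H 0)⟩
  · rintro ⟨H, H'⟩ i
    rcases lt_trichotomy i 0 with hi | rfl | hi
    · exact (h1 i hi.ne).2 (H i hi)
    · exact h0.2 H'
    · exact (h1 i hi.ne').2 (exactAt_of_subsingleton (subsingleton_of_isStrictlyLE hP hi))

/-- Morphisms from a resolution of `M` to a module are morphisms from `M`. -/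
theorem exists_comp_single_map_eq {P : Cx R} (hP : P.IsStrictlyLE 0) {M N : ModuleCat.{u} R}
    (π : P ⟶ asComplex M) [hπ : QuasiIso π] (g : P ⟶ asComplex N) :
    ∃ u : M ⟶ N,
      π ≫ (HomologicalComplex.single (ModuleCat.{u} R) (ComplexShape.up ℤ) 0).map u = g := by
  obtain ⟨-, hex, hs⟩ := (quasiIso_asComplex_iff hP π).1 hπ
  have hk : LinearMap.ker (augmentation π).hom ≤ LinearMap.ker (augmentation g).hom := by
    intro x hx
    obtain ⟨y, rfl⟩ := (hex x).1 hx
    exact augmentation_d g y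
  let u : M →ₗ[R] N := (LinearMap.ker (augmentation π).hom).liftQ (augmentation g).hom hk ∘ₗ
    ((augmentation π).hom.quotKerEquivOfSurjective hs).symm.toLinearMap
  refine ⟨ModuleCat.ofHom u, hom_asComplex_ext fun x => ?_⟩
  rw [augmentation_comp_single_map]
  change u ((augmentation π).hom x) = _
  have : ((augmentation π).hom.quotKerEquivOfSurjective hs).symm ((augmentation π).hom x) =
      Submodule.Quotient.mk x := by
    rw [LinearEquiv.symm_apply_eq]
    rfl
  change (LinearMap.ker (augmentation π).hom).liftQ _ hk (_) = _
  rw [LinearEquiv.coe_coe, this]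
  rfl

theorem homologicallyFinite_asComplex_iff (M : ModuleCat.{u} R) :
    HomologicallyFinite (asComplex M) ↔ Module.Finite R M := by
  have e := (singleObjHomologySelfIso (ComplexShape.up ℤ) 0 M).toLinearEquiv
  rw [homologicallyFinite_iff]
  constructor
  · rintro ⟨h, -⟩
    have := h 0
    exact Module.Finite.equiv e
  · intro h
    have hs : ∀ i, i ≠ 0 → Subsingleton ((asComplex M).homology i) := fun i hi =>
      (exactAt_iff_subsingleton _ _).1 (exactAt_asComplex M hi)
    refine ⟨fun i => ?_, 0, fun i hi => hs i (by rintro rfl; simp at hi)⟩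
    by_cases hi : i = 0
    · subst hi
      exact Module.Finite.equiv e.symm
    · have := hs i hi
      infer_instance

end Augmentation

end

end SemiDual

namespace SemiDual

noncomputable section

open HomologicalComplex Limits CochainComplex

/-! ### Semidualizing modules as semidualizing complexes -/

section Semidualizing

variable {R : Type u} [CommRing R]

theorem subsingleton_cohomologyClass_iff (X Y : Cx R) (i : ℤ) :
    Subsingleton (CohomologyClass X Y i) ↔ (homCx X Y).ExactAt i := by
  rw [exactAt_iff _ (i - 1) i (i + 1) (by lia) rfl]
  constructor
  · intro H (z : Cochain X Y i) (hz : δ i (i + 1) z = 0)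
    have h := Subsingleton.elim (CohomologyClass.mk (Cocycle.mk z (i + 1) rfl hz)) 0
    rwa [CohomologyClass.mk_eq_zero_iff, mem_coboundaries_iff _ (i - 1) (by lia)] at h
  · intro H
    refine subsingleton_of_forall_eq 0 fun x => ?_
    obtain ⟨z, rfl⟩ := x.mk_surjective
    rw [CohomologyClass.mk_eq_zero_iff, mem_coboundaries_iff _ (i - 1) (by lia)]
    exact H z.1 (z.δ_eq_zero (i + 1))

theorem subsingleton_ext_iff {C D : ModuleCat.{u} R} (ρ : ProjectiveResolution C) (i : ℕ) :
    Subsingleton (Abelian.Ext C D i) ↔ (homCx ρ.cochainComplex (asComplex D)).ExactAt i := by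
  rw [← subsingleton_cohomologyClass_iff]
  exact ρ.extEquivCohomologyClass.subsingleton_congr

theorem subsingleton_homCx_X {P Y : Cx R} {a b n : ℤ} (hP : P.IsStrictlyLE b)
    (hY : Y.IsStrictlyGE a) (h : b + n < a) : Subsingleton ((homCx P Y).X n) := by
  refine subsingleton_of_forall_eq 0 fun (z : Cochain P Y n) => ?_
  refine Cochain.ext _ _ fun p q hpq => ?_
  rcases lt_or_ge b p with hp | hp
  · exact (P.isZero_of_isStrictlyLE b p hp).eq_of_src _ _
  · exact (Y.isZero_of_isStrictlyGE a q (by lia)).eq_of_tgt _ _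

/-- Composing with π turns the homothety into R → Hom(P, C), r ↦ r·π. The target vanishes in
negative degrees, its degree 0 cocycles are the endomorphisms of C, and its positive cohomology is
Ext(C, C) when P is a projective resolution. -/
theorem quasiIso_homothety_iff {P : Cx R} (hP : P.IsStrictlyLE 0) (hPP : P.IsKProjective)
    {C : ModuleCat.{u} R} (π : P ⟶ asComplex C) [hπ : QuasiIso π] :
    QuasiIso (homothety P) ↔ Function.Bijective (algebraMap R (Module.End R C)) ∧
      ∀ i : ℕ, 1 ≤ i → (homCx P (asComplex C)).ExactAt i := by
  have hq := quasiIso_homCxPostcomp hPP π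
  have hC : CochainComplex.IsStrictlyGE (asComplex C) 0 := by
    rw [CochainComplex.isStrictlyGE_iff]
    exact fun i hi => isZero_single_obj_X _ _ _ _ hi.ne
  obtain ⟨-, -, hs⟩ := (quasiIso_asComplex_iff hP π).1 hπ
  rw [← quasiIso_iff_comp_right (homothety P) (homCxPostcomp P π)]
  let q := homothety P ≫ homCxPostcomp P π
  have h1 : ∀ i, i ≠ 0 → (QuasiIsoAt q i ↔ (homCx P (asComplex C)).ExactAt i) := fun i hi =>
    quasiIsoAt_iff_exactAt q i (exactAt_asComplex _ hi)
  have hq0 : ∀ r : R, (q.f 0).hom (singleElt (M := ModuleCat.of R R) r) =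
      (r • Cochain.ofHom π : Cochain P (asComplex C) 0) := fun r => by
    refine (congrArg ((homCxPostcomp P π).f 0).hom (homothety_singleElt P r)).trans ?_
    refine Cochain.ext _ _ fun p q h => ?_
    ext x
    refine (comp_ofHom_v_apply (r • Cochain.ofHom (𝟙 P)) π p q h x).trans ?_
    obtain rfl : p = q := by lia
    simp
  have hr : ∀ (r : R) (u : C ⟶ C), (r • Cochain.ofHom π : Cochain P (asComplex C) 0) =
      Cochain.ofHom (π ≫
        (HomologicalComplex.single (ModuleCat.{u} R) (ComplexShape.up ℤ) 0).map u) ↔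
      algebraMap R (Module.End R C) r = u.hom := by
    intro r u
    have hs' : (r • Cochain.ofHom π : Cochain P (asComplex C) 0) = Cochain.ofHom (r • π) := by
      refine Cochain.ext _ _ fun p q h => ?_
      obtain rfl : p = q := by lia
      simp
    rw [hs']
    refine Iff.trans ⟨fun h => Cochain.ofHom_injective h, fun h => congrArg _ h⟩ ?_
    have hru : r • π = π ≫
        (HomologicalComplex.single (ModuleCat.{u} R) (ComplexShape.up ℤ) 0).map u ↔
        ∀ x, r • (augmentation π).hom x = u.hom ((augmentation π).hom x) := by
      have e : ∀ x, (augmentation (r • π)).hom x = r • (augmentation π).hom x := fun x => by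
        simp [augmentation]
      constructor
      · intro h x
        rw [← e, h, augmentation_comp_single_map]
        rfl
      · intro h
        refine hom_asComplex_ext fun x => ?_
        rw [e, h, augmentation_comp_single_map]
        rfl
    rw [hru]
    constructor
    · intro h
      ext y
      obtain ⟨x, rfl⟩ := hs y
      exact h x
    · intro h x
      exact LinearMap.congr_fun h _
  have h0 : QuasiIsoAt q 0 ↔ Function.Bijective (algebraMap R (Module.End R C)) := by
    rw [quasiIsoAt_iff q (-1) 0 1 rfl rfl]
    have s1 : Subsingleton ((asComplex (ModuleCat.of R R)).X 1) := subsingleton_asComplex (by lia)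
    have s2 : Subsingleton ((homCx P (asComplex C)).X (-1)) :=
      subsingleton_homCx_X hP hC (by lia)
    have s3 : Subsingleton ((asComplex (ModuleCat.of R R)).X (-1)) :=
      subsingleton_asComplex (by lia)
    refine and_congr ⟨fun H => ?_, fun H x _ y hy => ?_⟩ ⟨fun H u => ?_, fun H y hy => ?_⟩
    · rw [injective_iff_map_eq_zero]
      intro r h
      have h2 := (hr r 0).2 h
      obtain ⟨w, hw⟩ := H (singleElt (M := ModuleCat.of R R) r) (Subsingleton.elim _ _) 0 (by
        rw [hq0, h2, map_zero]
        simp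
        rfl)
      refine singleElt_injective (hw.symm.trans ?_)
      rw [Subsingleton.elim w 0, map_zero]
      exact singleElt_zero.symm
    · obtain ⟨(r : R), rfl⟩ := exists_singleElt x
      refine ⟨0, ?_⟩
      rw [Subsingleton.elim y 0, map_zero, hq0] at hy
      have h2 := (hr r 0).1 (by
        rw [← hy]
        simp
        rfl)
      have h3 : r = 0 := H (h2.trans (map_zero _).symm)
      rw [h3, map_zero]
      exact singleElt_zero.symm
    · let y := π ≫ (HomologicalComplex.single (ModuleCat.{u} R) (ComplexShape.up ℤ) 0).map
        (ModuleCat.ofHom u)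
      obtain ⟨x, -, w, hw⟩ := H (Cochain.ofHom y) (δ_ofHom y)
      obtain ⟨(r : R), rfl⟩ := exists_singleElt x
      refine ⟨r, (hr r (ModuleCat.ofHom u)).1 ?_⟩
      rw [Subsingleton.elim w 0, map_zero, hq0] at hw
      exact hw.trans (add_zero _)
    · let g : P ⟶ asComplex C := Cocycle.homOf (Cocycle.mk y 1 rfl hy)
      obtain ⟨u, hu⟩ := exists_comp_single_map_eq hP π g
      obtain ⟨r, hru⟩ := H u.hom
      refine ⟨singleElt (M := ModuleCat.of R R) r, Subsingleton.elim _ _, 0, ?_⟩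
      rw [hq0, (hr r u).2 hru, hu, map_zero, add_zero]
      exact Cocycle.cochain_ofHom_homOf_eq_coe _
  rw [quasiIso_iff]
  constructor
  · intro H
    exact ⟨h0.1 (H 0), fun i hi => (h1 i (by lia)).1 (H i)⟩
  · rintro ⟨H, H'⟩ i
    rcases lt_trichotomy i 0 with hi | rfl | hi
    · exact (h1 i hi.ne).2 (exactAt_of_subsingleton (subsingleton_homCx_X hP hC (by lia)))
    · exact h0.2 H
    · refine (h1 i hi.ne').2 ?_
      obtain ⟨n, rfl⟩ := Int.eq_ofNat_of_zero_le hi.le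
      exact H' n (by lia)

/-- A module is semidualizing when it is a semidualizing complex. -/
theorem isSemidualizingModule_iff (C : ModuleCat.{u} R) :
    IsSemidualizingModule C ↔ IsSemidualizing (asComplex C) := by
  let ρ := projectiveResolution C
  let P : Cx R := ρ.cochainComplex
  let π : P ⟶ asComplex C := ρ.π'
  have hπ : QuasiIso π := inferInstanceAs (QuasiIso ρ.π')
  have hP : P.IsKProjective := inferInstanceAs ρ.cochainComplex.IsKProjective
  rw [isSemidualizing_iff (DerivedIso.of_quasiIso π) hP, homologicallyFinite_asComplex_iff,
    quasiIso_homothety_iff (inferInstanceAs (ρ.cochainComplex.IsStrictlyLE 0)) hP π]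
  exact and_congr_right fun _ => and_congr_right fun _ =>
    forall₂_congr fun i _ => subsingleton_ext_iff ρ i

end Semidualizing

end

end SemiDual

namespace SemiDual

noncomputable section

open HomologicalComplex Limits CochainComplex

/-! ### Maps out of a faithful module and the lowest cohomology -/

section Faithful

variable {R : Type u} [CommRing R] [IsNoetherianRing R]

/-- A faithful finite module has non-zero maps to every non-zero module. -/
theorem subsingleton_of_forall_hom_eq_zero {C : ModuleCat.{u} R} [Module.Finite R C]
    (hC : Function.Injective (algebraMap R (Module.End R C))) (T : ModuleCat.{u} R)
    (h : ∀ u : C ⟶ T, u = 0) : Subsingleton T := by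
  refine subsingleton_of_forall_eq 0 fun t => ?_
  let N := Submodule.span R {t}
  have h1 : Subsingleton (C →ₗ[R] N) := subsingleton_of_forall_eq 0 fun u => by
    have h2 := congrArg ModuleCat.Hom.hom (h (ModuleCat.ofHom (N.subtype ∘ₗ u)))
    ext x
    exact LinearMap.congr_fun h2 x
  -- For finite modules over a Noetherian ring, Hom(C, N) = 0 exactly when some element of the
  -- annihilator of C is regular on N. Faithfulness makes that element 0, so N = 0.
  rw [IsSMulRegular.subsingleton_linearMap_iff] at h1
  obtain ⟨r, hr, hreg⟩ := h1
  have hr0 : r = 0 := hC (by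
    ext x
    rw [map_zero]
    exact Module.mem_annihilator.1 hr x)
  subst hr0
  exact congrArg Subtype.val (hreg (a₁ := (⟨t, Submodule.mem_span_singleton_self t⟩ : N)) (a₂ := 0)
    ((zero_smul R _).trans (zero_smul R _).symm))

end Faithful

section LowestDegree

variable {R : Type u} [CommRing R]

/-- In the lowest possible degree s, the cohomology of Hom(P, X) is Hom(C, Hˢ(X)). Once X is
truncated, a map from C to the cocycles in degree s gives a cocycle of Hom(P, X) supported at P⁰; it
is a coboundary of something in degree s - 1, where the Hom complex is zero. -/
theorem exactAt_of_exactAt_homCx {P X : Cx R} (hP : P.IsStrictlyLE 0) (hPP : P.IsKProjective)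
    {C : ModuleCat.{u} R} (π : P ⟶ asComplex C) [hπ : QuasiIso π]
    (hC : ∀ T : ModuleCat.{u} R, (∀ u : C ⟶ T, u = 0) → Subsingleton T) {s : ℤ} (hs : X.IsGE s)
    (h : (homCx P X).ExactAt s) : X.ExactAt s := by
  let Y := X.truncGE s
  have hY : Y.IsStrictlyGE s := inferInstance
  have hq := quasiIso_homCxPostcomp hPP (X.πTruncGE s)
  rw [exactAt_of_quasiIso (homCxPostcomp P (X.πTruncGE s)), exactAt_iff _ (s - 1) s (s + 1)
    (by lia) rfl] at h
  rw [exactAt_of_quasiIso (X.πTruncGE s), exactAt_iff _ (s - 1) s (s + 1) (by lia) rfl]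
  let T := ModuleCat.of R (LinearMap.ker (Y.d s (s + 1)).hom)
  let ι : T ⟶ Y.X s := ModuleCat.ofHom (LinearMap.ker (Y.d s (s + 1)).hom).subtype
  obtain ⟨-, -, hsurj⟩ := (quasiIso_asComplex_iff hP π).1 hπ
  have hT : Subsingleton T := hC T fun u => by
    have hz : δ s (s + 1) (Cochain.single (K := P) (L := Y) (augmentation π ≫ u ≫ ι) s) = 0 := by
      have e1 : (augmentation π ≫ u ≫ ι) ≫ Y.d s (s + 1) = 0 := by
        ext x
        exact (u.hom ((augmentation π).hom x)).2
      have e2 : P.d (-1) 0 ≫ augmentation π ≫ u ≫ ι = 0 := by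
        ext x
        refine (congrArg (fun c : C => (u.hom c).1) (augmentation_d π x)).trans ?_
        rw [map_zero]
        rfl
      rw [Cochain.δ_single (p := 0) _ s (s + 1) rfl (-1) (s + 1) rfl rfl, e1, e2, Cochain.single_zero,
        Cochain.single_zero, smul_zero, add_zero]
    obtain ⟨w, hw⟩ := h (Cochain.single (K := P) (L := Y) (augmentation π ≫ u ≫ ι) s) hz
    have := subsingleton_homCx_X hP hY (n := s - 1) (by lia)
    rw [Subsingleton.elim w 0, map_zero] at hw
    have h2 := congrArg (fun z : Cochain P Y s => z.v 0 s (zero_add s)) hw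
    have h3 : augmentation π ≫ u ≫ ι = 0 := by
      refine Eq.trans ?_ h2.symm
      exact (Cochain.single_v (K := P) (L := Y) (augmentation π ≫ u ≫ ι) s (zero_add s)).symm
    ext c
    obtain ⟨x, rfl⟩ := hsurj c
    exact congrArg (fun k : P.X 0 ⟶ Y.X s => k.hom x) h3
  intro x hx
  refine ⟨0, ?_⟩
  rw [map_zero]
  exact (congrArg Subtype.val (Subsingleton.elim (⟨x, hx⟩ : T) 0)).symm

/-- Starting from the lower bound `a`, each degree in turn becomes the lowest one where cohomology
could survive. -/
theorem exactAt_of_forall_exactAt_homCx {P X : Cx R} (hP : P.IsStrictlyLE 0)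
    (hPP : P.IsKProjective) {C : ModuleCat.{u} R} (π : P ⟶ asComplex C) [QuasiIso π]
    (hC : ∀ T : ModuleCat.{u} R, (∀ u : C ⟶ T, u = 0) → Subsingleton T) {a : ℤ} (ha : X.IsGE a)
    (h : ∀ i < 0, (homCx P X).ExactAt i) : ∀ i < 0, X.ExactAt i := by
  have key : ∀ (n : ℕ) (i : ℤ), i < 0 → i < a + n → X.ExactAt i := by
    intro n
    induction n with
    | zero => exact fun i _ hi => X.exactAt_of_isGE a i (by simpa using hi)
    | succ n ih =>
      intro i hi0 hi
      refine exactAt_of_exactAt_homCx hP hPP π hC ?_ (h i hi0)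
      rw [CochainComplex.isGE_iff]
      exact fun j hj => ih j (by lia) (by push_cast at hi; lia)
  exact fun i hi => key (i - a + 1).toNat i hi (by lia)

end LowestDegree

/-! ### Base change of semidualizing modules -/

section Modules

variable {A B : Type u} [CommRing A] [CommRing B]

/-- Extension of scalars of a module in degree `0`. -/
def extAsComplexIso (φ : A →+* B) (C : ModuleCat.{u} A) :
    (extCx φ).obj (asComplex C) ≅ asComplex ((ModuleCat.extendScalars.{u, u, u} φ).obj C) :=
  (singleMapHomologicalComplex (ModuleCat.extendScalars.{u, u, u} φ) (ComplexShape.up ℤ) 0).app C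

theorem augmentation_extAsComplexIso (φ : A →+* B) {P : Cx A} {C : ModuleCat.{u} A}
    (π : P ⟶ asComplex C) : augmentation ((extCx φ).map π ≫ (extAsComplexIso φ C).hom) =
      (ModuleCat.extendScalars.{u, u, u} φ).map (augmentation π) := by
  rw [augmentation, augmentation, Functor.map_comp, comp_f, Category.assoc]
  congr 1
  have := singleMapHomologicalComplex_hom_app_self (ModuleCat.extendScalars.{u, u, u} φ)
    (ComplexShape.up ℤ) 0 C
  refine (congrArg (· ≫ (singleObjXSelf (ComplexShape.up ℤ) 0 _).hom) this).trans ?_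
  exact (Category.assoc _ _ _).trans ((congrArg (_ ≫ ·) (Iso.inv_hom_id _)).trans
    (Category.comp_id _))

theorem extendScalars_exact (φ : A →+* B) {X Y Z : ModuleCat.{u} A} (f : X ⟶ Y) (g : Y ⟶ Z)
    (h : Function.Exact f.hom g.hom) (hg : Function.Surjective g.hom) :
    Function.Exact ((ModuleCat.extendScalars.{u, u, u} φ).map f).hom
        ((ModuleCat.extendScalars.{u, u, u} φ).map g).hom ∧
      Function.Surjective ((ModuleCat.extendScalars.{u, u, u} φ).map g).hom :=
  ⟨lTensor_exact (ringAsModule φ) h hg, LinearMap.lTensor_surjective (ringAsModule φ) hg⟩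

variable [IsNoetherianRing A]

/-- A semidualizing module is Tor-independent from a homomorphism of finite flat dimension. -/
theorem quasiIso_extCx_of_isSemidualizingModule {φ : A →+* B} (hφ : FiniteFlatDim φ)
    {C : ModuleCat.{u} A} (hC : IsSemidualizingModule C) {P : Cx A} (hP : IsFiniteFree P)
    (hP0 : P.IsStrictlyLE 0) (π : P ⟶ asComplex C) [hπ : QuasiIso π] :
    QuasiIso ((extCx φ).map π ≫ (extAsComplexIso φ C).hom) := by
  have hD := DerivedIso.of_quasiIso π
  have hC' := (isSemidualizingModule_iff C).1 hC
  have hPs := ((isSemidualizing_iff hD hP.isKProjective).1 hC').2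
  obtain ⟨hex1, hex2, hex3⟩ := (quasiIso_asComplex_iff hP0 π).1 hπ
  have ha : P.IsGE 0 := by
    rw [CochainComplex.isGE_iff]
    exact hex1
  obtain ⟨a, ha'⟩ := isGE_extCx hφ hP.flat ha
  have hh := quasiIso_homothety_extCx hφ hP ha
  have hPB : ((extCx φ).obj P).IsStrictlyLE 0 := by
    rw [CochainComplex.isStrictlyLE_iff] at hP0 ⊢
    exact fun i hi => (ModuleCat.extendScalars.{u, u, u} φ).map_isZero (hP0 i hi)
  rw [quasiIso_asComplex_iff hPB, augmentation_extAsComplexIso]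
  refine ⟨?_, extendScalars_exact φ _ _ hex2 hex3⟩
  have hres : ((resCx φ).obj ((extCx φ).obj P)).IsGE a := by
    rw [CochainComplex.isGE_iff]
    exact fun i hi => (exactAt_resCx_iff φ _ i).2 (((extCx φ).obj P).exactAt_of_isGE a i hi)
  have := hC.1
  intro i hi
  rw [← exactAt_resCx_iff φ]
  -- Hom_A(P, B ⊗ P) is Hom_B(B ⊗ P, B ⊗ P) ≃ B, which has no cohomology in negative degrees.
  refine exactAt_of_forall_exactAt_homCx hP0 hP.isKProjective π
    (subsingleton_of_forall_hom_eq_zero hC.2.1.1) hres (fun j hj => ?_) i hi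
  rw [← exactAt_of_quasiIso (homCxRes φ P _), exactAt_resCx_iff,
    ← exactAt_of_quasiIso (homothety ((extCx φ).obj P))]
  exact exactAt_asComplex _ hj.ne

theorem exists_resolution_asComplex (C : ModuleCat.{u} A) [hC : Module.Finite A C] :
    ∃ (P : Cx A) (π : P ⟶ asComplex C), IsFiniteFree P ∧ QuasiIso π ∧ P.IsStrictlyLE 0 := by
  refine exists_isFiniteFree
    ((homologicallyFinite_iff _).1 ((homologicallyFinite_asComplex_iff C).2 hC)).1 ?_
  rw [CochainComplex.isLE_iff]
  exact fun i hi => exactAt_asComplex C hi.ne'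

theorem IsSemidualizingModule.isDerivedBaseChange {φ : A →+* B} (hφ : FiniteFlatDim φ)
    {C : ModuleCat.{u} A} (hC : IsSemidualizingModule C) : IsDerivedBaseChange φ (asComplex C)
      (asComplex ((ModuleCat.extendScalars.{u, u, u} φ).obj C)) := by
  have := hC.1
  obtain ⟨P, π, hP, hπ, hP0⟩ := exists_resolution_asComplex C
  rw [isDerivedBaseChange_iff φ (DerivedIso.of_quasiIso π) hP.isKProjective]
  have := quasiIso_extCx_of_isSemidualizingModule hφ hC hP hP0 π
  exact (DerivedIso.of_quasiIso ((extCx φ).map π ≫ (extAsComplexIso φ C).hom)).symm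

theorem IsSemidualizingModule.extendScalars [IsNoetherianRing B] {φ : A →+* B} (hφ : FiniteFlatDim φ)
    {C : ModuleCat.{u} A} (hC : IsSemidualizingModule C) :
    IsSemidualizingModule ((ModuleCat.extendScalars.{u, u, u} φ).obj C) := by
  have h := hC.isDerivedBaseChange hφ
  rw [isSemidualizingModule_iff] at hC ⊢
  obtain ⟨P, hP, hPC, -, hPs⟩ := hC.exists_resolution
  rw [isDerivedBaseChange_iff φ hPC hP.isKProjective] at h
  exact h.symm.isSemidualizing (isSemidualizing_extCx hφ hP hPs)

end Modules

end

end SemiDual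

namespace SemiDual

noncomputable section

open HomologicalComplex Limits CochainComplex

/-! ### The induced bijections on semidualizing modules -/

section Modules

variable {A B : Type u} [CommRing A] [CommRing B]

theorem S₀.mk_eq_mk {C D : ModuleCat.{u} A} {hC : IsSemidualizingModule C}
    {hD : IsSemidualizingModule D} (e : C ≅ D) : S₀.mk C hC = S₀.mk D hD := Quotient.sound ⟨e⟩

theorem S₀.exists_rep (a : S₀ A) :
    ∃ (C : ModuleCat.{u} A) (h : IsSemidualizingModule C), a = S₀.mk C h := by
  induction a using Quotient.inductionOn with | h C =>
  exact ⟨C.1, C.2, rfl⟩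

theorem DerivedIso.nonempty_iso {C D : ModuleCat.{u} A}
    (h : DerivedIso (asComplex C) (asComplex D)) : Nonempty (C ≅ D) := by
  obtain ⟨e⟩ := h.homologyEquiv 0
  exact ⟨(singleObjHomologySelfIso (ComplexShape.up ℤ) 0 C).symm ≪≫ e ≪≫
    singleObjHomologySelfIso (ComplexShape.up ℤ) 0 D⟩

/-- A homomorphism of finite flat dimension induces a map on isomorphism classes of semidualizing
modules. -/
theorem exists_isInducedMap₀ [IsNoetherianRing A] [IsNoetherianRing B] {φ : A →+* B}
    (hφ : FiniteFlatDim φ) : ∃ f : S₀ A → S₀ B, IsInducedMap₀ φ f :=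
  ⟨Quotient.lift (fun C => S₀.mk _ (C.2.extendScalars hφ))
    fun C D (h : Nonempty (C.1 ≅ D.1)) =>
      S₀.mk_eq_mk ((ModuleCat.extendScalars.{u, u, u} φ).mapIso h.some),
    fun _ hC => ⟨hC.extendScalars hφ, rfl⟩⟩

theorem IsInducedMap₀.le [IsNoetherianRing A] [IsNoetherianRing B] {φ : A →+* B}
    (hφ : FiniteFlatDim φ) {f : S₀ A → S₀ B} (hf : IsInducedMap₀ φ f) {a b : S₀ A}
    (h : S₀.le a b) : S₀.le (f a) (f b) := by
  obtain ⟨C, D, hC, hD, rfl, rfl, h⟩ := h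
  obtain ⟨hC', eC⟩ := hf C hC
  obtain ⟨hD', eD⟩ := hf D hD
  exact ⟨_, _, hC', hD', eC, eD,
    h.baseChange hφ ((homologicallyFinite_asComplex_iff C).2 hC.1) (hC.isDerivedBaseChange hφ)
      (hD.isDerivedBaseChange hφ)⟩

theorem IsInducedMap₀.retract {φ : A →+* B} {ψ : B →+* A} (h : ψ.comp φ = RingHom.id A)
    {f : S₀ A → S₀ B} {g : S₀ B → S₀ A} (hf : IsInducedMap₀ φ f) (hg : IsInducedMap₀ ψ g)
    (a : S₀ A) : g (f a) = a := by
  obtain ⟨C, hC, rfl⟩ := a.exists_rep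
  obtain ⟨h1, e1⟩ := hf C hC
  obtain ⟨h2, e2⟩ := hg _ h1
  rw [e1, e2]
  exact S₀.mk_eq_mk ((extendScalarsRetractIso h).app C)

/-- By Tor-independence both module base changes are derived ones, so the isomorphism of complexes P
≅ B ⊗ (A ⊗ P) can be read off on cohomology in degree 0. -/
theorem IsInducedMap₀.section [IsNoetherianRing A] [IsNoetherianRing B] {φ : A →+* B} {ψ : B →+* A}
    (h : IsRetractPair φ ψ) {f : S₀ A → S₀ B} {g : S₀ B → S₀ A} (hf : IsInducedMap₀ φ f)
    (hg : IsInducedMap₀ ψ g) (b : S₀ B) : f (g b) = b := by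
  obtain ⟨C, hC, rfl⟩ := b.exists_rep
  obtain ⟨h1, e1⟩ := hg C hC
  obtain ⟨h2, e2⟩ := hf _ h1
  rw [e1, e2]
  have := hC.1
  obtain ⟨P, π, hP, hπ, hP0⟩ := exists_resolution_asComplex C
  have hPC := DerivedIso.of_quasiIso π
  have hP' := isFiniteFree_extCx ψ hP
  have hd := hC.isDerivedBaseChange h.finiteFlatDim_right
  rw [isDerivedBaseChange_iff ψ hPC hP.isKProjective] at hd
  have hd' := h1.isDerivedBaseChange h.finiteFlatDim_left
  rw [isDerivedBaseChange_iff φ hd.symm hP'.isKProjective] at hd'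
  have hh := ((isSemidualizing_iff hd.symm hP'.isKProjective).1
    ((isSemidualizingModule_iff _).1 h1)).2
  have ha : P.IsGE 0 := by
    rw [CochainComplex.isGE_iff]
    exact ((quasiIso_asComplex_iff hP0 π).1 hπ).1
  obtain ⟨e⟩ := exists_iso_extCx_extCx h.finiteFlatDim_right h.comp_eq_id h.ker_le_jacobson hP ha
    h.finiteFlatDim_left
  obtain ⟨e'⟩ := ((hd'.trans (DerivedIso.of_iso e.symm)).trans hPC).nonempty_iso
  exact S₀.mk_eq_mk e'

/-- A retract pair induces mutually inverse order isomorphisms on semidualizing modules. -/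
theorem IsRetractPair.exists_isPerfectBijection₀ [IsNoetherianRing A] [IsNoetherianRing B]
    {φ : A →+* B} {ψ : B →+* A} (h : IsRetractPair φ ψ) :
    (∃ f : S₀ A → S₀ B, IsInducedMap₀ φ f ∧ IsPerfectBijection S₀.le S₀.le f) ∧
      ∃ g : S₀ B → S₀ A, IsInducedMap₀ ψ g ∧ IsPerfectBijection S₀.le S₀.le g := by
  obtain ⟨f, hf⟩ := exists_isInducedMap₀ h.finiteFlatDim_left
  obtain ⟨g, hg⟩ := exists_isInducedMap₀ h.finiteFlatDim_right
  have h1 := hf.retract h.comp_eq_id hg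
  have h2 := hf.section h hg
  have h3 := fun a b : S₀ A => hf.le h.finiteFlatDim_left (a := a) (b := b)
  have h4 := fun a b : S₀ B => hg.le h.finiteFlatDim_right (a := a) (b := b)
  exact ⟨⟨f, hf, isPerfectBijection_of_inverse h1 h2 h3 h4⟩,
    ⟨g, hg, isPerfectBijection_of_inverse h2 h1 h4 h3⟩⟩

end Modules

end

end SemiDual

namespace SemiDual

noncomputable section

/-! ### Flat dimension in short exact sequences -/

section FlatDimension

variable {R : Type u} [CommRing R]

/-- An extension of modules of flat dimension at most `n`. -/
theorem FlatDimLE.of_exact {n : ℕ} {M M' M'' : ModuleCat.{u} R} (f : M' →ₗ[R] M) (g : M →ₗ[R] M'')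
    (h : Function.Exact f g) (hf : Function.Injective f) (hg : Function.Surjective g)
    (h' : FlatDimLE n M') (h'' : FlatDimLE n M'') : FlatDimLE n M := by
  induction n generalizing M M' M'' with
  | zero => exact flat_of_exact h hf hg h' h''
  | succ n ih =>
    let p' := Finsupp.linearCombination R (id : M' → M')
    have hp' : Function.Surjective p' := Finsupp.linearCombination_id_surjective R M'
    let p'' := Finsupp.linearCombination R (id : M'' → M'')
    have hp'' : Function.Surjective p'' := Finsupp.linearCombination_id_surjective R M''
    obtain ⟨q, hq⟩ := Module.projective_lifting_property g p'' hg
    have hq' : ∀ x, g (q x) = p'' x := LinearMap.congr_fun hq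
    have hgf : ∀ x, g (f x) = 0 := fun x => (h _).2 ⟨x, rfl⟩
    -- Horseshoe construction: the kernels of the three free covers form a short exact sequence, and
    -- the outer ones have smaller flat dimension.
    let p : ((M' →₀ R) × (M'' →₀ R)) →ₗ[R] M := (f ∘ₗ p').coprod q
    have hp : ∀ x, p x = f (p' x.1) + q x.2 := fun _ => rfl
    refine ⟨ModuleCat.of R ((M' →₀ R) × (M'' →₀ R)), p, ?_, fun m => ?_, ?_⟩
    · exact inferInstanceAs (Module.Flat R ((M' →₀ R) × (M'' →₀ R)))
    · obtain ⟨y, hy⟩ := hp'' (g m)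
      obtain ⟨z, hz⟩ := (h (m - q y)).1 (by rw [map_sub, hq', hy, sub_self])
      obtain ⟨x, rfl⟩ := hp' z
      exact ⟨(x, y), by rw [hp, hz, sub_add_cancel]⟩
    · let i : LinearMap.ker p' →ₗ[R] LinearMap.ker p :=
        (LinearMap.inl R (M' →₀ R) (M'' →₀ R)).restrict fun x hx => by
          rw [LinearMap.mem_ker] at hx ⊢
          rw [LinearMap.inl_apply, hp, hx, map_zero, map_zero, zero_add]
      let s : LinearMap.ker p →ₗ[R] LinearMap.ker p'' :=
        (LinearMap.snd R (M' →₀ R) (M'' →₀ R)).restrict fun x hx => by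
          rw [LinearMap.mem_ker, hp] at hx
          have := congrArg g hx
          rw [map_add, hgf, zero_add, map_zero, hq'] at this
          exact this
      refine ih (M' := ModuleCat.of R (LinearMap.ker p')) (M := ModuleCat.of R (LinearMap.ker p))
        (M'' := ModuleCat.of R (LinearMap.ker p'')) i s ?_ ?_ ?_ (h'.ker_of_projective p' hp')
        (h''.ker_of_projective p'' hp'')
      · intro x
        constructor
        · intro hx
          have hx2 : x.1.2 = 0 := congrArg Subtype.val hx
          have hx1 : f (p' x.1.1) + q x.1.2 = 0 := x.2
          rw [hx2, map_zero, add_zero] at hx1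
          exact ⟨⟨x.1.1, hf (hx1.trans (map_zero f).symm)⟩, Subtype.ext (Prod.ext rfl hx2.symm)⟩
        · rintro ⟨y, rfl⟩
          rfl
      · intro x y hxy
        exact Subtype.ext (congrArg (fun z : LinearMap.ker p => z.1.1) hxy)
      · rintro ⟨y, hy⟩
        obtain ⟨z, hz⟩ := (h (q y)).1 (by rw [hq']; exact hy)
        obtain ⟨x, rfl⟩ := hp' z
        refine ⟨⟨(-x, y), ?_⟩, rfl⟩
        rw [LinearMap.mem_ker, hp, map_neg, map_neg, hz, neg_add_cancel]

theorem FlatDimLE.succ {n : ℕ} {M : ModuleCat.{u} R} (h : FlatDimLE n M) :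
    FlatDimLE (n + 1) M := by
  induction n generalizing M with
  | zero =>
    refine ⟨M, LinearMap.id, h, Function.surjective_id, ?_⟩
    rw [LinearMap.ker_id]
    exact inferInstanceAs (Module.Flat R (⊥ : Submodule R M))
  | succ n ih =>
    obtain ⟨F, f, hF, hf, hK⟩ := h
    exact ⟨F, f, hF, hf, ih hK⟩

/-- A cokernel of an injective map between modules of flat dimension at most `n`. -/
theorem FlatDimLE.of_exact_right {n : ℕ} {M M' M'' : ModuleCat.{u} R} (f : M' →ₗ[R] M)
    (g : M →ₗ[R] M'') (h : Function.Exact f g) (hf : Function.Injective f)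
    (hg : Function.Surjective g) (h' : FlatDimLE n M') (hM : FlatDimLE n M) :
    FlatDimLE (n + 1) M'' := by
  let p := Finsupp.linearCombination R (id : M → M)
  have hp : Function.Surjective p := Finsupp.linearCombination_id_surjective R M
  have hK : FlatDimLE n (ModuleCat.of R (LinearMap.ker p)) := by
    have := hM.ker_of_projective p hp
    cases n with
    | zero => exact this
    | succ n => exact this.succ
  have hle : LinearMap.ker p ≤ LinearMap.ker (g ∘ₗ p) := LinearMap.ker_le_ker_comp p g
  let s : LinearMap.ker (g ∘ₗ p) →ₗ[R] LinearMap.ker g := p.restrict fun x hx => hx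
  refine ⟨ModuleCat.of R (M →₀ R), g ∘ₗ p, inferInstanceAs (Module.Flat R (M →₀ R)),
    hg.comp hp, ?_⟩
  -- The kernel of the free cover g ∘ p of M'' is an extension of ker g ≅ M' by ker p.
  refine FlatDimLE.of_exact (M' := ModuleCat.of R (LinearMap.ker p))
    (M := ModuleCat.of R (LinearMap.ker (g ∘ₗ p))) (M'' := ModuleCat.of R (LinearMap.ker g))
    (Submodule.inclusion hle) s (fun x => ?_) (Submodule.inclusion_injective hle) ?_ hK
    (h'.of_linearEquiv (M' := ModuleCat.of R (LinearMap.ker g))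
      ((LinearEquiv.ofInjective f hf).trans (LinearEquiv.ofEq _ _ h.linearMap_ker_eq.symm)))
  · constructor
    · intro hx
      exact ⟨⟨x.1, congrArg Subtype.val hx⟩, rfl⟩
    · rintro ⟨y, rfl⟩
      exact Subtype.ext y.2
  · rintro ⟨y, hy⟩
    obtain ⟨x, rfl⟩ := hp y
    exact ⟨⟨x, hy⟩, rfl⟩

end FlatDimension

/-! ### Flatness of products of copies of the ring -/

section Pi

variable {R : Type u} [CommRing R] [IsNoetherianRing R]

/-- Products of copies of a Noetherian ring are flat. -/
theorem flat_pi (X : Type*) : Module.Flat R (X → R) := by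
  rw [Module.Flat.iff_forall_isTrivialRelation]
  intro l f x hx
  -- Equational criterion: a relation with coefficients `f` holds coordinatewise, so each coordinate
  -- is a syzygy of `f`. Finitely many generators of the syzygy module trivialize all coordinates at
  -- once.
  let K := LinearMap.ker (Fintype.linearCombination R f)
  obtain ⟨k, a, ha⟩ := Submodule.fg_iff_exists_fin_generating_family.1 (IsNoetherian.noetherian K)
  have hK : ∀ p : X, (fun i => x i p) ∈ Submodule.span R (Set.range a) := by
    intro p
    rw [ha, LinearMap.mem_ker, Fintype.linearCombination_apply]
    have := congrFun hx p
    rw [Finset.sum_apply] at this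
    refine Eq.trans (Finset.sum_congr rfl fun i _ => ?_) this
    exact mul_comm _ _
  simp only [Submodule.mem_span_range_iff_exists_fun] at hK
  choose y hy using hK
  refine ⟨k, fun i j => a j i, fun j p => y p j, fun i => ?_, fun j => ?_⟩
  · funext p
    have := congrFun (hy p) i
    rw [Finset.sum_apply] at this ⊢
    refine this.symm.trans (Finset.sum_congr rfl fun j _ => ?_)
    exact mul_comm _ _
  · have : a j ∈ K := ha ▸ Submodule.subset_span ⟨j, rfl⟩
    rw [LinearMap.mem_ker, Fintype.linearCombination_apply] at this
    refine Eq.trans (Finset.sum_congr rfl fun i _ => ?_) this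
    exact mul_comm _ _

end Pi

/-! ### Power series rings -/

section PowerSeries

open MvPowerSeries

variable {R : Type u} [CommRing R] {σ : Type}

/-- The power series without monomials avoiding the variables in `s`. -/
def variablesIdeal (R : Type u) [CommRing R] (s : Finset σ) : Ideal (MvPowerSeries σ R) where
  carrier := {f | ∀ m : σ →₀ ℕ, (∀ i ∈ s, m i = 0) → coeff m f = 0}
  add_mem' hf hg m hm := by rw [map_add, hf m hm, hg m hm, add_zero]
  zero_mem' m _ := map_zero _
  smul_mem' f g hg m hm := by
    classical
    rw [smul_eq_mul, coeff_mul]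
    refine Finset.sum_eq_zero fun p hp => ?_
    rw [Finset.HasAntidiagonal.mem_antidiagonal] at hp
    rw [hg p.2 fun i hi => ?_, mul_zero]
    have := hm i hi
    rw [← hp, Finsupp.add_apply] at this
    lia

theorem coeff_add_single_X_mul (f : MvPowerSeries σ R) (k : σ) (m : σ →₀ ℕ) :
    coeff (Finsupp.single k 1 + m) (X k * f) = coeff m f := by
  rw [X, coeff_add_monomial_mul, one_mul]

theorem coeff_X_mul_eq_zero (f : MvPowerSeries σ R) (k : σ) (m : σ →₀ ℕ) (hm : m k = 0) :
    coeff m (X k * f) = 0 := by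
  classical
  rw [X, coeff_monomial_mul, if_neg]
  intro h
  have := h k
  simp [hm] at this

theorem mem_variablesIdeal_of_X_mul_mem {s : Finset σ} {k : σ} (hk : k ∉ s)
    {f : MvPowerSeries σ R} (h : X k * f ∈ variablesIdeal R s) : f ∈ variablesIdeal R s := by
  intro m hm
  rw [← coeff_add_single_X_mul f k m]
  refine h _ fun i hi => ?_
  have : k ≠ i := fun e => hk (e ▸ hi)
  simp [hm i hi, this]

/-- Taking for h the series f with its exponents shifted down in X_k, the difference f - X_k·h
retains exactly the monomials of f not involving X_k. -/
theorem mem_variablesIdeal_cons_iff {s : Finset σ} {k : σ} (hk : k ∉ s) (f : MvPowerSeries σ R) :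
    f ∈ variablesIdeal R (Finset.cons k s hk) ↔ ∃ h, f - X k * h ∈ variablesIdeal R s := by
  constructor
  · intro hf
    let h : MvPowerSeries σ R := fun m => coeff (Finsupp.single k 1 + m) f
    refine ⟨h, fun m hm => ?_⟩
    rw [map_sub, sub_eq_zero]
    by_cases hmk : m k = 0
    · rw [coeff_X_mul_eq_zero _ _ _ hmk]
      refine hf m fun i hi => ?_
      rcases Finset.mem_cons.1 hi with rfl | hi
      · exact hmk
      · exact hm i hi
    · obtain ⟨m', rfl⟩ : ∃ m', m = Finsupp.single k 1 + m' :=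
        ⟨m - Finsupp.single k 1, (add_tsub_cancel_of_le (by
          rw [Finsupp.single_le_iff]
          lia)).symm⟩
      rw [coeff_add_single_X_mul]
      rfl
  · rintro ⟨h, hh⟩ m hm
    have h1 := hh m fun i hi => hm i (Finset.mem_cons_of_mem hi)
    rwa [map_sub, coeff_X_mul_eq_zero _ _ _ (hm k (Finset.mem_cons_self k s)), sub_zero] at h1

/-- X_k is regular modulo the variables in `s`, and dividing by it gives the quotient for `s` with k
added. Each variable therefore costs at most one in flat dimension. -/
theorem exists_flatDimLE_variablesIdeal (s : Finset σ) : ∃ n, FlatDimLE n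
    (ModuleCat.of (MvPowerSeries σ R) (MvPowerSeries σ R ⧸ variablesIdeal R s)) := by
  induction s using Finset.cons_induction with
  | empty =>
    refine ⟨0, ?_⟩
    have h : variablesIdeal R (∅ : Finset σ) = ⊥ := by
      refine eq_bot_iff.2 fun f hf => ?_
      rw [Submodule.mem_bot]
      ext m
      exact hf m (by simp)
    rw [h]
    exact Module.Flat.of_linearEquiv (Submodule.quotEquivOfEqBot ⊥ rfl)
  | cons k s hk ih =>
    obtain ⟨n, hn⟩ := ih
    let I := variablesIdeal R s
    let J := variablesIdeal R (Finset.cons k s hk)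
    have hIJ : I ≤ J := fun f hf => (mem_variablesIdeal_cons_iff hk f).2 ⟨0, by simpa using hf⟩
    let f : (MvPowerSeries σ R ⧸ I) →ₗ[MvPowerSeries σ R] (MvPowerSeries σ R ⧸ I) :=
      LinearMap.lsmul _ _ (X k)
    refine ⟨n + 1, FlatDimLE.of_exact_right (M'' := ModuleCat.of _ (MvPowerSeries σ R ⧸ J)) f
      (Submodule.mapQ I J LinearMap.id hIJ) (fun x => ?_) ?_ ?_ hn hn⟩
    · obtain ⟨x, rfl⟩ := Submodule.Quotient.mk_surjective _ x
      rw [Submodule.mapQ_apply, LinearMap.id_apply, Submodule.Quotient.mk_eq_zero,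
        mem_variablesIdeal_cons_iff hk]
      constructor
      · rintro ⟨h, hh⟩
        refine ⟨Submodule.Quotient.mk h, ?_⟩
        exact ((Submodule.Quotient.eq I).2 hh).symm
      · rintro ⟨y, hy⟩
        obtain ⟨h, rfl⟩ := Submodule.Quotient.mk_surjective _ y
        exact ⟨h, (Submodule.Quotient.eq I).1 hy.symm⟩
    · rw [← LinearMap.ker_eq_bot, LinearMap.ker_eq_bot']
      intro y hy
      obtain ⟨h, rfl⟩ := Submodule.Quotient.mk_surjective _ y
      rw [Submodule.Quotient.mk_eq_zero]
      exact mem_variablesIdeal_of_X_mul_mem hk ((Submodule.Quotient.mk_eq_zero I).1 hy)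
    · intro y
      obtain ⟨h, rfl⟩ := Submodule.Quotient.mk_surjective _ y
      exact ⟨Submodule.Quotient.mk h, rfl⟩

theorem finiteFlatDim_constantCoeff [Fintype σ] :
    FiniteFlatDim (constantCoeff : MvPowerSeries σ R →+* R) := by
  let ψ : MvPowerSeries σ R →+* R := constantCoeff
  obtain ⟨n, hn⟩ := exists_flatDimLE_variablesIdeal (R := R) (Finset.univ : Finset σ)
  have h : variablesIdeal R (Finset.univ : Finset σ) = LinearMap.ker (extRingAux ψ).hom := by
    ext f
    rw [ker_extRingAux, RingHom.mem_ker]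
    constructor
    · intro hf
      exact hf 0 (by simp)
    · intro hf m hm
      obtain rfl : m = 0 := Finsupp.ext fun i => hm i (Finset.mem_univ i)
      exact hf
  refine ⟨n, hn.of_linearEquiv (M' := ringAsModule ψ) ((Submodule.quotEquivOfEq _ _ h).trans
    ((extRingAux ψ).hom.quotKerEquivOfSurjective (extRingAux_surjective fun r => ⟨C r, ?_⟩)))⟩
  exact constantCoeff_C r

/-- As an `R`-module the power series ring is the product of copies of `R` indexed by monomials,
hence flat. -/
theorem finiteFlatDim_C [IsNoetherianRing R] :
    FiniteFlatDim (C : R →+* MvPowerSeries σ R) := by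
  refine ⟨0, ?_⟩
  have := flat_pi (R := R) (σ →₀ ℕ)
  let e : (ModuleCat.restrictScalars (C : R →+* MvPowerSeries σ R)).obj
      (ModuleCat.of (MvPowerSeries σ R) (MvPowerSeries σ R)) ≃ₗ[R] ((σ →₀ ℕ) → R) :=
    { toFun := fun (f : MvPowerSeries σ R) => f
      invFun := fun f => f
      left_inv := fun _ => rfl
      right_inv := fun _ => rfl
      map_add' := fun _ _ => rfl
      map_smul' := fun r (f : MvPowerSeries σ R) => (smul_eq_C_mul f r).symm }
  exact Module.Flat.of_linearEquiv e

/-- A power series ring is a retract of the base ring up to semidualizing complexes. -/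
theorem isRetractPair_mvPowerSeries [IsNoetherianRing R] [Fintype σ] :
    IsRetractPair (C : R →+* MvPowerSeries σ R) constantCoeff where
  finiteFlatDim_left := finiteFlatDim_C
  finiteFlatDim_right := finiteFlatDim_constantCoeff
  comp_eq_id := RingHom.ext fun r => by
    rw [RingHom.comp_apply, constantCoeff_C, RingHom.id_apply]
  ker_le_jacobson := by
    intro f hf
    rw [← Ideal.jacobson_bot, Ideal.mem_jacobson_bot]
    intro g
    rw [MvPowerSeries.isUnit_iff_constantCoeff, map_add, map_mul, RingHom.mem_ker.1 hf, zero_mul,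
      zero_add, map_one]
    exact isUnit_one

end PowerSeries

end

end SemiDual

/-- Both maps of a retract pair induce perfectly order-respecting bijections on semidualizing
modules and on semidualizing complexes; power series extensions are retract pairs. -/
theorem proposition2 {R : Type u} [CommRing R] [IsNoetherianRing R] :
    (∀ (S' : Type u) [CommRing S'] [IsNoetherianRing S'] (φ : R →+* S') (ψ : S' →+* R),
      SemiDual.IsRetractPair φ ψ →
      (∃ f₀ : SemiDual.S₀ R → SemiDual.S₀ S', SemiDual.IsInducedMap₀ φ f₀ ∧
        SemiDual.IsPerfectBijection SemiDual.S₀.le SemiDual.S₀.le f₀) ∧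
      (∃ g₀ : SemiDual.S₀ S' → SemiDual.S₀ R, SemiDual.IsInducedMap₀ ψ g₀ ∧
        SemiDual.IsPerfectBijection SemiDual.S₀.le SemiDual.S₀.le g₀) ∧
      (∃ f : SemiDual.S R → SemiDual.S S', SemiDual.IsInducedMap φ f ∧
        SemiDual.IsPerfectBijection SemiDual.S.le SemiDual.S.le f) ∧
      (∃ g : SemiDual.S S' → SemiDual.S R, SemiDual.IsInducedMap ψ g ∧
        SemiDual.IsPerfectBijection SemiDual.S.le SemiDual.S.le g)) ∧
    (∀ n : ℕ, IsNoetherianRing (MvPowerSeries (Fin n) R) ∧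
      SemiDual.IsRetractPair (MvPowerSeries.C : R →+* MvPowerSeries (Fin n) R)
        (MvPowerSeries.constantCoeff : MvPowerSeries (Fin n) R →+* R)) := by
  refine ⟨fun S' _ _ φ ψ h => ?_, fun n => ⟨inferInstance, SemiDual.isRetractPair_mvPowerSeries⟩⟩
  obtain ⟨h1, h2⟩ := h.exists_isPerfectBijection₀
  obtain ⟨h3, h4⟩ := h.exists_isPerfectBijection
  exact ⟨h1, h2, h3, h4⟩
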